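/- Let $V=\mathbb{R}^{2n}$, let $\mathcal{Q}=S^2V^*$ be the space of symmetric bilinear forms on $V$, dual to the space $S^2V$ of symmetric tensors through $q(p)=\mathrm{Tr}(q\circ p)$, and let $S^2V^{\geq 0}$ and $S^2V^{>0}$ be the cones of semi-positive and of positive definite tensors. For a linear subspace $P\subset\mathcal{Q}$ let $P^\circ\subset S^2V$ be its annihilator. For $d\geq 1$ let $\mathrm{Gr}_d^{\mathrm{mix}}(\mathcal{Q})$ be the space of $d$-dimensional linear subspaces $P\subset\mathcal{Q}$ with $P^\circ\cap S^2V^{>0}\neq\emptyset$, topologized as a subspace of the Grassmannian. Let $N$ be a closed connected manifold of dimension $d$ with universal cover $\tilde N$, let $\Gamma=\pi_1(N)$ act on $\tilde N$ by deck transformations, let $\rho:\Gamma\to\mathrm{SL}(V)$ be a homomorphism, and let $u:\tilde N\to\mathrm{Gr}_d^{\mathrm{mix}}(\mathcal{Q})$ be continuous and $\rho$-equivariant. Let $u^*\mathcal{E}=\{(x,q)\in \tilde N\times\mathcal{Q} : q\in u(x)\}$, let $\mathbb{S}u^*\mathcal{E}$ be the quotient of the complement of its zero section by positive scalars acting on $q$,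 and let $p:\mathbb{S}u^*\mathcal{E}\to\tilde N$ be the projection. The group $\Gamma$ acts on $\mathbb{S}u^*\mathcal{E}$ by $\gamma\cdot(x,[q])=(\gamma x,[\rho(\gamma)\cdot q])$. Suppose that there is an equivariant fitting flow, that is, a continuous flow $(\Phi_t)_{t\in\mathbb{R}}$ on $\mathbb{S}u^*\mathcal{E}$ that commutes with $\Gamma$ and such that for all $t>0$ and all $(x,q)\in u^*\mathcal{E}$ with $q\neq 0$ one can write $\Phi_t(x,[q])=(x',[q'])$ with $q'-q$ positive definite. Then: 1. $u$ is a topological embedding; 2. $u$ is a globally fitting map: for all $x\neq y$ in $\tilde N$ the subsets $\mathbb{P}(u(x)^\circ\cap S^2V^{\geq 0})$ and $\mathbb{P}(u(y)^\circ\cap S^2V^{\geq 0})$ of $\mathbb{P}(S^2V)$ are disjoint; 3. for every $\Gamma$-invariant length distance $\delta$ on $\tilde N$ inducing its topology (for instance the distance of the lift of a Riemannian metric on $N$) there exist $C,D>0$ such that for every $\xi\in\mathbb{S}u^*\mathcal{E}$ and all $s,t\in\mathbb{R}$ $$C^{-1}|s-t|-D\;\leq\;\delta\big(p(\Phi_s(\xi)),p(\Phi_t(\xi))\big)\;\leq\;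 C|s-t|+D;$$ 4. for all $x,y\in\tilde N$ there exist $\xi\in\mathbb{S}u^*\mathcal{E}$ and $t\geq 0$ with $p(\xi)=x$ and $p(\Phi_t(\xi))=y$; 5. $\Gamma$ is finitely generated and $\rho$ is a quasi-isometric embedding: for every finite generating set of $\Gamma$, with word distance $d_\Gamma$, and for the distance $d_G$ of a left-invariant Riemannian metric on $\mathrm{SL}(V)$, there exist $C,D>0$ such that $C^{-1}d_\Gamma(\gamma,\eta)-D\leq d_G(\rho(\gamma),\rho(\eta))\leq C\,d_\Gamma(\gamma,\eta)+D$ for all $\gamma,\eta\in\Gamma$. -/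

import Mathlib

open scoped Matrix

namespace FittingFlow

/-! ### Quadrics, symmetric tensors and pencils on `V = ℝ^m` -/

/-- The real vector space of symmetric `m × m` matrices. -/
def Sym (m : ℕ) : Submodule ℝ (Matrix (Fin m) (Fin m) ℝ) where
  carrier := {A | A.IsSymm}
  add_mem' := fun ha hb => ha.add hb
  zero_mem' := Matrix.isSymm_zero
  smul_mem' := fun c _ ha => ha.smul c

/-- `𝒬 = S²V*`: symmetric bilinear forms on `V = ℝ^m`, through their Gram matrices. -/
abbrev Quadric (m : ℕ) : Type := Sym m

/-- `S²V`: symmetric bilinear tensors on `V = ℝ^m`, through their matrices. -/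
abbrev SymTensor (m : ℕ) : Type := Sym m

/-- The pairing `q(p) = Tr (q ∘ p)` between `𝒬` and `S²V`. -/
def pairing {m : ℕ} (q : Quadric m) (p : SymTensor m) : ℝ :=
  Matrix.trace ((q : Matrix (Fin m) (Fin m) ℝ) * (p : Matrix (Fin m) (Fin m) ℝ))

/-- The annihilator `P° ⊆ S²V` of a linear subspace `P` of `𝒬`. -/
def annihilator {m : ℕ} (P : Submodule ℝ (Quadric m)) : Set (SymTensor m) :=
  {p | ∀ q ∈ P, pairing q p = 0}

/-- The Grassmannian of `d`-dimensional linear subspaces of `𝒬`. -/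
def Gr (d m : ℕ) : Type :=
  {P : Submodule ℝ (Quadric m) // Module.finrank ℝ P = d}

/-- The pencil spanned by a linearly independent `d`-tuple of quadrics. -/
def spanFrame {d m : ℕ} (b : {b : Fin d → Quadric m // LinearIndependent ℝ b}) : Gr d m :=
  ⟨Submodule.span ℝ (Set.range b.1), by simpa using finrank_span_eq_card b.2⟩

/-- The topology of the Grassmannian: the quotient topology from the space of
linearly independent `d`-tuples. -/
instance instTopologicalSpaceGr (d m : ℕ) : TopologicalSpace (Gr d m) :=
  TopologicalSpace.coinduced spanFrame inferInstance

/-- `P` is mixed if its annihilator contains a positive (definite) tensor. -/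
def IsMixed {d m : ℕ} (P : Gr d m) : Prop :=
  ∃ p ∈ annihilator P.1, (p : Matrix (Fin m) (Fin m) ℝ).PosDef

/-- The space of mixed pencils, with the subspace topology. -/
abbrev GrMix (d m : ℕ) : Type := {P : Gr d m // IsMixed P}

/-- The linear subspace of `𝒬` underlying a mixed pencil. -/
def GrMix.toSubmodule {d m : ℕ} (P : GrMix d m) : Submodule ℝ (Quadric m) := P.1.1

/-- The subset `ℙ(P° ∩ S²V^{≥0})` of `ℙ(S²V)`. -/
def projSlice {d m : ℕ} (P : GrMix d m) : Set (Projectivization ℝ (SymTensor m)) :=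
  {ℓ | ∃ (p : SymTensor m) (hp : p ≠ 0), p ∈ annihilator P.toSubmodule ∧
    (p : Matrix (Fin m) (Fin m) ℝ).PosSemidef ∧ ℓ = Projectivization.mk ℝ p hp}

/-- `u` is globally fitting: it is continuous and the sets `ℙ(u(x)° ∩ S²V^{≥0})` are
pairwise disjoint. -/
def IsGloballyFitting {M : Type*} [TopologicalSpace M] {d m : ℕ} (u : M → GrMix d m) : Prop :=
  Continuous u ∧ ∀ x y : M, x ≠ y → Disjoint (projSlice (u x)) (projSlice (u y))

/-- The action of `g ∈ SL(V)` on `𝒬 = S²V*`, `(g · q)(v, w) = q(g⁻¹ v, g⁻¹ w)`. -/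
def actQuadric {m : ℕ} (g : Matrix.SpecialLinearGroup (Fin m) ℝ) :
    Quadric m →ₗ[ℝ] Quadric m where
  toFun q := ⟨((g⁻¹ : Matrix.SpecialLinearGroup (Fin m) ℝ) : Matrix (Fin m) (Fin m) ℝ)ᵀ *
      (q : Matrix (Fin m) (Fin m) ℝ) *
      ((g⁻¹ : Matrix.SpecialLinearGroup (Fin m) ℝ) : Matrix (Fin m) (Fin m) ℝ), by
    have hq : (q : Matrix (Fin m) (Fin m) ℝ)ᵀ = q := q.2
    change (_ * _ * _)ᵀ = _ * _ * _
    rw [Matrix.transpose_mul, Matrix.transpose_mul, hq, Matrix.transpose_transpose,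
      Matrix.mul_assoc]⟩
  map_add' q r := by
    ext1
    simp [Matrix.mul_add, Matrix.add_mul]
  map_smul' c q := by
    ext1
    simp

theorem actQuadric_inv {m : ℕ} (g : Matrix.SpecialLinearGroup (Fin m) ℝ) (q : Quadric m) :
    actQuadric g⁻¹ (actQuadric g q) = q := by
  ext1
  have h : ((g⁻¹ : Matrix.SpecialLinearGroup (Fin m) ℝ) : Matrix (Fin m) (Fin m) ℝ) *
      (g : Matrix (Fin m) (Fin m) ℝ) = 1 := by
    rw [← Matrix.SpecialLinearGroup.coe_mul, inv_mul_cancel, Matrix.SpecialLinearGroup.coe_one]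
  have h' : (g : Matrix (Fin m) (Fin m) ℝ)ᵀ *
      ((g⁻¹ : Matrix.SpecialLinearGroup (Fin m) ℝ) : Matrix (Fin m) (Fin m) ℝ)ᵀ = 1 := by
    rw [← Matrix.transpose_mul, h, Matrix.transpose_one]
  simp only [actQuadric, LinearMap.coe_mk, AddHom.coe_mk, inv_inv]
  calc _ = ((g : Matrix (Fin m) (Fin m) ℝ)ᵀ *
      ((g⁻¹ : Matrix.SpecialLinearGroup (Fin m) ℝ) : Matrix (Fin m) (Fin m) ℝ)ᵀ) *
      (q : Matrix (Fin m) (Fin m) ℝ) *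
      (((g⁻¹ : Matrix.SpecialLinearGroup (Fin m) ℝ) : Matrix (Fin m) (Fin m) ℝ) *
      (g : Matrix (Fin m) (Fin m) ℝ)) := by simp only [Matrix.mul_assoc]
    _ = _ := by rw [h, h', Matrix.one_mul, Matrix.mul_one]

/-! ### Deck transformations and equivariance -/

/-- The group of deck transformations of `π : M → N`. When `π` is the universal covering of
a closed connected manifold `N`, this is the group `Γ = π₁(N)` with its action on `M = Ñ`. -/
def deckGroup {M N : Type*} [TopologicalSpace M] (π : M → N) : Subgroup (M ≃ₜ M) where
  carrier := {φ | ∀ x, π (φ x) = π x}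
  mul_mem' := by
    intro φ ψ hφ hψ x
    rw [Homeomorph.mul_apply, hφ, hψ]
  one_mem' := fun _ => rfl
  inv_mem' := by
    intro φ hφ x
    have h := hφ (φ⁻¹ x)
    rw [← Homeomorph.mul_apply, mul_inv_cancel] at h
    exact h.symm

/-- `u` is `ρ`-equivariant: `u(γ x) = ρ(γ) · u(x)` for every deck transformation `γ`. -/
def IsEquivariant {M N : Type*} [TopologicalSpace M] {π : M → N} {d m : ℕ}
    (ρ : deckGroup π →* Matrix.SpecialLinearGroup (Fin m) ℝ) (u : M → GrMix d m) : Prop :=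
  ∀ (γ : deckGroup π) (x : M),
    (u (γ.1 x)).toSubmodule = (u x).toSubmodule.map (actQuadric (ρ γ))

/-! ### The sphere bundle `𝕊u*ℰ` -/

/-- The pulled back tautological bundle `u*ℰ` without its zero section, as a subspace of
`M × 𝒬`. -/
abbrev PunctBundle {M : Type*} {d m : ℕ} (u : M → GrMix d m) : Type _ :=
  {v : M × Quadric m // v.2 ∈ (u v.1).toSubmodule ∧ v.2 ≠ 0}

/-- Two non-zero vectors of `u*ℰ` are identified if they lie in the same fiber and differ by a
positive scalar. -/
def raySetoid {M : Type*} {d m : ℕ} (u : M → GrMix d m) : Setoid (PunctBundle u) where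
  r v w := v.1.1 = w.1.1 ∧ ∃ c : ℝ, 0 < c ∧ w.1.2 = c • v.1.2
  iseqv :=
    { refl := fun _ => ⟨rfl, 1, one_pos, (one_smul ℝ _).symm⟩
      symm := by
        rintro v w ⟨h, c, hc, e⟩
        exact ⟨h.symm, c⁻¹, inv_pos.mpr hc, by rw [e, smul_smul, inv_mul_cancel₀ hc.ne', one_smul]⟩
      trans := by
        rintro v w z ⟨h, c, hc, e⟩ ⟨h', c', hc', e'⟩
        exact ⟨h.trans h', c' * c, mul_pos hc' hc, by rw [e', e, smul_smul]⟩ }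

/-- The sphere bundle `𝕊u*ℰ`, the quotient of `u*ℰ` minus its zero section by positive scalars,
with the quotient topology. -/
abbrev SphereBundle {M : Type*} {d m : ℕ} (u : M → GrMix d m) : Type _ :=
  Quotient (raySetoid u)

/-- The class `[q]` in `𝕊u*ℰ` of a non-zero vector `q` of `u*ℰ`. -/
def SphereBundle.mk {M : Type*} {d m : ℕ} {u : M → GrMix d m} (v : PunctBundle u) :
    SphereBundle u :=
  Quotient.mk (raySetoid u) v

/-- The bundle projection `p : 𝕊u*ℰ → M`. -/
def SphereBundle.proj {M : Type*} {d m : ℕ} {u : M → GrMix d m} : SphereBundle u → M :=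
  Quotient.lift (fun v : PunctBundle u => v.1.1) (fun _ _ h => h.1)

/-- The action of a deck transformation on `u*ℰ` minus its zero section,
`γ · (x, q) = (γ x, ρ(γ) · q)`. -/
def PunctBundle.act {M N : Type*} [TopologicalSpace M] {π : M → N} {d m : ℕ}
    {ρ : deckGroup π →* Matrix.SpecialLinearGroup (Fin m) ℝ} {u : M → GrMix d m}
    (hu : IsEquivariant ρ u) (γ : deckGroup π) (v : PunctBundle u) : PunctBundle u :=
  ⟨(γ.1 v.1.1, actQuadric (ρ γ) v.1.2), by
    refine ⟨?_, fun h => v.2.2 ?_⟩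
    · rw [hu γ v.1.1]
      exact Submodule.mem_map_of_mem v.2.1
    · rw [← actQuadric_inv (ρ γ) v.1.2]
      exact (congrArg (actQuadric (ρ γ)⁻¹) h).trans (map_zero _)⟩

/-- The induced action of a deck transformation on `𝕊u*ℰ`. -/
def SphereBundle.act {M N : Type*} [TopologicalSpace M] {π : M → N} {d m : ℕ}
    {ρ : deckGroup π →* Matrix.SpecialLinearGroup (Fin m) ℝ} {u : M → GrMix d m}
    (hu : IsEquivariant ρ u) (γ : deckGroup π) : SphereBundle u → SphereBundle u :=
  Quotient.map' (s₁ := raySetoid u) (s₂ := raySetoid u) (PunctBundle.act hu γ) (by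
    rintro v w ⟨h, c, hc, e⟩
    exact ⟨congrArg γ.1 h, c, hc, (congrArg (actQuadric (ρ γ)) e).trans (map_smul _ c _)⟩)

/-! ### Fitting flows -/

/-- A continuous flow `Φ` on `𝕊u*ℰ` is fitting if for all `t > 0` and all `q`, some
representative `q'` of `Φ_t [q]` is such that `q' - q` is a positive (definite) quadric. -/
def IsFittingFlow {M : Type*} [TopologicalSpace M] {d m : ℕ} {u : M → GrMix d m}
    (Φ : Flow ℝ (SphereBundle u)) : Prop :=
  ∀ t : ℝ, 0 < t → ∀ v : PunctBundle u, ∃ w : PunctBundle u,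
    SphereBundle.mk w = Φ t (SphereBundle.mk v) ∧
      ((w.1.2 - v.1.2 : Quadric m) : Matrix (Fin m) (Fin m) ℝ).PosDef

/-- The flow commutes with the action of the deck transformations on `𝕊u*ℰ`. -/
def IsEquivariantFlow {M N : Type*} [TopologicalSpace M] {π : M → N} {d m : ℕ}
    {ρ : deckGroup π →* Matrix.SpecialLinearGroup (Fin m) ℝ} {u : M → GrMix d m}
    (hu : IsEquivariant ρ u) (Φ : Flow ℝ (SphereBundle u)) : Prop :=
  ∀ (γ : deckGroup π) (t : ℝ) (ξ : SphereBundle u),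
    Φ t (SphereBundle.act hu γ ξ) = SphereBundle.act hu γ (Φ t ξ)

/-! ### Coarse geometry -/

/-- `δ` is a distance on `M` that induces the topology of `M`, is invariant under the deck
transformations of `π`, and is a length distance: `δ x y` is approximated by lengths (suprema
over subdivisions) of paths from `x` to `y`. The Riemannian distance of the lift to `M` of any
Riemannian metric on `N` is of this kind. -/
structure IsInvariantLengthDist {M N : Type*} [TopologicalSpace M] (π : M → N)
    (δ : M → M → ℝ) : Prop where
  eq_zero_iff : ∀ x y, δ x y = 0 ↔ x = y
  symm : ∀ x y, δ x y = δ y x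
  triangle : ∀ x y z, δ x z ≤ δ x y + δ y z
  isOpen_iff : ∀ s : Set M, IsOpen s ↔ ∀ x ∈ s, ∃ r > 0, ∀ y, δ x y < r → y ∈ s
  invariant : ∀ γ ∈ deckGroup π, ∀ x y, δ (γ x) (γ y) = δ x y
  length : ∀ x y, ∀ ε > 0, ∃ c : Path x y, ∀ (k : ℕ) (t : Fin (k + 1) → unitInterval),
    Monotone t → ∑ i : Fin k, δ (c (t i.castSucc)) (c (t i.succ)) ≤ δ x y + ε

/-- `c : ℝ → M` is a `(C, D)`-quasi-geodesic for the distance `δ`. -/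
def IsQuasiGeodesic {M : Type*} (δ : M → M → ℝ) (C D : ℝ) (c : ℝ → M) : Prop :=
  ∀ s t : ℝ, C⁻¹ * |s - t| - D ≤ δ (c s) (c t) ∧ δ (c s) (c t) ≤ C * |s - t| + D

/-- Word length of `γ` with respect to `S`: the least length of a word in the elements of `S`
and their inverses that represents `γ`. -/
noncomputable def wordLength {Γ : Type*} [Group Γ] (S : Finset Γ) (γ : Γ) : ℕ :=
  sInf {k | ∃ l : List Γ, l.length = k ∧ (∀ s ∈ l, s ∈ S ∨ s⁻¹ ∈ S) ∧ l.prod = γ}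

/-- `c` restricts on `[0, 1]` to a `C¹` curve from `g` to `h` in `SL(m, ℝ)`. -/
def IsCurveInSL {m : ℕ} (g h : Matrix.SpecialLinearGroup (Fin m) ℝ)
    (c : ℝ → Matrix (Fin m) (Fin m) ℝ) : Prop :=
  (∀ i j, ContDiff ℝ 1 fun t => c t i j) ∧ (∀ t, (c t).det = 1) ∧ c 0 = g ∧ c 1 = h

/-- The length `∫₀¹ ‖c(t)⁻¹ c'(t)‖ dt` of a `C¹` curve on `[0, 1]`, for the left-invariant
Riemannian metric on `SL(m, ℝ)` given at the identity by `⟨X, Y⟩ = Tr (Xᵀ Y)`. -/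
noncomputable def curveLength {m : ℕ} (c : ℝ → Matrix (Fin m) (Fin m) ℝ) : ℝ :=
  ∫ t in (0 : ℝ)..1,
    √(∑ i, ∑ j, (((c t)⁻¹ * Matrix.of fun k l => deriv (fun s => c s k l) t) i j) ^ 2)

/-- The left-invariant Riemannian distance on `SL(m, ℝ)`. -/
noncomputable def slDist {m : ℕ} (g h : Matrix.SpecialLinearGroup (Fin m) ℝ) : ℝ :=
  sInf {L | ∃ c : ℝ → Matrix (Fin m) (Fin m) ℝ, IsCurveInSL g h c ∧ L = curveLength c}

/-- `ρ : Γ → SL(m, ℝ)` is a quasi-isometric embedding: `Γ` is finitely generated, and for the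
word distance of any finite generating set `ρ` is a quasi-isometric embedding into `SL(m, ℝ)`
with a left-invariant Riemannian distance. -/
def IsQuasiIsometricEmbedding {Γ : Type*} [Group Γ] {m : ℕ}
    (ρ : Γ →* Matrix.SpecialLinearGroup (Fin m) ℝ) : Prop :=
  Group.FG Γ ∧ ∀ S : Finset Γ, Subgroup.closure (S : Set Γ) = ⊤ →
    ∃ C D : ℝ, 0 < C ∧ 0 < D ∧ ∀ γ η : Γ,
      C⁻¹ * (wordLength S (γ⁻¹ * η) : ℝ) - D ≤ slDist (ρ γ) (ρ η) ∧
      slDist (ρ γ) (ρ η) ≤ C * (wordLength S (γ⁻¹ * η) : ℝ) + D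

end FittingFlow

open FittingFlow

open scoped Matrix

/-! The engine is uniform growth. As `N` is compact, `Γ` has a compact fundamental set `K`, and over
`K` fitting is uniform: for a unit quadric `q`, some positive multiple of the direction of `Φ 1 [q]`
exceeds `q` by `ε` times the Euclidean form, hence by `ε |q|`. This last inequality is insensitive
to scaling and to linear changes of variable, so equivariance spreads it to the whole bundle.
Iterated (`exists_growth`), it says that positive values of `q` grow at least like `b ^ k`, while
values that are still negative at time `k` have shrunk at least like `b ^ (-k)`, up to one common
scalar. Quadrics of mixed pencils take values of both signs, uniformly over `K`. Playing a positive
vector at time `0` against a negative vector at time `k` eliminates the unknown scalars: the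
holonomy between the translates of `K` met at these two times distorts Euclidean norms by at least
`a * b ^ k` (`exists_expansion`).

The topological heart is statement 4 (`exists_flow_proj_eq`), a degree argument. Fix the target `x`,
a positive tensor `p` annihilated by `u(x)`, and a path from `x` to the source `y`. For each point
of the path, flowing all rays of its fiber for times in `[0, R]` maps a `d`-ball into `M`. The
section sending `z` to the orthogonal projection of `p` to `u(z)`, pulled back to the ball, is a
vector field. By growth (`exists_inner_pos`), for `R` large it points along the flow on the
boundary, so it has degree one for every point of the path. For the ball centered at `x` its only
zero is the center, by fitting. Were `x` never reached from `y`, the zeros over a small neighborhood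
of `x` would disappear along the path, against invariance of the degree. Other zeros of the section
on `M` are not excluded, so the section is first perturbed to have no zero on the boundary of that
neighborhood. The degree theory required is a zero theorem for maps equal to the identity near
infinity, proved by integrating Jacobians.

Given flow lines between any two points, a semi-positive tensor annihilated at both ends contradicts
fitting, which gives global fitting and injectivity; a quantitative version of the same pairing
shows that `u` is inducing. Flow lines are quasi-geodesics because the distortion of the holonomy is
at least exponential in time and at most exponential in `δ`. Cutting flow lines into unit pieces
gives finitely many generators of `Γ` and bounds word length by flow time, while the distance in
`SL(V)` bounds the logarithm of the distortion from above (`IsCurveInSL.distortionLE`); hence `ρ` is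
a quasi-isometric embedding. -/

section

open MeasureTheory Metric Set Function

/-! ### A Brouwer type theorem, by integration of Jacobian determinants -/

section Brouwer

open Polynomial in
/-- The determinant of an endomorphism is determined by the determinants of its translates by
`n + 1` distinct scalars. -/
theorem exists_weights_det {E : Type*} [AddCommGroup E] [Module ℝ E] [FiniteDimensional ℝ E]
    (c : ℝ) : ∃ w : ℕ → ℝ, ∀ A : E →ₗ[ℝ] E, LinearMap.det A =
      ∑ i ∈ Finset.range (Module.finrank ℝ E + 1),
        w i * LinearMap.det ((c + i) • LinearMap.id + A) := by
  classical
  set s := Finset.range (Module.finrank ℝ E + 1)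
  -- Lagrange interpolation at the nodes `c + i`, evaluated at `0`: `t ↦ det (t + A)` is the
  -- characteristic polynomial of `-A`, of degree `finrank`, so `finrank + 1` nodes suffice.
  refine ⟨fun i => (Lagrange.basis s (fun i : ℕ => c + i) i).eval 0, fun A => ?_⟩
  have hinj : Set.InjOn (fun i : ℕ => c + (i : ℝ)) s := by
    intro i _ j _ h
    simpa using h
  have hdeg : (-A).charpoly.degree < s.card := by
    refine lt_of_le_of_lt degree_le_natDegree ?_
    rw [LinearMap.charpoly_natDegree]
    simp only [s, Finset.card_range]
    exact_mod_cast Nat.lt_succ_self _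
  have key := congrArg (Polynomial.eval 0) (Lagrange.eq_interpolate hinj hdeg)
  have hev : ∀ t : ℝ, Polynomial.eval t (-A).charpoly = LinearMap.det (t • LinearMap.id + A) := by
    intro t
    rw [LinearMap.eval_charpoly, sub_neg_eq_add]
    rfl
  rw [hev, Lagrange.interpolate_apply, eval_finsetSum] at key
  simp only [zero_smul, zero_add, eval_mul, eval_C, hev] at key
  rw [key]
  exact Finset.sum_congr rfl fun i _ => mul_comm _ _

variable {E : Type*} [NormedAddCommGroup E] [NormedSpace ℝ E] [FiniteDimensional ℝ E]

/-- A large multiple of the identity dominates a compactly supported Lipschitz map. -/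
theorem bijective_smul_add {φ : E → E} {C : NNReal} (hφ : LipschitzWith C φ) {l : ℝ}
    (hl : C < l) : Bijective fun x => l • x + φ x := by
  have hl0 : 0 < l := lt_of_le_of_lt C.2 hl
  refine ⟨fun x y h => ?_, fun y => ?_⟩
  · have h1 : l • (x - y) = φ y - φ x := by
      rw [smul_sub]
      have : l • x + φ x = l • y + φ y := h
      rw [sub_eq_sub_iff_add_eq_add, this]
      abel
    have h2 := hφ.dist_le_mul y x
    rw [dist_eq_norm, dist_eq_norm, ← h1, norm_smul, Real.norm_of_nonneg hl0.le,
      norm_sub_rev y x] at h2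
    have h3 : ‖x - y‖ = 0 := by
      by_contra hne
      have : 0 < ‖x - y‖ := lt_of_le_of_ne (norm_nonneg _) (Ne.symm hne)
      nlinarith
    exact sub_eq_zero.mp (norm_eq_zero.mp h3)
  -- Solving `l x + φ x = y` amounts to finding a fixed point of `x ↦ l⁻¹ (y - φ x)`, a contraction
  -- of ratio `C / l`.
  · set K : NNReal := C / ⟨l, hl0.le⟩
    have hK : ContractingWith K fun x => l⁻¹ • (y - φ x) := by
      refine ⟨?_, LipschitzWith.of_dist_le_mul fun a b => ?_⟩
      · rw [← NNReal.coe_lt_coe]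
        exact (div_lt_one hl0).mpr hl
      · have := hφ.dist_le_mul a b
        rw [dist_eq_norm, ← smul_sub, norm_smul, norm_inv, Real.norm_of_nonneg hl0.le,
          sub_sub_sub_cancel_left, ← dist_eq_norm, dist_comm]
        calc l⁻¹ * dist (φ a) (φ b) ≤ l⁻¹ * (C * dist a b) := by gcongr
          _ = K * dist a b := by
            rw [show (K : ℝ) = C / l from rfl]
            ring
    refine ⟨ContractingWith.fixedPoint _ hK, ?_⟩
    have h := hK.fixedPoint_isFixedPt
    have h' : l⁻¹ • (y - φ (ContractingWith.fixedPoint _ hK)) = ContractingWith.fixedPoint _ hK := h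
    have h'' : l • ContractingWith.fixedPoint _ hK = y - φ (ContractingWith.fixedPoint _ hK) := by
      conv_lhs => rw [← h']
      rw [smul_inv_smul₀ hl0.ne']
    simp only [h'']
    abel

variable [MeasurableSpace E] [BorelSpace E] (μ : Measure E) [μ.IsAddHaarMeasure]

/-- For large `l` the map `x ↦ l x + φ x` is a bijection with positive Jacobian that is
multiplication by `l` outside the ball. It therefore carries the ball of radius `R` onto the ball of
radius `l R`, and the integral is the volume of the image. -/
theorem integral_det_smul_add [Nontrivial E] {φ : E → E} (hφ : ContDiff ℝ 1 φ) {R : ℝ}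
    (hs : ∀ x, R ≤ ‖x‖ → φ x = 0) :
    ∃ c : ℝ, ∀ l, c ≤ l →
      ∫ x in ball (0 : E) R, (l • ContinuousLinearMap.id ℝ E + fderiv ℝ φ x).det ∂μ =
      l ^ Module.finrank ℝ E * μ.real (ball (0 : E) R) := by
  have hcs : HasCompactSupport φ :=
    HasCompactSupport.intro (isCompact_closedBall (0 : E) R) fun x hx => hs x (by
      simp at hx; exact hx.le)
  obtain ⟨C, hC⟩ := hφ.lipschitzWith_of_hasCompactSupport hcs one_ne_zero
  have hdet : ∀ᶠ A : E →L[ℝ] E in nhds (ContinuousLinearMap.id ℝ E), 0 < A.det := by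
    have : ContinuousAt (fun A : E →L[ℝ] E => A.det) (ContinuousLinearMap.id ℝ E) :=
      ContinuousLinearMap.continuous_det.continuousAt
    refine this.eventually (lt_mem_nhds ?_)
    simp [ContinuousLinearMap.det]
  obtain ⟨r, hr, hball⟩ := Metric.eventually_nhds_iff.mp hdet
  -- `l > C` gives bijectivity; `l > C / r` keeps `id + l⁻¹ Dφ` in the `r`-neighborhood of the
  -- identity where the determinant is positive.
  refine ⟨C / r + C + 1, fun l hl => ?_⟩
  have hCr : 0 ≤ C / r := by positivity
  have hC0 : (0 : ℝ) ≤ C := C.2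
  have hlC : (C : ℝ) < l := by linarith
  have hl0 : 0 < l := by linarith
  have hlr : C / r < l := by linarith
  have hbij := bijective_smul_add hC hlC
  have hd : ∀ x, HasFDerivAt (fun x => l • x + φ x)
      (l • ContinuousLinearMap.id ℝ E + fderiv ℝ φ x) x := fun x =>
    ((hasFDerivAt_id x).const_smul l).add
      ((hφ.differentiable one_ne_zero).differentiableAt.hasFDerivAt)
  have hpos : ∀ x, 0 < (l • ContinuousLinearMap.id ℝ E + fderiv ℝ φ x).det := by
    intro x
    have h1 : l • ContinuousLinearMap.id ℝ E + fderiv ℝ φ x =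
        l • (ContinuousLinearMap.id ℝ E + l⁻¹ • fderiv ℝ φ x) := by
      rw [smul_add, smul_inv_smul₀ hl0.ne']
    have h2 : 0 < (ContinuousLinearMap.id ℝ E + l⁻¹ • fderiv ℝ φ x).det := by
      apply hball
      rw [dist_eq_norm, add_sub_cancel_left, norm_smul, norm_inv, Real.norm_of_nonneg hl0.le]
      calc l⁻¹ * ‖fderiv ℝ φ x‖ ≤ l⁻¹ * C := by
            gcongr; exact norm_fderiv_le_of_lipschitz ℝ hC
        _ < r := by
            rw [inv_mul_lt_iff₀ hl0]
            rwa [div_lt_iff₀ hr] at hlr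
    rw [h1]
    unfold ContinuousLinearMap.det at h2 ⊢
    rw [ContinuousLinearMap.toLinearMap_smul, LinearMap.det_smul]
    positivity
  have himg : (fun x => l • x + φ x) '' ball 0 R = ball 0 (l * R) := by
    have hout : ∀ x, R ≤ ‖x‖ → l • x + φ x ∉ ball (0 : E) (l * R) := by
      intro x hx
      simp only [hs x hx, add_zero, mem_ball_zero_iff, norm_smul, Real.norm_of_nonneg hl0.le,
        not_lt]
      gcongr
    apply Subset.antisymm
    · rintro _ ⟨x, hx, rfl⟩
      by_contra hne
      simp only [mem_ball_zero_iff, not_lt] at hne hx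
      set y := l⁻¹ • (l • x + φ x) with hy
      have hyR : R ≤ ‖y‖ := by
        rw [hy, norm_smul, norm_inv, Real.norm_of_nonneg hl0.le, le_inv_mul_iff₀ hl0]
        exact hne
      have : l • y + φ y = l • x + φ x := by
        rw [hs y hyR, hy, smul_inv_smul₀ hl0.ne', add_zero]
      have hxy : y = x := hbij.1 this
      rw [hxy] at hyR
      linarith
    · intro y hy
      obtain ⟨x, hx⟩ := hbij.2 y
      refine ⟨x, ?_, hx⟩
      by_contra hne
      simp only [mem_ball_zero_iff, not_lt] at hne
      exact hout x hne (by rw [show l • x + φ x = y from hx]; exact hy)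
  have := integral_image_eq_integral_abs_det_fderiv_smul μ (measurableSet_ball (x := (0 : E)) (ε := R))
    (fun x _ => (hd x).hasFDerivWithinAt) hbij.1.injOn (fun _ => (1 : ℝ))
  rw [himg] at this
  simp only [smul_eq_mul, mul_one, integral_const, measureReal_restrict_apply_univ] at this
  rw [measureReal_def, Measure.addHaar_ball_mul μ _ hl0.le, ENNReal.toReal_mul,
    ENNReal.toReal_ofReal (by positivity)] at this
  rw [measureReal_def, this]
  exact integral_congr_ae (ae_of_all _ fun x => (abs_of_pos (hpos x)).symm)

theorem integrableOn_ball_of_continuous {f : E → ℝ} (hf : Continuous f) (R : ℝ) :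
    IntegrableOn f (ball 0 R) μ :=
  (hf.continuousOn.integrableOn_compact (isCompact_closedBall 0 R)).mono_set ball_subset_closedBall

/-- The Jacobian determinant of a compactly supported map has zero integral. -/
theorem integral_det_fderiv_eq_zero [Nontrivial E] {φ : E → E} (hφ : ContDiff ℝ 1 φ) {R : ℝ}
    (hs : ∀ x, R ≤ ‖x‖ → φ x = 0) :
    ∫ x in ball (0 : E) R, (fderiv ℝ φ x).det ∂μ = 0 := by
  obtain ⟨c, hc⟩ := integral_det_smul_add μ hφ hs
  obtain ⟨w, hw⟩ := exists_weights_det (E := E) c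
  have hw' : ∀ A : E →L[ℝ] E, A.det = ∑ i ∈ Finset.range (Module.finrank ℝ E + 1),
      w i * ((c + i) • ContinuousLinearMap.id ℝ E + A).det := fun A => hw A
  have hcont : Continuous fun x => fderiv ℝ φ x := hφ.continuous_fderiv one_ne_zero
  -- The integrals at the nodes do not depend on `φ`, so interpolation yields the same value as for
  -- `φ = 0`, and `det 0 = 0` in positive dimension.
  have h0 := hw' 0
  rw [integral_congr_ae (ae_of_all _ fun x => hw' (fderiv ℝ φ x)), integral_finsetSum]
  · have : ∀ i ∈ Finset.range (Module.finrank ℝ E + 1), ∫ x in ball (0 : E) R,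
        w i * ((c + i) • ContinuousLinearMap.id ℝ E + fderiv ℝ φ x).det ∂μ =
        w i * ((c + i) • ContinuousLinearMap.id ℝ E + 0).det * μ.real (ball (0 : E) R) := by
      intro i _
      rw [integral_const_mul, hc _ (by simp), mul_assoc]
      congr 2
      rw [add_zero]
      unfold ContinuousLinearMap.det
      rw [ContinuousLinearMap.toLinearMap_smul, LinearMap.det_smul]
      simp
    rw [Finset.sum_congr rfl this, ← Finset.sum_mul, ← h0]
    unfold ContinuousLinearMap.det
    rw [ContinuousLinearMap.toLinearMap_zero, LinearMap.det_zero, zero_pow Module.finrank_pos.ne', zero_mul]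
  · intro i _
    refine integrableOn_ball_of_continuous μ ?_ R
    exact continuous_const.mul (ContinuousLinearMap.continuous_det.comp (continuous_const.add hcont))


/-- The map applying a primitive of `b` to each coordinate. -/
theorem exists_hasFDerivAt_pi_primitive {ι : Type*} [Fintype ι] {b : ℝ → ℝ} (hb : Continuous b) :
    ∃ Θ : (ι → ℝ) → ι → ℝ, ContDiff ℝ 1 Θ ∧
      ∀ y, (fderiv ℝ Θ y).det = ∏ i, b (y i) := by
  set B : ℝ → ℝ := fun t => ∫ s in (0 : ℝ)..t, b s
  have hB : ∀ t, HasDerivAt B (b t) t := fun t =>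
    intervalIntegral.integral_hasDerivAt_right (hb.intervalIntegrable _ _)
      hb.aestronglyMeasurable.stronglyMeasurableAtFilter hb.continuousAt
  have hB1 : ContDiff ℝ 1 B := by
    rw [contDiff_one_iff_deriv]
    exact ⟨fun t => (hB t).differentiableAt, by rwa [show deriv B = b from funext fun t => (hB t).deriv]⟩
  refine ⟨fun y i => B (y i), contDiff_pi.mpr fun i => hB1.comp (contDiff_apply ℝ ℝ i), fun y => ?_⟩
  have hd : HasFDerivAt (fun (y : ι → ℝ) i => B (y i)) (ContinuousLinearMap.pi fun i =>
      (ContinuousLinearMap.toSpanSingleton ℝ (b (y i))).comp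
        (ContinuousLinearMap.proj (R := ℝ) (φ := fun _ : ι => ℝ) i)) y := by
    rw [hasFDerivAt_pi]
    intro i
    exact (hB (y i)).hasFDerivAt.comp y (ContinuousLinearMap.proj (R := ℝ) i).hasFDerivAt
  rw [hd.fderiv]
  have := LinearMap.det_pi (fun i => LinearMap.toSpanSingleton ℝ ℝ (b (y i)))
  calc _ = LinearMap.det (LinearMap.pi fun i => LinearMap.toSpanSingleton ℝ ℝ (b (y i)) ∘ₗ
        LinearMap.proj i) := rfl
    _ = _ := this
    _ = _ := by
      refine Finset.prod_congr rfl fun i _ => ?_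
      rw [LinearMap.det_ring]
      simp

/-- If `f` had no zero, a `C¹` approximation `F`, still the identity far away, would avoid a
neighborhood of `0`. Let `Θ` have as Jacobian a bump concentrated near `0`. After a cutoff `χ`, the
Jacobians of `χ Θ` and `χ (Θ ∘ F)` both integrate to zero and agree where `F` is the identity;
further in, the first is the bump and the second vanishes, so the difference has positive integral.
-/
theorem exists_zero_of_eq_id_pi {ι : Type*} [Fintype ι] [Nonempty ι] {f : (ι → ℝ) → ι → ℝ}
    (hf : Continuous f) {R : ℝ} (hfR : ∀ x, R ≤ ‖x‖ → f x = x) : ∃ x, f x = 0 := by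
  by_contra! hne
  wlog hR : 0 < R generalizing R
  · exact this (R := 1) (fun x hx => hfR x (by linarith)) one_pos
  obtain ⟨m, hm, hfm⟩ : ∃ m > 0, ∀ x, m ≤ ‖f x‖ := by
    obtain ⟨x₀, -, hx₀⟩ := (isCompact_closedBall (0 : ι → ℝ) R).exists_isMinOn
      ⟨0, by simp [hR.le]⟩ (hf.norm.continuousOn)
    refine ⟨min ‖f x₀‖ R, lt_min (norm_pos_iff.mpr (hne x₀)) hR, fun x => ?_⟩
    rcases le_total ‖x‖ R with h | h
    · exact (min_le_left _ _).trans (hx₀ (by simpa using h))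
    · rw [hfR x h]
      exact (min_le_right _ _).trans h
  obtain ⟨G, hG, hGd, hGs⟩ := (hf.sub continuous_id).exists_contDiff_approx (n := 1)
    (ε := fun _ => m / 2) continuous_const (fun _ => half_pos hm)
  set F : (ι → ℝ) → ι → ℝ := fun x => x + G x
  have hF : ContDiff ℝ 1 F := contDiff_id.add hG
  have hFR : ∀ x, R ≤ ‖x‖ → F x = x := by
    intro x hx
    have : G x = 0 := by
      by_contra h
      exact hGs h (by simp [hfR x hx])
    simp [F, this]
  have hFm : ∀ x, m / 2 ≤ ‖F x‖ := by
    intro x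
    have h1 := hGd x
    have h2 : f x - F x = (f x - x) - G x := by
      simp only [F]
      abel
    have h3 : ‖f x - F x‖ < m / 2 := by
      rw [h2, ← dist_eq_norm, dist_comm]
      exact h1
    have h4 := hfm x
    have h5 := norm_sub_norm_le (f x) (F x)
    linarith
  -- In the sup norm `‖F x‖ ≥ m / 2`, so some coordinate of `F x` lies outside the support of radius
  -- `m / 4` and the product of bumps vanishes at `F x`.
  set β : ContDiffBump (0 : ℝ) := ⟨m / 8, m / 4, by positivity, by linarith⟩
  obtain ⟨Θ, hΘ, hΘd⟩ := exists_hasFDerivAt_pi_primitive (ι := ι) β.continuous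
  set χ : ContDiffBump (0 : ι → ℝ) := ⟨R + 1, R + 2, by positivity, by linarith⟩
  have hχ : ContDiff ℝ 1 χ := χ.contDiff
  have hφ₁ : ContDiff ℝ 1 fun x => χ x • Θ (F x) := hχ.smul (hΘ.comp hF)
  have hφ₂ : ContDiff ℝ 1 fun x => χ x • Θ x := hχ.smul hΘ
  have hχ0 : ∀ x : ι → ℝ, R + 2 ≤ ‖x‖ → χ x = 0 := fun x hx =>
    χ.zero_of_le_dist (by simpa using hx)
  have h₁ := integral_det_fderiv_eq_zero volume hφ₁ (R := R + 2)
    (fun x hx => by rw [hχ0 x hx, zero_smul])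
  have h₂ := integral_det_fderiv_eq_zero volume hφ₂ (R := R + 2)
    (fun x hx => by rw [hχ0 x hx, zero_smul])
  set h : (ι → ℝ) → ℝ := fun x => (fderiv ℝ (fun x => χ x • Θ x) x).det -
    (fderiv ℝ (fun x => χ x • Θ (F x)) x).det
  have c₁ : Continuous fun x => (fderiv ℝ (fun x => χ x • Θ (F x)) x).det :=
    ContinuousLinearMap.continuous_det.comp (hφ₁.continuous_fderiv one_ne_zero)
  have c₂ : Continuous fun x => (fderiv ℝ (fun x => χ x • Θ x) x).det :=
    ContinuousLinearMap.continuous_det.comp (hφ₂.continuous_fderiv one_ne_zero)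
  have hint : ∫ x in ball 0 (R + 2), h x = 0 := by
    rw [integral_sub (integrableOn_ball_of_continuous _ c₂ _)
      (integrableOn_ball_of_continuous _ c₁ _), h₁, h₂, sub_zero]
  have hin : ∀ x, ‖x‖ ≤ R → h x = ∏ i, β (x i) := by
    intro x hx
    have hev : ∀ᶠ y in nhds x, χ y = 1 := by
      filter_upwards [isOpen_ball.mem_nhds (show x ∈ ball (0 : ι → ℝ) (R + 1) by
        simp; linarith)] with y hy
      exact χ.one_of_mem_closedBall (ball_subset_closedBall hy)
    have e₁ : fderiv ℝ (fun x => χ x • Θ (F x)) x = (fderiv ℝ Θ (F x)).comp (fderiv ℝ F x) := by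
      rw [← fderiv_comp x (hΘ.differentiable one_ne_zero).differentiableAt
        (hF.differentiable one_ne_zero).differentiableAt]
      refine Filter.EventuallyEq.fderiv_eq ?_
      filter_upwards [hev] with y hy
      rw [hy, one_smul]; rfl
    have e₂ : fderiv ℝ (fun x => χ x • Θ x) x = fderiv ℝ Θ x := by
      refine Filter.EventuallyEq.fderiv_eq ?_
      filter_upwards [hev] with y hy
      rw [hy, one_smul]
    have e₃ : ∏ i, β (F x i) = 0 := by
      obtain ⟨i, hi⟩ : ∃ i, m / 4 ≤ ‖F x i‖ := by
        by_contra! hlt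
        have := (pi_norm_lt_iff (by positivity)).mpr hlt
        linarith [hFm x]
      refine Finset.prod_eq_zero (Finset.mem_univ i) (β.zero_of_le_dist ?_)
      rw [dist_zero_right]
      exact hi
    have e₄ : ((fderiv ℝ Θ (F x)).comp (fderiv ℝ F x)).det =
        (fderiv ℝ Θ (F x)).det * (fderiv ℝ F x).det := LinearMap.det_comp _ _
    simp only [h]
    rw [e₁, e₂, e₄, hΘd, hΘd, e₃, zero_mul, sub_zero]
  have hout : ∀ x, R < ‖x‖ → h x = 0 := by
    intro x hx
    simp only [h]
    rw [sub_eq_zero]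
    congr 1
    refine Filter.EventuallyEq.fderiv_eq ?_
    filter_upwards [(isOpen_lt continuous_const continuous_norm).mem_nhds hx] with y hy
    rw [hFR y (le_of_lt hy)]
  have hnn : ∀ x, 0 ≤ h x := by
    intro x
    rcases le_or_gt ‖x‖ R with hx | hx
    · rw [hin x hx]
      exact Finset.prod_nonneg fun i _ => β.nonneg
    · rw [hout x hx]
  have hpos : 0 < ∫ x in ball 0 (R + 2), h x := by
    rw [setIntegral_pos_iff_support_of_nonneg_ae (ae_of_all _ hnn)
      (integrableOn_ball_of_continuous _ (c₂.sub c₁) _)]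
    refine ((c₂.sub c₁).isOpen_support.inter isOpen_ball).measure_pos _ ⟨0, ?_, ?_⟩
    · change h 0 ≠ 0
      rw [hin 0 (by simp [hR.le])]
      exact (Finset.prod_pos fun i _ => β.pos_of_mem_ball (by simp [β, hm])).ne'
    · simp; linarith
  exact hpos.ne' hint

end Brouwer

/-- A continuous self-map of a nonzero finite-dimensional space that is the identity outside a
bounded set has a zero. -/
theorem exists_zero_of_eq_id {E : Type*} [NormedAddCommGroup E] [NormedSpace ℝ E]
    [FiniteDimensional ℝ E] [Nontrivial E] {f : E → E} (hf : Continuous f) {R : ℝ}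
    (hfR : ∀ x, R ≤ ‖x‖ → f x = x) : ∃ x, f x = 0 := by
  set κ : E ≃L[ℝ] (Fin (Module.finrank ℝ E) → ℝ) :=
    (Module.finBasis ℝ E).equivFun.toContinuousLinearEquiv
  have : Nonempty (Fin (Module.finrank ℝ E)) := ⟨⟨0, Module.finrank_pos⟩⟩
  obtain ⟨x, hx⟩ := exists_zero_of_eq_id_pi (f := fun y => κ (f (κ.symm y)))
    (κ.continuous.comp (hf.comp κ.symm.continuous))
    (R := ‖(κ : E →L[ℝ] (Fin (Module.finrank ℝ E) → ℝ))‖ * max R 0 + 1) (by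
      intro y hy
      have h1 : ‖y‖ ≤ ‖(κ : E →L[ℝ] (Fin (Module.finrank ℝ E) → ℝ))‖ * ‖κ.symm y‖ := by
        simpa using (κ : E →L[ℝ] (Fin (Module.finrank ℝ E) → ℝ)).le_opNorm (κ.symm y)
      have h2 : max R 0 ≤ ‖κ.symm y‖ := by
        by_contra! hlt
        have := mul_le_mul_of_nonneg_left hlt.le
          (norm_nonneg (κ : E →L[ℝ] (Fin (Module.finrank ℝ E) → ℝ)))
        linarith
      rw [hfR _ ((le_max_left _ _).trans h2), κ.apply_symm_apply])
  exact ⟨κ.symm x, by simpa using hx⟩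

/-! ### Continuation of zeros of vector fields along a parameter -/

section Cylinder

/-- Truncation of a real number to `[0, 1]`. -/
noncomputable def clamp (t : ℝ) : ℝ := max 0 (min 1 t)

theorem continuous_clamp : Continuous clamp := by unfold clamp; fun_prop
theorem clamp_nonneg (t : ℝ) : 0 ≤ clamp t := le_max_left _ _
theorem clamp_le_one (t : ℝ) : clamp t ≤ 1 := max_le zero_le_one (min_le_left _ _)
theorem clamp_of_le_zero {t : ℝ} (h : t ≤ 0) : clamp t = 0 :=
  max_eq_left ((min_le_right _ _).trans h)
theorem clamp_of_one_le {t : ℝ} (h : 1 ≤ t) : clamp t = 1 := by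
  rw [clamp, min_eq_left h, max_eq_right zero_le_one]

open unitInterval RealInnerProductSpace

variable {E : Type*} [NormedAddCommGroup E] [InnerProductSpace ℝ E]

/-- Radial retraction onto the closed unit ball. -/
noncomputable def ballRetract (v : E) : closedBall (0 : E) 1 :=
  ⟨(max 1 ‖v‖)⁻¹ • v, by
    have h : 0 < max 1 ‖v‖ := lt_max_of_lt_left one_pos
    rw [mem_closedBall_zero_iff, norm_smul, norm_inv, Real.norm_of_nonneg h.le,
      inv_mul_le_iff₀ h, mul_one]
    exact le_max_right _ _⟩

theorem continuous_ballRetract : Continuous (ballRetract : E → closedBall (0 : E) 1) := by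
  refine Continuous.subtype_mk (Continuous.smul (Continuous.inv₀ (by fun_prop) fun v => ?_)
    continuous_id) _
  exact (lt_max_of_lt_left one_pos).ne'

/-- Radial projection to the unit sphere. -/
noncomputable def sphereProj (w₀ : sphere (0 : E) 1) (v : E) : sphere (0 : E) 1 := by
  classical
  exact if h : v = 0 then w₀ else ⟨‖v‖⁻¹ • v, by
    rw [mem_sphere_zero_iff_norm, norm_smul, norm_inv, norm_norm,
      inv_mul_cancel₀ (norm_ne_zero_iff.mpr h)]⟩

theorem coe_sphereProj (w₀ : sphere (0 : E) 1) {v : E} (h : v ≠ 0) :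
    (sphereProj w₀ v : E) = ‖v‖⁻¹ • v := by
  simp [sphereProj, h]

theorem continuousOn_sphereProj (w₀ : sphere (0 : E) 1) :
    ContinuousOn (sphereProj w₀) {v | v ≠ 0} := by
  rw [continuousOn_iff_continuous_domRestrict]
  refine continuous_induced_rng.mpr ?_
  have : Continuous fun v : {v : E | v ≠ 0} => ‖(v : E)‖⁻¹ • (v : E) :=
    (Continuous.inv₀ (by fun_prop) fun v => norm_ne_zero_iff.mpr v.2).smul continuous_subtype_val
  refine this.congr fun v => ?_
  exact (coe_sphereProj w₀ v.2).symm

/-- A sphere as a subset of the closed ball. -/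
def sphereToBall (w : sphere (0 : E) 1) : closedBall (0 : E) 1 := ⟨w, sphere_subset_closedBall w.2⟩

variable [FiniteDimensional ℝ E] [Nontrivial E]

/-- A vector field on `[0, 1] × B` whose boundary values are homotopic to the radial field has a
zero on the graph `s = τ` of any function `τ` with values in `[0, 1]`. -/
theorem exists_zero_on_graph {g : I × closedBall (0 : E) 1 → E} (hg : Continuous g)
    {c : I × I × sphere (0 : E) 1 → E} (hc : Continuous c) (hc0 : ∀ s w, c (s, 0, w) = w)
    (hcne : ∀ x, c x ≠ 0) (hpos : ∀ s w, 0 < ⟪g (s, sphereToBall w), c (s, 1, w)⟫)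
    {τ : I × closedBall (0 : E) 1 → ℝ} (hτ : Continuous τ) (hτ01 : ∀ x, τ x ∈ Icc (0 : ℝ) 1) :
    ∃ x, g x = 0 ∧ τ x = x.1 := by
  obtain ⟨w₀, hw₀⟩ := (NormedSpace.sphere_nonempty (x := (0 : E)) (r := 1)).mpr zero_le_one
  set sb : ℝ → I := projIcc 0 1 zero_le_one
  have hsb : Continuous sb := continuous_projIcc
  set base : ℝ × E → I × closedBall (0 : E) 1 := fun x => (sb x.1, ballRetract x.2)
  have hbase : Continuous base :=
    (hsb.comp continuous_fst).prodMk (continuous_ballRetract.comp continuous_snd)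
  set ω : E → sphere (0 : E) 1 := sphereProj ⟨w₀, hw₀⟩
  -- Extension to the exterior of the ball without new zeros. For `1 ≤ ‖v‖ ≤ 2` it interpolates from
  -- `g` to `c (s, 1, ·)`, with which `g` has positive inner product; for `2 ≤ ‖v‖ ≤ 3` it runs the
  -- homotopy `c` back to the radial field; for `3 ≤ ‖v‖ ≤ 4` it rescales this to `v`.
  set outer : ℝ × E → E := fun x => (1 - clamp (‖x.2‖ - 1)) • g (base x) +
    (clamp (‖x.2‖ - 1) * (1 + (‖x.2‖ - 1) * clamp (‖x.2‖ - 3))) •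
      c (sb x.1, sb (3 - ‖x.2‖), ω x.2) with houter
  set G : ℝ × E → E := fun x => if ‖x.2‖ ≤ 1 then g (base x) else outer x with hGdef
  have hG : Continuous G := by
    refine continuous_if_le (by fun_prop) continuous_const (hg.comp hbase).continuousOn ?_ ?_
    · have h1 : ContinuousOn (fun x : ℝ × E => ω x.2) {x | 1 ≤ ‖x.2‖} :=
        (continuousOn_sphereProj _).comp continuous_snd.continuousOn fun x hx => by
          have : 1 ≤ ‖x.2‖ := hx
          exact norm_pos_iff.mp (by linarith)
      have h2 : ContinuousOn (fun x : ℝ × E => (sb x.1, sb (3 - ‖x.2‖), ω x.2)) {x | 1 ≤ ‖x.2‖} :=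
        (hsb.comp continuous_fst).continuousOn.prodMk
          ((hsb.comp (by fun_prop)).continuousOn.prodMk h1)
      have h3 : Continuous fun x : ℝ × E => clamp (‖x.2‖ - 1) := continuous_clamp.comp (by fun_prop)
      have h4 : Continuous fun x : ℝ × E => clamp (‖x.2‖ - 3) := continuous_clamp.comp (by fun_prop)
      exact ((continuous_const.sub h3).smul (hg.comp hbase)).continuousOn.add
        (ContinuousOn.smul (h3.mul (by fun_prop)).continuousOn
          (hc.comp_continuousOn h2))
    · intro x hx
      simp [outer, hx, clamp_of_le_zero]
  have hω : ∀ v : E, 1 ≤ ‖v‖ → ballRetract v = sphereToBall (ω v) := by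
    intro v hv
    apply Subtype.ext
    change (max 1 ‖v‖)⁻¹ • v = (ω v : E)
    rw [max_eq_right hv, coe_sphereProj _ (norm_pos_iff.mp (by linarith))]
  have hGout : ∀ x : ℝ × E, 1 ≤ ‖x.2‖ → G x = outer x := by
    intro x hx
    rcases hx.lt_or_eq with h | h
    · simp only [hGdef, if_neg (not_le.mpr h)]
    · simp only [hGdef, if_pos h.symm.le]
      simp [outer, ← h, clamp_of_le_zero]
  have hGne : ∀ x : ℝ × E, 1 ≤ ‖x.2‖ → G x ≠ 0 := by
    intro x hx
    rw [hGout x hx]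
    have hl : 0 < 1 + (‖x.2‖ - 1) * clamp (‖x.2‖ - 3) :=
      add_pos_of_pos_of_nonneg one_pos (mul_nonneg (by linarith) (clamp_nonneg _))
    rcases le_or_gt 2 ‖x.2‖ with h | h
    · have : clamp (‖x.2‖ - 1) = 1 := clamp_of_one_le (by linarith)
      simp only [outer, this, sub_self, zero_smul, zero_add, one_mul]
      exact smul_ne_zero hl.ne' (hcne _)
    · intro h0
      have hb : sb (3 - ‖x.2‖) = 1 := by
        apply Subtype.ext
        simp only [sb, coe_projIcc, Icc.coe_one]
        rw [min_eq_left (by linarith), max_eq_right zero_le_one]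
      have h1 := congrArg (fun y => ⟪y, c (sb x.1, 1, ω x.2)⟫) h0
      simp only [outer, hb, inner_add_left, real_inner_smul_left, inner_zero_left] at h1
      have h2 : 0 < ⟪g (base x), c (sb x.1, 1, ω x.2)⟫ := by
        have := hpos (sb x.1) (ω x.2)
        rwa [← hω _ hx] at this
      have h3 : 0 < ⟪c (sb x.1, 1, ω x.2), c (sb x.1, 1, ω x.2)⟫ :=
        real_inner_self_pos.mpr (hcne _)
      have h4 := clamp_nonneg (‖x.2‖ - 1)
      have h5 := clamp_le_one (‖x.2‖ - 1)
      rcases h4.lt_or_eq with h6 | h6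
      · have := mul_pos (mul_pos h6 hl) h3
        have := mul_nonneg (sub_nonneg.mpr h5) h2.le
        linarith
      · rw [← h6] at h1
        linarith
  have hGid : ∀ x : ℝ × E, 4 ≤ ‖x.2‖ → G x = x.2 := by
    intro x hx
    rw [hGout x (by linarith)]
    have hb : sb (3 - ‖x.2‖) = 0 := by
      apply Subtype.ext
      simp only [sb, coe_projIcc, Icc.coe_zero]
      exact max_eq_left ((min_le_right _ _).trans (by linarith))
    simp only [outer, hb, hc0]
    rw [clamp_of_one_le (by linarith), clamp_of_one_le (by linarith),
      coe_sphereProj _ (norm_pos_iff.mp (by linarith)), smul_smul, sub_self, zero_smul, zero_add]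
    have : ‖x.2‖ ≠ 0 := by linarith
    rw [show 1 * (1 + (‖x.2‖ - 1) * 1) * ‖x.2‖⁻¹ = 1 by field_simp; ring, one_smul]
  -- The equations `s = τ` and `G = 0` become one map that is the identity far away. At a zero the
  -- first component forces `s ∈ [0, 1]`, so `G` vanishes there and `‖v‖ < 1`, a region where the
  -- cutoffs have no effect.
  set F : ℝ × E → ℝ × E := fun x =>
    (x.1 - clamp (2 - |x.1|) * clamp (2 - ‖x.2‖) * τ (base x),
      G x + clamp (|x.1| - 1) • (x.2 - G x)) with hFdef
  have hF : Continuous F := by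
    have h1 : Continuous fun x : ℝ × E => clamp (2 - |x.1|) := continuous_clamp.comp (by fun_prop)
    have h2 : Continuous fun x : ℝ × E => clamp (2 - ‖x.2‖) := continuous_clamp.comp (by fun_prop)
    have h3 : Continuous fun x : ℝ × E => clamp (|x.1| - 1) := continuous_clamp.comp (by fun_prop)
    exact (continuous_fst.sub ((h1.mul h2).mul (hτ.comp hbase))).prodMk
      (hG.add (h3.smul (continuous_snd.sub hG)))
  obtain ⟨x, hx⟩ := exists_zero_of_eq_id hF (R := 4) (by
    intro x hx
    rw [Prod.norm_def, le_max_iff, Real.norm_eq_abs] at hx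
    apply Prod.ext
    · simp only [hFdef]
      rcases hx with h | h
      · rw [clamp_of_le_zero (by linarith : 2 - |x.1| ≤ 0), zero_mul, zero_mul, sub_zero]
      · rw [clamp_of_le_zero (by linarith : 2 - ‖x.2‖ ≤ 0), mul_zero, zero_mul, sub_zero]
    · simp only [hFdef]
      rcases hx with h | h
      · rw [clamp_of_one_le (by linarith : 1 ≤ |x.1| - 1), one_smul, add_sub_cancel]
      · rw [hGid x h, sub_self, smul_zero, add_zero])
  have hx1 : x.1 - clamp (2 - |x.1|) * clamp (2 - ‖x.2‖) * τ (base x) = 0 := congrArg Prod.fst hx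
  have hx2 : G x + clamp (|x.1| - 1) • (x.2 - G x) = 0 := congrArg Prod.snd hx
  have hmem : x.1 ∈ Icc (0 : ℝ) 1 := by
    rw [sub_eq_zero.mp hx1]
    have a1 := clamp_nonneg (2 - |x.1|)
    have a2 := clamp_nonneg (2 - ‖x.2‖)
    exact ⟨mul_nonneg (mul_nonneg a1 a2) (hτ01 _).1,
      mul_le_one₀ (mul_le_one₀ (clamp_le_one _) a2 (clamp_le_one _)) (hτ01 _).1 (hτ01 _).2⟩
  have habs : |x.1| = x.1 := abs_of_nonneg hmem.1
  rw [habs, clamp_of_le_zero (by linarith [hmem.2]), zero_smul, add_zero] at hx2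
  have hn : ‖x.2‖ < 1 := by
    by_contra! h
    exact hGne x h hx2
  rw [habs, clamp_of_one_le (by linarith [hmem.2]), clamp_of_one_le (by linarith), one_mul,
    one_mul, sub_eq_zero] at hx1
  refine ⟨base x, ?_, ?_⟩
  · simpa only [hGdef, if_pos hn.le] using hx2
  · rw [← hx1]
    simp only [base, sb, projIcc_of_mem zero_le_one hmem]

end Cylinder

/-! ### Transport and general position in continuous families of subspaces -/

section Transport

open unitInterval RealInnerProductSpace

variable {Q : Type*} [NormedAddCommGroup Q] [InnerProductSpace ℝ Q]

/-- The operator intertwining two nearby projections. -/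
noncomputable def intertwiner (P P' : Q →L[ℝ] Q) : Q →L[ℝ] Q := P' * P + (1 - P') * (1 - P)

theorem intertwiner_mul {P P' : Q →L[ℝ] Q} (hP : P * P = P) (hP' : P' * P' = P') :
    intertwiner P P' * P = P' * intertwiner P P' := by
  have h1 : (1 - P) * P = 0 := by rw [sub_mul, one_mul, hP, sub_self]
  have h2 : P' * (1 - P') = 0 := by rw [mul_sub, mul_one, hP', sub_self]
  rw [intertwiner, add_mul, mul_add, mul_assoc, hP, mul_assoc, h1, mul_zero, add_zero,
    ← mul_assoc, hP', ← mul_assoc, h2, zero_mul, add_zero]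

theorem intertwiner_self {P : Q →L[ℝ] Q} (hP : P * P = P) : intertwiner P P = 1 := by
  rw [intertwiner, hP, sub_mul, one_mul, mul_sub, hP, mul_one]
  abel

theorem norm_intertwiner_le {P P' : Q →L[ℝ] Q} (h1 : ‖P‖ ≤ 1) (h2 : ‖P'‖ ≤ 1)
    (h3 : ‖1 - P‖ ≤ 1) (h4 : ‖1 - P'‖ ≤ 1) : ‖intertwiner P P'‖ ≤ 2 := by
  calc ‖intertwiner P P'‖ ≤ ‖P'‖ * ‖P‖ + ‖1 - P'‖ * ‖1 - P‖ :=
        (norm_add_le _ _).trans (add_le_add (norm_mul_le _ _) (norm_mul_le _ _))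
    _ ≤ 1 * 1 + 1 * 1 := by gcongr
    _ = 2 := by norm_num

variable [FiniteDimensional ℝ Q]

/-- By idempotence the intertwiner differs from `1` by `P' (P' - P) + (P - P') P`, of norm less than
`1`. -/
theorem isUnit_intertwiner {P P' : Q →L[ℝ] Q} (hP : P * P = P) (hP' : P' * P' = P')
    (h1 : ‖P‖ ≤ 1) (h2 : ‖P'‖ ≤ 1) (h : ‖P - P'‖ < 1 / 2) : IsUnit (intertwiner P P') := by
  have e : intertwiner P P' = 1 - (P' * (P' - P) + (P - P') * P) := by
    have e1 : P' * (P' - P) = P' - P' * P := by rw [mul_sub, hP']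
    have e2 : (P - P') * P = P - P' * P := by rw [sub_mul, hP]
    rw [e1, e2, intertwiner, sub_mul, one_mul, mul_sub, mul_one]
    abel
  rw [e]
  apply isUnit_one_sub_of_norm_lt_one
  calc ‖P' * (P' - P) + (P - P') * P‖ ≤ ‖P'‖ * ‖P' - P‖ + ‖P - P'‖ * ‖P‖ :=
        (norm_add_le _ _).trans (add_le_add (norm_mul_le _ _) (norm_mul_le _ _))
    _ ≤ 1 * ‖P' - P‖ + ‖P - P'‖ * 1 := by gcongr
    _ < 1 := by rw [norm_sub_rev P' P]; linarith

theorem starProjection_mul_self (U : Submodule ℝ Q) :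
    U.starProjection * U.starProjection = U.starProjection := U.isIdempotentElem_starProjection

theorem norm_one_sub_starProjection_le (U : Submodule ℝ Q) : ‖1 - U.starProjection‖ ≤ 1 := by
  have : 1 - U.starProjection = Uᗮ.starProjection := by
    rw [Submodule.starProjection_orthogonal]; rfl
  rw [this]
  exact Submodule.starProjection_norm_le _

theorem continuous_ringInverse {X A : Type*} [TopologicalSpace X] [NormedRing A] [CompleteSpace A]
    {T : X → A} (hT : Continuous T) (hu : ∀ x, IsUnit (T x)) :
    Continuous fun x => Ring.inverse (T x) := by
  rw [continuous_iff_continuousAt]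
  intro x
  obtain ⟨w, hw⟩ := hu x
  have := NormedRing.inverse_continuousAt w
  rw [hw] at this
  exact this.comp hT.continuousAt

/-- Trivialization, along the interval direction, of a continuous family of subspaces. -/
theorem exists_transport {X : Type*} [MetricSpace X] [CompactSpace X] {W : I × X → Submodule ℝ Q}
    (hW : Continuous fun a => (W a).starProjection) :
    ∃ T : I × X → Q →L[ℝ] Q, Continuous T ∧ (∀ x, T (0, x) = 1) ∧ (∀ a, IsUnit (T a)) ∧
      ∀ t x, T (t, x) * (W (0, x)).starProjection = (W (t, x)).starProjection * T (t, x) := by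
  have huc := CompactSpace.uniformContinuous_of_continuous hW
  obtain ⟨δ, hδ, hd⟩ := Metric.uniformContinuous_iff.mp huc (1 / 2) (by norm_num)
  -- The segment from `0` to `t` is cut into `k` equal steps shorter than `δ`. Consecutive
  -- projections are then within `1 / 2`, and the product of their intertwiners is the transport.
  obtain ⟨k, hk⟩ := exists_nat_gt (1 / δ)
  have hk0 : (0 : ℝ) < k := lt_trans (by positivity) hk
  set tm : ℕ → I × X → I × X := fun i a => (projIcc 0 1 zero_le_one ((a.1 : ℝ) * (i / k)), a.2)
  have htm : ∀ i, Continuous (tm i) := fun i =>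
    (continuous_projIcc.comp (by fun_prop)).prodMk continuous_snd
  set P : I × X → Q →L[ℝ] Q := fun a => (W a).starProjection
  set st : ℕ → I × X → Q →L[ℝ] Q := fun i a => intertwiner (P (tm i a)) (P (tm (i + 1) a))
  have hst : ∀ i, Continuous (st i) := by
    intro i
    have h1 := hW.comp (htm i)
    have h2 := hW.comp (htm (i + 1))
    exact (h2.mul h1).add ((continuous_const.sub h2).mul (continuous_const.sub h1))
  set T : ℕ → I × X → Q →L[ℝ] Q := fun j => Nat.rec (fun _ => 1) (fun i S a => st i a * S a) j
  have hT0 : ∀ a, T 0 a = 1 := fun _ => rfl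
  have hTs : ∀ i a, T (i + 1) a = st i a * T i a := fun _ _ => rfl
  have hidem : ∀ a, P a * P a = P a := fun a => starProjection_mul_self _
  have hclose : ∀ i a, ‖P (tm i a) - P (tm (i + 1) a)‖ < 1 / 2 := by
    intro i a
    rw [← dist_eq_norm]
    apply hd
    rw [Prod.dist_eq, dist_self, max_eq_left dist_nonneg]
    calc dist (tm i a).1 (tm (i + 1) a).1
        ≤ dist ((a.1 : ℝ) * (i / k)) ((a.1 : ℝ) * ((i + 1 : ℕ) / k)) := by
          have := (LipschitzWith.projIcc (zero_le_one (α := ℝ))).dist_le_mul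
            ((a.1 : ℝ) * (i / k)) ((a.1 : ℝ) * ((i + 1 : ℕ) / k))
          rwa [NNReal.coe_one, one_mul] at this
      _ = (a.1 : ℝ) * (1 / k) := by
          rw [Real.dist_eq, ← mul_sub, ← sub_div, abs_mul, abs_of_nonneg a.1.2.1]
          push_cast
          rw [show (i : ℝ) - (i + 1) = -1 by ring, abs_div, abs_neg, abs_one, abs_of_pos hk0]
      _ ≤ 1 * (1 / k) := by gcongr; exact a.1.2.2
      _ < δ := by rw [one_mul, one_div_lt hk0 hδ]; exact hk
  have hcont : ∀ i, Continuous (T i) := by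
    intro i
    induction i with
    | zero => exact continuous_const
    | succ i ih => exact (hst i).mul ih
  have hunit : ∀ i a, IsUnit (T i a) := by
    intro i a
    induction i with
    | zero => exact isUnit_one
    | succ i ih =>
      exact (isUnit_intertwiner (hidem _) (hidem _) (Submodule.starProjection_norm_le _)
        (Submodule.starProjection_norm_le _) (hclose i a)).mul ih
  have hint : ∀ i a, T i a * P (tm 0 a) = P (tm i a) * T i a := by
    intro i a
    induction i with
    | zero => rw [hT0, one_mul, mul_one]
    | succ i ih =>
      rw [hTs, mul_assoc, ih, ← mul_assoc, ← mul_assoc]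
      congr 1
      exact intertwiner_mul (hidem _) (hidem _)
  refine ⟨T k, hcont k, fun x => ?_, hunit k, fun t x => ?_⟩
  · have hconst : ∀ i, tm i ((0 : I), x) = (0, x) := by
      intro i
      simp only [tm, Icc.coe_zero, zero_mul]
      rw [projIcc_left]
      rfl
    have : ∀ i, T i (0, x) = 1 := by
      intro i
      induction i with
      | zero => rfl
      | succ i ih =>
        rw [hTs, ih, mul_one]
        simp only [st, hconst]
        exact intertwiner_self (hidem _)
    exact this k
  · have h0 : tm 0 (t, x) = (0, x) := by
      simp only [tm, Nat.cast_zero, zero_div, mul_zero]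
      rw [projIcc_left]
      rfl
    have hk' : tm k (t, x) = (t, x) := by
      simp only [tm, div_self hk0.ne', mul_one, projIcc_val]
    have := hint k (t, x)
    rwa [h0, hk'] at this

/-- A continuous map between spaces of equal dimension can be made nonzero on a sphere by a small
perturbation. -/
theorem exists_small_add_ne_zero {R E : Type*} [NormedAddCommGroup R] [InnerProductSpace ℝ R]
    [FiniteDimensional ℝ R] [NormedAddCommGroup E] [NormedSpace ℝ E] [FiniteDimensional ℝ E]
    [Nontrivial R] (hfr : Module.finrank ℝ E = Module.finrank ℝ R) {h : R → E} (hh : Continuous h)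
    (a : R) {ρ : ℝ} (hρ : 0 < ρ) {ε : ℝ} (hε : 0 < ε) :
    ∃ k : R → E, Continuous k ∧ (∀ y, ‖k y‖ < ε) ∧ ∀ y ∈ sphere a ρ, h y + k y ≠ 0 := by
  obtain ⟨h₁, hh₁, hd, -⟩ := hh.exists_contDiff_approx (n := 1) (ε := fun _ => ε / 2)
    continuous_const (fun _ => half_pos hε)
  borelize R
  set κ : E ≃L[ℝ] R := ContinuousLinearEquiv.ofFinrankEq hfr
  -- `h₁` restricted to the sphere and extended to be constant along rays: its derivative kills the
  -- radial direction, so its image is null. Subtracting a small vector outside the image makes `h₁`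
  -- nonzero on the sphere.
  set f : R → R := fun y => κ (h₁ (a + (ρ * ‖y‖⁻¹) • y)) with hf
  have hdiff : ∀ y ∈ {y : R | y ≠ 0}, DifferentiableAt ℝ f y := by
    intro y hy
    have hn : DifferentiableAt ℝ (fun y : R => ‖y‖) y := differentiableAt_id.norm ℝ hy
    have h2 : DifferentiableAt ℝ (fun y : R => a + (ρ * ‖y‖⁻¹) • y) y :=
      (differentiableAt_const a).add
        (((hn.inv (norm_ne_zero_iff.mpr hy)).const_mul ρ).smul differentiableAt_id)
    exact κ.differentiableAt.comp y
      (((hh₁.differentiable one_ne_zero).differentiableAt).comp y h2)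
  have hdet : ∀ y ∈ {y : R | y ≠ 0}, (fderiv ℝ f y).det = 0 := by
    intro y hy
    have hline : HasDerivAt (fun t : ℝ => f (y + t • y)) (fderiv ℝ f y y) 0 := by
      have h1 : HasDerivAt (fun t : ℝ => y + t • y) y 0 := by
        simpa using ((hasDerivAt_id (0 : ℝ)).smul_const y).const_add y
      have h2 : HasFDerivAt f (fderiv ℝ f y) (y + (0 : ℝ) • y) := by
        simpa using (hdiff y hy).hasFDerivAt
      exact h2.comp_hasDerivAt (0 : ℝ) h1
    have hconst : (fun t : ℝ => f (y + t • y)) =ᶠ[nhds 0] fun _ => f y := by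
      filter_upwards [Ioo_mem_nhds (show (-1 : ℝ) < 0 by norm_num) zero_lt_one] with t ht
      have h1 : 0 < 1 + t := by linarith [ht.1]
      have h2 : y + t • y = (1 + t) • y := by rw [add_smul, one_smul]
      simp only [hf, h2, norm_smul, Real.norm_of_nonneg h1.le, smul_smul]
      congr 4
      have : ‖y‖ ≠ 0 := norm_ne_zero_iff.mpr hy
      field_simp
    have hz : fderiv ℝ f y y = 0 :=
      hline.unique ((hasDerivAt_const (0 : ℝ) (f y)).congr_of_eventuallyEq hconst)
    by_contra hne
    have : Injective (fderiv ℝ f y) := by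
      have hu := LinearMap.isUnit_iff_isUnit_det (fderiv ℝ f y : R →ₗ[ℝ] R) |>.mpr
        (isUnit_iff_ne_zero.mpr hne)
      exact ((Module.End.isUnit_iff _).mp hu).1
    exact hy (this (by rw [hz, map_zero]))
  have hnull := addHaar_image_eq_zero_of_det_fderivWithin_eq_zero (volume : Measure R)
    (fun y hy => (hdiff y hy).hasFDerivAt.hasFDerivWithinAt) hdet
  obtain ⟨z, hz, hzn⟩ : ∃ z ∈ κ.symm ⁻¹' ball 0 (ε / 2), z ∉ f '' {y : R | y ≠ 0} := by
    by_contra! hsub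
    have hop : IsOpen (κ.symm ⁻¹' ball (0 : E) (ε / 2)) := isOpen_ball.preimage κ.symm.continuous
    have := hop.measure_pos (volume : Measure R) ⟨0, by simp [hε]⟩
    exact this.ne' (measure_mono_null hsub hnull)
  refine ⟨fun y => h₁ y - h y - κ.symm z, (hh₁.continuous.sub hh).sub continuous_const,
    fun y => ?_, fun y hy h0 => hzn ?_⟩
  · have h1 := hd y
    have h2 : ‖κ.symm z‖ < ε / 2 := by simpa using hz
    rw [dist_eq_norm] at h1
    linarith [norm_sub_le (h₁ y - h y) (κ.symm z)]
  · have h1 : h₁ y = κ.symm z := by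
      have h2 : h y + (h₁ y - h y - κ.symm z) = h₁ y - κ.symm z := by abel
      exact sub_eq_zero.mp (h2 ▸ h0)
    have hnorm : ‖y - a‖ = ρ := by simpa [dist_eq_norm] using hy
    have hne : y - a ≠ 0 := norm_pos_iff.mp (by rw [hnorm]; exact hρ)
    refine ⟨y - a, hne, ?_⟩
    simp only [hf]
    rw [hnorm, mul_inv_cancel₀ hρ.ne', one_smul, add_sub_cancel, h1, κ.apply_symm_apply]

/-- Near a point of a manifold, the section `z ↦ π_z p` of a continuous family of `d`-planes can be
perturbed in a shell around the point so as not to vanish on the boundary of a neighborhood. -/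
theorem exists_perturbation {M : Type*} [TopologicalSpace M] [T2Space M] {d : ℕ} (hd : 0 < d)
    {U : M → Submodule ℝ Q} (hU : Continuous fun z => (U z).starProjection) {x : M}
    (hfr : Module.finrank ℝ (U x) = d) (e : OpenPartialHomeomorph M (EuclideanSpace ℝ (Fin d)))
    (hx : x ∈ e.source) {O : Set M} (hO : O ∈ nhds x) :
    ∃ V : Set M, IsOpen V ∧ x ∈ V ∧ V ⊆ O ∧ ∃ N : Set M, IsClosed N ∧ x ∉ N ∧
      ∀ (p : Q) (ε : ℝ), 0 < ε → ∃ f : M → Q, Continuous f ∧ (∀ z, ‖f z - p‖ < ε) ∧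
        (∀ z ∉ N, f z = p) ∧ ∀ z ∈ frontier V, (U z).starProjection (f z) ≠ 0 := by
  set R := EuclideanSpace ℝ (Fin d)
  have : Nonempty (Fin d) := ⟨⟨0, hd⟩⟩
  have hnhds : e.target ∩ e.symm ⁻¹' (O ∩ {z | ‖(U x).starProjection - (U z).starProjection‖ < 1 / 2})
      ∈ nhds (e x) := by
    refine Filter.inter_mem (e.open_target.mem_nhds (e.map_source hx)) ?_
    refine (e.continuousAt_symm (e.map_source hx)).preimage_mem_nhds ?_
    rw [e.left_inv hx]
    refine Filter.inter_mem hO ((isOpen_lt (by fun_prop) continuous_const).mem_nhds ?_)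
    simp
  obtain ⟨r, hr, hball⟩ := Metric.nhds_basis_closedBall.mem_iff.mp hnhds
  -- images of compact parts of the chart ball
  have himg : ∀ s : Set R, IsClosed s → s ⊆ closedBall (e x) r → IsClosed (e.symm '' s) := by
    intro s hs hsub
    exact (((isCompact_closedBall (e x) r).of_isClosed_subset hs hsub).image_of_continuousOn
      (e.continuousOn_symm.mono fun y hy => (hball (hsub hy)).1)).isClosed
  have hopen : ∀ ρ, IsOpen (e.source ∩ e ⁻¹' ball (e x) ρ) := fun ρ =>
    e.isOpen_inter_preimage isOpen_ball
  set V : Set M := e.source ∩ e ⁻¹' ball (e x) (r / 2)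
  set V' : Set M := e.source ∩ e ⁻¹' ball (e x) r
  -- The perturbation lives in this shell, which avoids the center but contains the sphere of radius
  -- `r / 2` bounding `V`.
  set shell : Set R := {y | r / 4 ≤ dist y (e x) ∧ dist y (e x) ≤ 3 * r / 4}
  have hshell : IsClosed shell :=
    (isClosed_le continuous_const (continuous_id.dist continuous_const)).inter
      (isClosed_le (continuous_id.dist continuous_const) continuous_const)
  have hshell' : shell ⊆ closedBall (e x) r := fun y hy => by
    have := hy.2
    rw [mem_closedBall]
    linarith
  set N : Set M := e.symm '' shell
  refine ⟨V, hopen _, ⟨hx, by simp [hr]⟩, ?_, N, himg _ hshell hshell', ?_, fun p ε hε => ?_⟩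
  · rintro z ⟨hz, hz'⟩
    have h1 : e z ∈ closedBall (e x) r := ball_subset_closedBall (ball_subset_ball (by linarith) hz')
    have := (hball h1).2.1
    rwa [e.left_inv hz] at this
  · rintro ⟨y, hy, hyx⟩
    have h1 : y = e x := by rw [← hyx, e.right_inv (hball (hshell' hy)).1]
    have := hy.1
    rw [h1, dist_self] at this
    linarith
  -- the inverse chart on all of `R`
  set ψ : R → M := fun y => e.symm (e x + r • (ballRetract (r⁻¹ • (y - e x)) : R)) with hψdef
  have hψmem : ∀ y, e x + r • (ballRetract (r⁻¹ • (y - e x)) : R) ∈ closedBall (e x) r := by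
    intro y
    have := (ballRetract (r⁻¹ • (y - e x)) : closedBall (0 : R) 1).2
    rw [mem_closedBall_zero_iff] at this
    rw [mem_closedBall, dist_eq_norm, add_sub_cancel_left, norm_smul, Real.norm_of_nonneg hr.le]
    nlinarith
  have hψc : Continuous ψ := by
    refine e.continuousOn_symm.comp_continuous ?_ fun y => (hball (hψmem y)).1
    have h1 : Continuous fun y : R => r⁻¹ • (y - e x) := by fun_prop
    have h2 : Continuous fun y : R => (ballRetract (r⁻¹ • (y - e x)) : R) :=
      continuous_subtype_val.comp (continuous_ballRetract.comp h1)
    exact continuous_const.add (h2.const_smul r)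
  have hψe : ∀ y ∈ closedBall (e x) r, ψ y = e.symm y := by
    intro y hy
    rw [mem_closedBall, dist_eq_norm] at hy
    have h1 : ‖r⁻¹ • (y - e x)‖ ≤ 1 := by
      rw [norm_smul, norm_inv, Real.norm_of_nonneg hr.le, inv_mul_le_iff₀ hr, mul_one]
      exact hy
    have h2 : (ballRetract (r⁻¹ • (y - e x)) : R) = r⁻¹ • (y - e x) := by
      change (max 1 ‖r⁻¹ • (y - e x)‖)⁻¹ • (r⁻¹ • (y - e x)) = _
      rw [max_eq_left h1, inv_one, one_smul]
    simp only [hψdef]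
    rw [h2, smul_inv_smul₀ hr.ne', add_sub_cancel]
  set P : M → Q →L[ℝ] Q := fun z => (U z).starProjection
  have hidem : ∀ z, P z * P z = P z := fun z => starProjection_mul_self _
  -- The intertwiners identify the fibers over the chart with the fiber at `x`. The section becomes
  -- a map `h` between spaces of equal dimension `d`, to which general position applies.
  set A : R → Q →L[ℝ] Q := fun y => intertwiner (P x) (P (ψ y))
  have hA : Continuous A := by
    have h1 := hU.comp hψc
    exact (h1.mul continuous_const).add ((continuous_const.sub h1).mul continuous_const)
  have hAu : ∀ y, IsUnit (A y) := fun y =>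
    isUnit_intertwiner (hidem _) (hidem _) (Submodule.starProjection_norm_le _)
      (Submodule.starProjection_norm_le _) (hball (hψmem y)).2.2
  have hAint : ∀ y, A y * P x = P (ψ y) * A y := fun y => intertwiner_mul (hidem _) (hidem _)
  set h : R → U x := fun y => (U x).orthogonalProjectionOnto (Ring.inverse (A y) (P (ψ y) p))
  have hh : Continuous h := by
    have h1 : Continuous fun y => P (ψ y) p := (hU.comp hψc).clm_apply continuous_const
    exact (U x).orthogonalProjectionOnto.continuous.comp ((continuous_ringInverse hA hAu).clm_apply h1)
  -- The bound `ε / 2` absorbs the factor `‖A y‖ ≤ 2`.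
  obtain ⟨k, hk, hkε, hkne⟩ := exists_small_add_ne_zero (by simpa [R] using hfr) hh (e x)
    (half_pos hr) (show 0 < ε / 2 by positivity)
  have hAh : ∀ y, A y (h y) = P (ψ y) p := by
    intro y
    have h1 : A y (P x (Ring.inverse (A y) (P (ψ y) p))) = P (ψ y) p := by
      have h2 : A y * P x * Ring.inverse (A y) = P (ψ y) := by
        rw [hAint, mul_assoc, Ring.mul_inverse_cancel _ (hAu y), mul_one]
      have h3 := congrArg (fun B : Q →L[ℝ] Q => B (P (ψ y) p)) h2
      exact h3.trans (congrArg (fun B : Q →L[ℝ] Q => B p) (hidem (ψ y)))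
    exact h1
  set κ : R → ℝ := fun y => clamp (2 - 8 / r * |dist y (e x) - r / 2|)
  have hκ : Continuous κ := continuous_clamp.comp (by fun_prop)
  have hκ0 : ∀ y, y ∉ shell → κ y = 0 := by
    intro y hy
    apply clamp_of_le_zero
    have h1 : r / 4 ≤ |dist y (e x) - r / 2| := by
      rw [le_abs]
      by_contra! hlt
      exact hy ⟨by linarith [hlt.2], by linarith [hlt.1]⟩
    have h2 : 8 / r * (r / 4) ≤ 8 / r * |dist y (e x) - r / 2| := by gcongr
    have h3 : 8 / r * (r / 4) = 2 := by field_simp; norm_num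
    linarith
  set w : R → Q := fun y => κ y • A y (k y)
  have hw : Continuous w := hκ.smul (hA.clm_apply (continuous_subtype_val.comp hk))
  have hwε : ∀ y, ‖w y‖ < ε := by
    intro y
    have h1 : ‖A y (k y)‖ ≤ 2 * ‖k y‖ :=
      ((A y).le_opNorm _).trans (by
        gcongr
        · exact norm_intertwiner_le (Submodule.starProjection_norm_le _)
            (Submodule.starProjection_norm_le _) (norm_one_sub_starProjection_le _)
            (norm_one_sub_starProjection_le _)
        · exact le_rfl)
    calc ‖w y‖ = κ y * ‖A y (k y)‖ := by
          rw [norm_smul, Real.norm_of_nonneg (clamp_nonneg _)]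
      _ ≤ 1 * (2 * ‖k y‖) := mul_le_mul (clamp_le_one _) h1 (norm_nonneg _) zero_le_one
      _ < ε := by linarith [hkε y]
  classical
  refine ⟨fun z => if z ∈ V' then p + w (e z) else p, ?_, fun z => ?_, fun z hz => ?_,
    fun z hz => ?_⟩
  · rw [continuous_iff_continuousAt]
    intro z
    by_cases hz : z ∈ V'
    · have h1 : ContinuousAt (fun z => p + w (e z)) z :=
        continuousAt_const.add (hw.continuousAt.comp (e.continuousAt hz.1))
      refine h1.congr ?_
      filter_upwards [(hopen r).mem_nhds hz] with z' hz'
      exact (if_pos hz').symm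
    · have hzN : z ∈ Nᶜ := by
        rintro ⟨y, hy, rfl⟩
        refine hz ⟨e.map_target (hball (hshell' hy)).1, ?_⟩
        rw [mem_preimage, e.right_inv (hball (hshell' hy)).1, mem_ball]
        linarith [hy.2]
      refine (continuousAt_const (y := p)).congr ?_
      filter_upwards [(himg _ hshell hshell').isOpen_compl.mem_nhds hzN] with z' hz'
      split_ifs with h1
      · have : e z' ∉ shell := fun h2 => hz' ⟨e z', h2, e.left_inv h1.1⟩
        simp [w, hκ0 _ this]
      · rfl
  · dsimp only
    split_ifs with h1
    · rw [add_sub_cancel_left]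
      exact hwε _
    · simpa using hε
  · dsimp only
    split_ifs with h1
    · have : e z ∉ shell := fun h2 => hz ⟨e z, h2, e.left_inv h1.1⟩
      simp [w, hκ0 _ this]
    · rfl
  · have hcl : closure V ⊆ e.symm '' closedBall (e x) (r / 2) :=
      closure_minimal (fun z hz => ⟨e z, ball_subset_closedBall hz.2, e.left_inv hz.1⟩)
        (himg _ isClosed_closedBall (closedBall_subset_closedBall (by linarith)))
    obtain ⟨y, hy, rfl⟩ := hcl hz.1
    have hyr : y ∈ closedBall (e x) r := closedBall_subset_closedBall (by linarith) hy
    have hyt := (hball hyr).1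
    have hyd : dist y (e x) = r / 2 := by
      refine le_antisymm hy (not_lt.mp fun hlt => ?_)
      rw [(hopen _).frontier_eq] at hz
      exact hz.2 ⟨e.map_target hyt, by rw [mem_preimage, e.right_inv hyt]; exact hlt⟩
    have hV' : e.symm y ∈ V' := ⟨e.map_target hyt, by
      rw [mem_preimage, e.right_inv hyt, mem_ball, hyd]; linarith⟩
    have hκ1 : κ y = 1 := by
      simp only [κ]
      rw [hyd, sub_self, abs_zero, mul_zero, sub_zero]
      exact clamp_of_one_le (by norm_num)
    dsimp only
    rw [if_pos hV', e.right_inv hyt]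
    simp only [w, hκ1, one_smul]
    rw [← hψe y hyr]
    have h1 : P (ψ y) (A y (k y)) = A y (k y) := by
      have h2 := congrArg (fun B : Q →L[ℝ] Q => B (k y : Q)) (hAint y)
      have h3 : P x (k y : Q) = k y := Submodule.starProjection_eq_self_iff.mpr (k y).2
      have h4 : A y (P x (k y : Q)) = P (ψ y) (A y (k y)) := h2
      rw [← h4, h3]
    change P (ψ y) (p + A y (k y)) ≠ 0
    rw [map_add, h1, ← hAh, ← map_add]
    intro h0
    have h5 : Ring.inverse (A y) * A y = 1 := Ring.inverse_mul_cancel _ (hAu y)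
    have h6 := congrArg (fun B : Q →L[ℝ] Q => B ((h y : Q) + k y)) h5
    have h7 : Ring.inverse (A y) (A y ((h y : Q) + k y)) = (h y : Q) + k y := h6
    rw [h0, map_zero] at h7
    exact hkne y hyd (Subtype.ext h7.symm)

end Transport

namespace FittingFlow

/-! ### The trace pairing as a Euclidean structure -/

section InnerProduct

variable {m : ℕ}

theorem pairing_eq_sum (q p : Sym m) : pairing q p = ∑ i, ∑ j, q.1 i j * p.1 i j := by
  have hp : ∀ i j, p.1 j i = p.1 i j := fun i j => congrFun (congrFun p.2 i) j
  simp only [pairing, Matrix.trace, Matrix.diag, Matrix.mul_apply]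
  exact Finset.sum_congr rfl fun i _ => Finset.sum_congr rfl fun j _ => by rw [hp]

theorem pairing_comm (q p : Sym m) : pairing q p = pairing p q := by
  rw [pairing_eq_sum, pairing_eq_sum]
  exact Finset.sum_congr rfl fun i _ => Finset.sum_congr rfl fun j _ => mul_comm _ _

/-- The trace pairing as an inner product on symmetric matrices. -/
@[reducible] noncomputable def symCore (m : ℕ) : InnerProductSpace.Core ℝ (Sym m) where
  inner q p := pairing q p
  conj_inner_symm q p := pairing_comm _ _
  re_inner_nonneg q := by
    rw [RCLike.re_to_real, pairing_eq_sum]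
    exact Finset.sum_nonneg fun i _ => Finset.sum_nonneg fun j _ => mul_self_nonneg _
  add_left q r p := by simp [pairing, Matrix.add_mul]
  smul_left q p c := by simp [pairing]
  definite q h := by
    rw [pairing_eq_sum] at h
    have h1 := (Finset.sum_eq_zero_iff_of_nonneg fun i _ => Finset.sum_nonneg fun j _ =>
      mul_self_nonneg (q.1 i j)).mp h
    ext i j
    have h2 := (Finset.sum_eq_zero_iff_of_nonneg fun j _ => mul_self_nonneg (q.1 i j)).mp
      (h1 i (Finset.mem_univ _)) j (Finset.mem_univ _)
    simpa using h2

/-- Together with `isVonNBounded_symCore`, this lets the norm of the trace pairing be installed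
without changing the topology that `Sym m` already carries and that the statement uses. -/
theorem continuousAt_symCore : ContinuousAt (fun q : Sym m => (symCore m).inner q q) 0 := by
  have : Continuous fun q : Sym m => pairing q q := by
    unfold pairing
    fun_prop
  exact this.continuousAt

theorem isVonNBounded_symCore :
    Bornology.IsVonNBounded ℝ {q : Sym m | RCLike.re ((symCore m).inner q q) < 1} := by
  let _ : NormedAddCommGroup (Matrix (Fin m) (Fin m) ℝ) := Matrix.normedAddCommGroup
  let _ : NormedSpace ℝ (Matrix (Fin m) (Fin m) ℝ) := Matrix.normedSpace
  refine NormedSpace.isVonNBounded_of_isBounded ℝ (isBounded_iff_forall_norm_le.mpr ⟨1, ?_⟩)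
  intro q hq
  have hq' : pairing q q < 1 := hq
  rw [pairing_eq_sum] at hq'
  change ‖(q : Matrix (Fin m) (Fin m) ℝ)‖ ≤ 1
  rw [Matrix.norm_le_iff zero_le_one]
  intro i j
  have h1 : q.1 i j * q.1 i j ≤ 1 := by
    refine le_trans ?_ hq'.le
    refine le_trans ?_ (Finset.single_le_sum (f := fun i => ∑ j, q.1 i j * q.1 i j)
      (fun i _ => Finset.sum_nonneg fun j _ => mul_self_nonneg _) (Finset.mem_univ i))
    exact Finset.single_le_sum (f := fun j => q.1 i j * q.1 i j)
      (fun j _ => mul_self_nonneg _) (Finset.mem_univ j)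
  rw [Real.norm_eq_abs]
  exact abs_le_one_iff_mul_self_le_one.mpr h1

noncomputable instance instNormedAddCommGroupSym : NormedAddCommGroup (Sym m) :=
  (symCore m).toNormedAddCommGroupOfTopology continuousAt_symCore isVonNBounded_symCore

noncomputable instance instInnerProductSpaceSym : InnerProductSpace ℝ (Sym m) :=
  InnerProductSpace.ofCoreOfTopology (symCore m) continuousAt_symCore isVonNBounded_symCore

theorem inner_eq_pairing (q p : Sym m) : inner ℝ q p = pairing q p := rfl

theorem mem_annihilator_iff {U : Submodule ℝ (Sym m)} {p : Sym m} :
    p ∈ annihilator U ↔ U.starProjection p = 0 := by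
  rw [Submodule.starProjection_apply_eq_zero_iff, Submodule.mem_orthogonal]
  rfl

end InnerProduct

/-! ### Positivity of quadrics and tensors -/

section QuadraticForm

variable {m : ℕ}

/-- The value `q(v, v)` of a quadric. -/
def quadForm (q : Sym m) (v : Fin m → ℝ) : ℝ := v ⬝ᵥ (q.1 *ᵥ v)

/-- The symmetric tensor `v ⊗ v`. -/
def rankOne (v : Fin m → ℝ) : Sym m :=
  ⟨Matrix.vecMulVec v v, by
    change (Matrix.vecMulVec v v)ᵀ = _
    rw [Matrix.transpose_vecMulVec]⟩

theorem inner_rankOne (q : Sym m) (v : Fin m → ℝ) : inner ℝ q (rankOne v) = quadForm q v := by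
  rw [inner_eq_pairing, pairing_eq_sum]
  simp only [quadForm, dotProduct, Matrix.mulVec, rankOne, Matrix.vecMulVec_apply, Finset.mul_sum]
  exact Finset.sum_congr rfl fun i _ => Finset.sum_congr rfl fun j _ => by ring

theorem norm_rankOne (v : Fin m → ℝ) : ‖rankOne v‖ = v ⬝ᵥ v := by
  have h : 0 ≤ v ⬝ᵥ v := Finset.sum_nonneg fun i _ => mul_self_nonneg _
  rw [← sq_eq_sq₀ (norm_nonneg _) h, ← real_inner_self_eq_norm_sq, inner_rankOne]
  simp only [quadForm, rankOne, Matrix.vecMulVec_mulVec, dotProduct_smul, sq]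
  simp

theorem dotProduct_self_pos' {v : Fin m → ℝ} (hv : v ≠ 0) : 0 < v ⬝ᵥ v := by
  rw [← norm_rankOne, norm_pos_iff]
  intro h
  apply hv
  have h1 : v ⬝ᵥ v = 0 := by rw [← norm_rankOne, h, norm_zero]
  exact dotProduct_self_eq_zero.mp h1

/-- Cauchy–Schwarz against `v ⊗ v`: a unit quadric is bounded by the Euclidean form, which is how a
gap of `ε` times that form yields a gap of `ε |q|`. -/
theorem abs_quadForm_le (q : Sym m) (v : Fin m → ℝ) : |quadForm q v| ≤ ‖q‖ * (v ⬝ᵥ v) := by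
  rw [← inner_rankOne, ← norm_rankOne]
  exact abs_real_inner_le_norm _ _

theorem quadForm_add (q r : Sym m) (v : Fin m → ℝ) :
    quadForm (q + r) v = quadForm q v + quadForm r v := by
  simp only [← inner_rankOne, inner_add_left]

theorem quadForm_sub (q r : Sym m) (v : Fin m → ℝ) :
    quadForm (q - r) v = quadForm q v - quadForm r v := by
  simp only [← inner_rankOne, inner_sub_left]

theorem quadForm_smul (c : ℝ) (q : Sym m) (v : Fin m → ℝ) :
    quadForm (c • q) v = c * quadForm q v := by
  simp only [← inner_rankOne, real_inner_smul_left]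

theorem continuous_quadForm (v : Fin m → ℝ) : Continuous fun q : Sym m => quadForm q v := by
  simp only [← inner_rankOne]
  fun_prop

/-- The standard Euclidean scalar product. -/
def idQuadric (m : ℕ) : Sym m := ⟨1, Matrix.isSymm_one⟩

theorem quadForm_idQuadric (v : Fin m → ℝ) : quadForm (idQuadric m) v = v ⬝ᵥ v := by
  simp [quadForm, idQuadric]

theorem posDef_iff {q : Sym m} :
    (q : Matrix (Fin m) (Fin m) ℝ).PosDef ↔ ∀ v : Fin m → ℝ, v ≠ 0 → 0 < quadForm q v := by
  rw [Matrix.posDef_iff_dotProduct_mulVec]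
  refine ⟨fun h v hv => h.2 hv, fun h => ⟨?_, fun v hv => h v hv⟩⟩
  have : (q : Matrix (Fin m) (Fin m) ℝ)ᵀ = q := q.2
  rwa [Matrix.IsHermitian, Matrix.conjTranspose_eq_transpose_of_trivial]

-- In a factorization `p = Bᵀ B`, the rows of `B` are the required vectors. Pairings with
-- semi-positive tensors thus reduce to values of `quadForm`.
open MatrixOrder Matrix.Norms.L2Operator in
theorem exists_sum_rankOne {p : Sym m} (hp : (p : Matrix (Fin m) (Fin m) ℝ).PosSemidef) :
    ∃ b : Fin m → Fin m → ℝ, p = ∑ k, rankOne (b k) := by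
  obtain ⟨B, hB⟩ := CStarAlgebra.nonneg_iff_eq_star_mul_self.mp hp.nonneg
  refine ⟨B, Subtype.ext ?_⟩
  rw [hB, AddSubmonoidClass.coe_finsetSum]
  ext i j
  simp [Matrix.sum_apply, rankOne, Matrix.vecMulVec_apply, Matrix.mul_apply, Matrix.star_apply]

theorem inner_nonneg_of_posSemidef {q p : Sym m} (hq : ∀ v, 0 ≤ quadForm q v)
    (hp : (p : Matrix (Fin m) (Fin m) ℝ).PosSemidef) : 0 ≤ inner ℝ q p := by
  obtain ⟨b, rfl⟩ := exists_sum_rankOne hp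
  rw [inner_sum]
  exact Finset.sum_nonneg fun k _ => by rw [inner_rankOne]; exact hq _

theorem inner_pos_of_posDef {q p : Sym m} (hq : (q : Matrix (Fin m) (Fin m) ℝ).PosDef)
    (hp : (p : Matrix (Fin m) (Fin m) ℝ).PosSemidef) (hp0 : p ≠ 0) : 0 < inner ℝ q p := by
  obtain ⟨b, rfl⟩ := exists_sum_rankOne hp
  have hq' := posDef_iff.mp hq
  have hnn : ∀ v, 0 ≤ quadForm q v := fun v => by
    rcases eq_or_ne v 0 with rfl | hv
    · simp [quadForm]
    · exact (hq' v hv).le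
  obtain ⟨k, hk⟩ : ∃ k, b k ≠ 0 := by
    by_contra! h
    apply hp0
    refine Finset.sum_eq_zero fun k _ => ?_
    rw [h k]
    ext i j
    simp [rankOne]
  rw [inner_sum]
  exact Finset.sum_pos' (fun k _ => by rw [inner_rankOne]; exact hnn _)
    ⟨k, Finset.mem_univ _, by rw [inner_rankOne]; exact hq' _ hk⟩

theorem exists_le_quadForm {q : Sym m} (hq : (q : Matrix (Fin m) (Fin m) ℝ).PosDef) :
    ∃ ε > 0, ∀ v, ε * (v ⬝ᵥ v) ≤ quadForm q v := by
  have hq' := posDef_iff.mp hq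
  have hcont : Continuous fun v : Fin m → ℝ => quadForm q v := by
    unfold quadForm
    fun_prop
  have hcpt : IsCompact {v : Fin m → ℝ | v ⬝ᵥ v = 1} := by
    refine (isCompact_closedBall (0 : Fin m → ℝ) 1).of_isClosed_subset
      (isClosed_eq (by fun_prop) continuous_const) fun v hv => ?_
    rw [mem_closedBall_zero_iff, pi_norm_le_iff_of_nonneg zero_le_one]
    intro i
    rw [Real.norm_eq_abs]
    apply abs_le_one_iff_mul_self_le_one.mpr
    have : v ⬝ᵥ v = 1 := hv
    rw [← this]
    exact Finset.single_le_sum (f := fun i => v i * v i) (fun i _ => mul_self_nonneg _)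
      (Finset.mem_univ i)
  obtain ⟨ε, hε, hmin⟩ : ∃ ε > 0, ∀ v : Fin m → ℝ, v ⬝ᵥ v = 1 → ε ≤ quadForm q v := by
    rcases Set.eq_empty_or_nonempty {v : Fin m → ℝ | v ⬝ᵥ v = 1} with h | h
    · exact ⟨1, one_pos, fun v hv => absurd (show v ∈ {v : Fin m → ℝ | v ⬝ᵥ v = 1} from hv)
        (by rw [h]; simp)⟩
    · obtain ⟨v₀, hv₀, hmin⟩ := hcpt.exists_isMinOn h hcont.continuousOn
      refine ⟨quadForm q v₀, hq' v₀ ?_, fun v hv => hmin hv⟩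
      rintro rfl
      simp at hv₀
  refine ⟨ε, hε, fun v => ?_⟩
  rcases eq_or_ne v 0 with rfl | hv
  · simp [quadForm]
  have hpos := dotProduct_self_pos' hv
  set s := √(v ⬝ᵥ v)
  have hs : 0 < s := Real.sqrt_pos.mpr hpos
  have hs2 : s * s = v ⬝ᵥ v := Real.mul_self_sqrt hpos.le
  have h1 := hmin (s⁻¹ • v) (by
    rw [smul_dotProduct, dotProduct_smul, smul_eq_mul, smul_eq_mul, ← hs2]
    field_simp)
  have h2 : quadForm q (s⁻¹ • v) = s⁻¹ * s⁻¹ * quadForm q v := by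
    simp only [quadForm, Matrix.mulVec_smul, smul_dotProduct, dotProduct_smul, smul_eq_mul]
    ring
  rw [h2] at h1
  rw [← hs2]
  calc ε * (s * s) ≤ s⁻¹ * s⁻¹ * quadForm q v * (s * s) := by gcongr
    _ = quadForm q v := by field_simp

theorem le_quadForm_of_norm_sub_le {q r : Sym m} {ε η : ℝ} (h : ∀ v, ε * (v ⬝ᵥ v) ≤ quadForm q v)
    (hr : ‖r - q‖ ≤ η) (v : Fin m → ℝ) : (ε - η) * (v ⬝ᵥ v) ≤ quadForm r v := by
  have h1 := abs_quadForm_le (r - q) v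
  have h2 : 0 ≤ v ⬝ᵥ v := by rw [← norm_rankOne]; exact norm_nonneg _
  have h3 := neg_abs_le (quadForm (r - q) v)
  rw [quadForm_sub] at h1 h3
  have := h v
  have := mul_le_mul_of_nonneg_right hr h2
  nlinarith

theorem quadForm_actQuadric (g : Matrix.SpecialLinearGroup (Fin m) ℝ) (q : Sym m)
    (v : Fin m → ℝ) : quadForm (actQuadric g q) v =
      quadForm q (((g⁻¹ : Matrix.SpecialLinearGroup (Fin m) ℝ) : Matrix (Fin m) (Fin m) ℝ) *ᵥ v) := by
  simp only [quadForm, actQuadric, LinearMap.coe_mk, AddHom.coe_mk]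
  rw [← Matrix.mulVec_mulVec, ← Matrix.mulVec_mulVec, Matrix.dotProduct_mulVec,
    Matrix.vecMul_transpose]

end QuadraticForm

/-! ### The Grassmannian seen through orthogonal projections -/

section Grassmannian

variable {d m : ℕ}

/-- The orthogonal projection to a subspace depends continuously on the subspace. -/
theorem continuous_starProjection_gr :
    Continuous fun P : Gr d m => P.1.starProjection := by
  rw [continuous_coinduced_dom]
  set T : {b : Fin d → Quadric m // LinearIndependent ℝ b} →
      EuclideanSpace ℝ (Fin d) →L[ℝ] Quadric m := fun b =>
    ∑ i, (EuclideanSpace.proj i : EuclideanSpace ℝ (Fin d) →L[ℝ] ℝ).smulRight (b.1 i)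
  have hTapp : ∀ b x, T b x = ∑ i, x i • b.1 i := by
    intro b x
    simp [T]
  have hT : Continuous T := by
    refine continuous_finsetSum _ fun i _ => ?_
    exact (ContinuousLinearMap.smulRightL ℝ (EuclideanSpace ℝ (Fin d)) (Quadric m)
      (EuclideanSpace.proj i)).continuous.comp ((continuous_apply i).comp continuous_subtype_val)
  have hadj : Continuous fun b => ContinuousLinearMap.adjoint (T b) :=
    (ContinuousLinearMap.adjoint (𝕜 := ℝ) (E := EuclideanSpace ℝ (Fin d))
      (F := Quadric m)).continuous.comp hT
  set S : {b : Fin d → Quadric m // LinearIndependent ℝ b} →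
      EuclideanSpace ℝ (Fin d) →L[ℝ] EuclideanSpace ℝ (Fin d) := fun b =>
    (ContinuousLinearMap.adjoint (T b)).comp (T b)
  have hS : Continuous S := hadj.clm_comp hT
  have hinj : ∀ b, Injective (T b) := by
    intro b
    rw [injective_iff_map_eq_zero]
    intro x hx
    rw [hTapp] at hx
    ext i
    exact Fintype.linearIndependent_iff.mp b.2 _ hx i
  have hSu : ∀ b, IsUnit (S b) := by
    intro b
    have hSinj : Injective (S b) := by
      rw [injective_iff_map_eq_zero]
      intro x hx
      have h1 : inner ℝ (T b x) (T b x) = 0 := by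
        rw [← ContinuousLinearMap.adjoint_inner_right]
        change inner ℝ x (S b x) = 0
        rw [hx, inner_zero_right]
      exact hinj b ((inner_self_eq_zero.mp h1).trans (map_zero _).symm)
    rw [ContinuousLinearMap.isUnit_iff_bijective]
    exact ⟨hSinj,
        (LinearMap.injective_iff_surjective (f := (S b : EuclideanSpace ℝ (Fin d) →ₗ[ℝ] _))).mp hSinj⟩
  -- For an injective `T`, the orthogonal projection to its range is `T (T* T)⁻¹ T*`, visibly
  -- continuous in the frame.
  have hmain : ∀ b, (spanFrame b).1.starProjection =
      (T b).comp ((Ring.inverse (S b)).comp (ContinuousLinearMap.adjoint (T b))) := by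
    intro b
    ext1 q
    have hr : ∀ x, T b x ∈ (spanFrame b).1 := by
      intro x
      rw [hTapp]
      exact Submodule.sum_mem _ fun i _ => Submodule.smul_mem _ _ (Submodule.subset_span ⟨i, rfl⟩)
    refine Submodule.eq_starProjection_of_mem_of_inner_eq_zero (hr _) fun w hw => ?_
    obtain ⟨c, rfl⟩ := (Submodule.mem_span_range_iff_exists_fun ℝ).mp hw
    have hc : ∑ i, c i • b.1 i = T b (WithLp.toLp 2 c) := by rw [hTapp]
    rw [hc, real_inner_comm, inner_sub_right, ← ContinuousLinearMap.adjoint_inner_right,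
      ← ContinuousLinearMap.adjoint_inner_right, sub_eq_zero]
    congr 1
    have h1 : S b * Ring.inverse (S b) = 1 := Ring.mul_inverse_cancel _ (hSu b)
    exact (congrArg (fun B : EuclideanSpace ℝ (Fin d) →L[ℝ] EuclideanSpace ℝ (Fin d) =>
      B (ContinuousLinearMap.adjoint (T b) q)) h1).symm
  exact (hT.clm_comp ((continuous_ringInverse hS hSu).clm_comp hadj)).congr fun b => (hmain b).symm

end Grassmannian

end FittingFlow

namespace FittingFlow

/-! ### Unit directions, compactness and uniform estimates on the sphere bundle -/

section SphereBundle

variable {M : Type*} {d m : ℕ} {u : M → GrMix d m}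

/-- The orthogonal projection of `𝒬` to the pencil `u(x)`. -/
noncomputable def proj𝒬 (u : M → GrMix d m) (x : M) : Quadric m →L[ℝ] Quadric m :=
  (u x).toSubmodule.starProjection

theorem proj𝒬_eq_self_iff {x : M} {q : Quadric m} : proj𝒬 u x q = q ↔ q ∈ (u x).toSubmodule :=
  Submodule.starProjection_eq_self_iff

theorem inner_proj𝒬_right {x : M} {q p : Quadric m} (hq : q ∈ (u x).toSubmodule) :
    inner ℝ q (proj𝒬 u x p) = inner ℝ q p := by
  have h := Submodule.inner_starProjection_left_eq_right (u x).toSubmodule q p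
  rw [Submodule.starProjection_eq_self_iff.mpr hq] at h
  exact h.symm

theorem finrank_toSubmodule (x : M) : Module.finrank ℝ (u x).toSubmodule = d := (u x).1.2

/-- A positive tensor annihilated by the mixed pencil `u(x)`. -/
theorem exists_posDef_annihilated (u : M → GrMix d m) (x : M) : ∃ p : SymTensor m,
    (p : Matrix (Fin m) (Fin m) ℝ).PosDef ∧ ∀ q ∈ (u x).toSubmodule, inner ℝ q p = 0 := by
  obtain ⟨p, hp, hpos⟩ := (u x).2
  exact ⟨p, hpos, hp⟩

namespace SphereBundle

/-- The unit representative of a ray. -/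
noncomputable def dir : SphereBundle u → Quadric m :=
  Quotient.lift (fun v : PunctBundle u => ‖v.1.2‖⁻¹ • v.1.2) (by
    rintro v w ⟨-, c, hc, e⟩
    have hv : ‖v.1.2‖ ≠ 0 := norm_ne_zero_iff.mpr v.2.2
    simp only [e, norm_smul, Real.norm_of_nonneg hc.le, smul_smul]
    congr 1
    field_simp)

theorem dir_mk (v : PunctBundle u) : (mk v).dir = ‖v.1.2‖⁻¹ • v.1.2 := rfl

theorem norm_dir (ξ : SphereBundle u) : ‖ξ.dir‖ = 1 := by
  induction ξ using Quotient.inductionOn with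
  | h v =>
    have hv : ‖v.1.2‖ ≠ 0 := norm_ne_zero_iff.mpr v.2.2
    change ‖‖v.1.2‖⁻¹ • v.1.2‖ = 1
    rw [norm_smul, norm_inv, norm_norm, inv_mul_cancel₀ hv]

theorem dir_ne_zero (ξ : SphereBundle u) : ξ.dir ≠ 0 := by
  rw [← norm_ne_zero_iff, norm_dir]
  exact one_ne_zero

theorem dir_mem (ξ : SphereBundle u) : ξ.dir ∈ (u ξ.proj).toSubmodule := by
  induction ξ using Quotient.inductionOn with
  | h v => exact Submodule.smul_mem _ _ v.2.1

/-- The class of a ray with given base point and direction. -/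
def ofDir (x : M) (q : Quadric m) (hq : q ∈ (u x).toSubmodule) (h0 : q ≠ 0) : SphereBundle u :=
  mk ⟨(x, q), hq, h0⟩

theorem ofDir_dir (ξ : SphereBundle u) : ofDir ξ.proj ξ.dir ξ.dir_mem ξ.dir_ne_zero = ξ := by
  induction ξ using Quotient.inductionOn with
  | h v =>
    refine Quotient.sound ⟨rfl, ‖v.1.2‖, norm_pos_iff.mpr v.2.2, ?_⟩
    change v.1.2 = ‖v.1.2‖ • (‖v.1.2‖⁻¹ • v.1.2)
    rw [smul_inv_smul₀ (norm_ne_zero_iff.mpr v.2.2)]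

variable [TopologicalSpace M]

theorem continuous_mk : Continuous (mk : PunctBundle u → SphereBundle u) := continuous_quotient_mk'

theorem continuous_proj : Continuous (proj : SphereBundle u → M) :=
  Continuous.quotient_lift (by fun_prop) _

theorem continuous_dir : Continuous (dir : SphereBundle u → Quadric m) := by
  refine Continuous.quotient_lift ?_ _
  have h : Continuous fun v : PunctBundle u => v.1.2 := by fun_prop
  exact (h.norm.inv₀ fun v => norm_ne_zero_iff.mpr v.2.2).smul h

theorem continuous_ofDir {X : Type*} [TopologicalSpace X] {x : X → M} {q : X → Quadric m}
    (hx : Continuous x) (hq : Continuous q) (h : ∀ a, q a ∈ (u (x a)).toSubmodule)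
    (h0 : ∀ a, q a ≠ 0) : Continuous fun a => ofDir (x a) (q a) (h a) (h0 a) :=
  continuous_mk.comp (Continuous.subtype_mk (hx.prodMk hq) _)

end SphereBundle

variable [TopologicalSpace M]

theorem continuous_proj𝒬 (hu : Continuous u) : Continuous (proj𝒬 u) :=
  continuous_starProjection_gr.comp (continuous_subtype_val.comp hu)

/-- The unit vectors of the pencils over `K` form a closed subset of `K` times the unit sphere, cut
out by the continuous family of projections, and they surject onto the rays over `K`. -/
theorem isCompact_proj_preimage (hu : Continuous u) {K : Set M} (hK : IsCompact K) :
    IsCompact {ξ : SphereBundle u | ξ.proj ∈ K} := by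
  set A : Set (M × Quadric m) := (K ×ˢ sphere 0 1) ∩ {a | proj𝒬 u a.1 a.2 = a.2}
  have hA : IsCompact A := (hK.prod (isCompact_sphere 0 1)).inter_right
    (isClosed_eq (((continuous_proj𝒬 hu).comp continuous_fst).clm_apply continuous_snd)
      continuous_snd)
  have hA' : IsCompact ((Subtype.val : PunctBundle u → M × Quadric m) ⁻¹' A) := by
    rw [Subtype.isCompact_iff, image_preimage_eq_of_subset]
    · exact hA
    · rintro ⟨x, q⟩ ⟨⟨-, hq⟩, hq'⟩
      refine ⟨⟨(x, q), proj𝒬_eq_self_iff.mp hq', ?_⟩, rfl⟩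
      rintro rfl
      simp at hq
  have hset : {ξ : SphereBundle u | ξ.proj ∈ K} = SphereBundle.mk '' (Subtype.val ⁻¹' A) := by
    ext ξ
    constructor
    · intro hξ
      exact ⟨⟨(ξ.proj, ξ.dir), ξ.dir_mem, ξ.dir_ne_zero⟩,
        ⟨⟨hξ, by simp [SphereBundle.norm_dir]⟩, proj𝒬_eq_self_iff.mpr ξ.dir_mem⟩, ξ.ofDir_dir⟩
    · rintro ⟨v, ⟨⟨hv, -⟩, -⟩, rfl⟩
      exact hv
  rw [hset]
  exact hA'.image SphereBundle.continuous_mk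

/-- Fitting expressed with unit directions; `c` is the norm of the representative that fitting
provides. -/
theorem IsFittingFlow.exists_dir {Φ : Flow ℝ (SphereBundle u)} (hΦ : IsFittingFlow Φ) {t : ℝ}
    (ht : 0 < t) (ξ : SphereBundle u) : ∃ c : ℝ, 0 < c ∧
      ((c • (Φ t ξ).dir - ξ.dir : Quadric m) : Matrix (Fin m) (Fin m) ℝ).PosDef := by
  obtain ⟨w, hw, hpos⟩ := hΦ t ht ⟨(ξ.proj, ξ.dir), ξ.dir_mem, ξ.dir_ne_zero⟩
  have h1 : SphereBundle.mk ⟨(ξ.proj, ξ.dir), ξ.dir_mem, ξ.dir_ne_zero⟩ = ξ := ξ.ofDir_dir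
  rw [h1] at hw
  refine ⟨‖w.1.2‖, norm_pos_iff.mpr w.2.2, ?_⟩
  rw [← hw, SphereBundle.dir_mk, smul_inv_smul₀ (norm_ne_zero_iff.mpr w.2.2)]
  exact hpos

/-- Over a compact set, fitting is uniform for a given time. -/
theorem IsFittingFlow.exists_uniform {Φ : Flow ℝ (SphereBundle u)} (hΦ : IsFittingFlow Φ)
    {S : Set (SphereBundle u)} (hS : IsCompact S) {t : ℝ} (ht : 0 < t) :
    ∃ ε > 0, ∀ ξ ∈ S, ∃ c : ℝ, 0 < c ∧ ∀ v, ε * (v ⬝ᵥ v) ≤ quadForm (c • (Φ t ξ).dir - ξ.dir) v := by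
  have hcont : Continuous fun ξ => (Φ t ξ).dir :=
    SphereBundle.continuous_dir.comp (Φ.continuous continuous_const continuous_id)
  refine hS.induction_on (p := fun S => ∃ ε > 0, ∀ ξ ∈ S, ∃ c : ℝ, 0 < c ∧ ∀ v,
    ε * (v ⬝ᵥ v) ≤ quadForm (c • (Φ t ξ).dir - ξ.dir) v) ⟨1, one_pos, by simp⟩ ?_ ?_ ?_
  · rintro A B hAB ⟨ε, hε, h⟩
    exact ⟨ε, hε, fun ξ hξ => h ξ (hAB hξ)⟩
  · rintro A B ⟨ε, hε, h⟩ ⟨ε', hε', h'⟩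
    refine ⟨min ε ε', lt_min hε hε', ?_⟩
    have hvv : ∀ v : Fin m → ℝ, 0 ≤ v ⬝ᵥ v := fun v => by
      rw [← norm_rankOne]; exact norm_nonneg _
    rintro ξ (hξ | hξ)
    · obtain ⟨c, hc, hv⟩ := h ξ hξ
      exact ⟨c, hc, fun v => (mul_le_mul_of_nonneg_right (min_le_left _ _) (hvv v)).trans (hv v)⟩
    · obtain ⟨c, hc, hv⟩ := h' ξ hξ
      exact ⟨c, hc, fun v => (mul_le_mul_of_nonneg_right (min_le_right _ _) (hvv v)).trans (hv v)⟩
  · intro ξ hξ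
    obtain ⟨c, hc, hpos⟩ := hΦ.exists_dir ht ξ
    obtain ⟨ε, hε, hle⟩ := exists_le_quadForm hpos
    have hc' : Continuous fun η => c • (Φ t η).dir - η.dir :=
      (hcont.const_smul c).sub SphereBundle.continuous_dir
    refine ⟨{η | ‖(c • (Φ t η).dir - η.dir) - (c • (Φ t ξ).dir - ξ.dir)‖ < ε / 2},
      mem_nhdsWithin_of_mem_nhds ((isOpen_lt (by fun_prop) continuous_const).mem_nhds
        (by simp [hε])), ε / 2, half_pos hε, fun η hη => ⟨c, hc, fun v => ?_⟩⟩
    have hη' : ‖(c • (Φ t η).dir - η.dir) - (c • (Φ t ξ).dir - ξ.dir)‖ ≤ ε / 2 := le_of_lt hη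
    have := le_quadForm_of_norm_sub_le hle hη' v
    rwa [sub_half] at this

/-- Over a compact set, quadrics of unit norm in mixed pencils take values of both signs,
uniformly. -/
theorem exists_uniform_quadForm {S : Set (SphereBundle u)} (hS : IsCompact S) :
    ∃ a > 0, ∀ ξ ∈ S, (∃ v, v ≠ 0 ∧ a * (v ⬝ᵥ v) ≤ quadForm ξ.dir v) ∧
      ∃ v, v ≠ 0 ∧ quadForm ξ.dir v ≤ -(a * (v ⬝ᵥ v)) := by
  have hvv : ∀ v : Fin m → ℝ, 0 ≤ v ⬝ᵥ v := fun v => by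
    rw [← norm_rankOne]; exact norm_nonneg _
  refine hS.induction_on (p := fun S => ∃ a > 0, ∀ ξ ∈ S,
    (∃ v, v ≠ 0 ∧ a * (v ⬝ᵥ v) ≤ quadForm ξ.dir v) ∧
      ∃ v, v ≠ 0 ∧ quadForm ξ.dir v ≤ -(a * (v ⬝ᵥ v))) ⟨1, one_pos, by simp⟩ ?_ ?_ ?_
  · rintro A B hAB ⟨ε, hε, h⟩
    exact ⟨ε, hε, fun ξ hξ => h ξ (hAB hξ)⟩
  · rintro A B ⟨a, ha, h⟩ ⟨a', ha', h'⟩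
    refine ⟨min a a', lt_min ha ha', ?_⟩
    rintro ξ (hξ | hξ)
    · obtain ⟨⟨v, hv, hv'⟩, w, hw, hw'⟩ := h ξ hξ
      exact ⟨⟨v, hv, (mul_le_mul_of_nonneg_right (min_le_left _ _) (hvv v)).trans hv'⟩, w, hw,
        hw'.trans (neg_le_neg (mul_le_mul_of_nonneg_right (min_le_left _ _) (hvv w)))⟩
    · obtain ⟨⟨v, hv, hv'⟩, w, hw, hw'⟩ := h' ξ hξ
      exact ⟨⟨v, hv, (mul_le_mul_of_nonneg_right (min_le_right _ _) (hvv v)).trans hv'⟩, w, hw,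
        hw'.trans (neg_le_neg (mul_le_mul_of_nonneg_right (min_le_right _ _) (hvv w)))⟩
  · intro ξ hξ
    obtain ⟨p, hp, hpz⟩ := exists_posDef_annihilated u ξ.proj
    have h0 : inner ℝ ξ.dir p = 0 := hpz _ ξ.dir_mem
    -- A nonzero semi-negative quadric would pair strictly negatively with the positive tensor `p`.
    -- Applied to `ξ.dir` and to its opposite, this produces both signs.
    have key : ∀ q : Sym m, q ≠ 0 → inner ℝ q p = 0 → ∃ v, v ≠ 0 ∧ 0 < quadForm q v := by
      intro q hq hqp
      by_contra! hneg
      have hnn : ((-q : Sym m) : Matrix (Fin m) (Fin m) ℝ).PosSemidef := by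
        rw [Matrix.posSemidef_iff_dotProduct_mulVec]
        have hs : ((-q : Sym m) : Matrix (Fin m) (Fin m) ℝ)ᵀ = (-q : Sym m) := (-q).2
        refine ⟨by rwa [Matrix.IsHermitian, Matrix.conjTranspose_eq_transpose_of_trivial],
          fun v => ?_⟩
        change 0 ≤ quadForm (-q) v
        rcases eq_or_ne v 0 with rfl | hv
        · simp [quadForm]
        · have := hneg v hv
          rw [← neg_one_smul ℝ q, quadForm_smul]
          linarith
      have h1 := inner_pos_of_posDef hp hnn (neg_ne_zero.mpr hq)
      rw [inner_neg_right, real_inner_comm, hqp] at h1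
      simp at h1
    obtain ⟨v, hv, hvp⟩ := key _ ξ.dir_ne_zero h0
    obtain ⟨w, hw, hwp⟩ := key (-ξ.dir) (neg_ne_zero.mpr ξ.dir_ne_zero)
      (by rw [inner_neg_left, h0, neg_zero])
    rw [← neg_one_smul ℝ, quadForm_smul] at hwp
    have hv0 := dotProduct_self_pos' hv
    have hw0 := dotProduct_self_pos' hw
    set a := min (quadForm ξ.dir v / (2 * (v ⬝ᵥ v))) (-quadForm ξ.dir w / (2 * (w ⬝ᵥ w)))
    have ha : 0 < a := lt_min (by positivity) (div_pos (by linarith) (by positivity))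
    have ha1 : a * (v ⬝ᵥ v) < quadForm ξ.dir v := by
      have := min_le_left (quadForm ξ.dir v / (2 * (v ⬝ᵥ v))) (-quadForm ξ.dir w / (2 * (w ⬝ᵥ w)))
      rw [le_div_iff₀ (by positivity)] at this
      linarith
    have ha2 : a * (w ⬝ᵥ w) < -quadForm ξ.dir w := by
      have := min_le_right (quadForm ξ.dir v / (2 * (v ⬝ᵥ v))) (-quadForm ξ.dir w / (2 * (w ⬝ᵥ w)))
      rw [le_div_iff₀ (by positivity)] at this
      linarith
    have hc : ∀ v, Continuous fun η : SphereBundle u => quadForm η.dir v := fun v =>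
      (continuous_quadForm v).comp SphereBundle.continuous_dir
    refine ⟨{η | a * (v ⬝ᵥ v) < quadForm η.dir v} ∩ {η | a * (w ⬝ᵥ w) < -quadForm η.dir w},
      mem_nhdsWithin_of_mem_nhds (Filter.inter_mem
        ((isOpen_lt continuous_const (hc v)).mem_nhds ha1)
        ((isOpen_lt continuous_const (hc w).neg).mem_nhds ha2)), a, ha, ?_⟩
    rintro η ⟨h1, h2⟩
    have h2' : a * (w ⬝ᵥ w) < -quadForm η.dir w := h2
    exact ⟨⟨v, hv, le_of_lt h1⟩, w, hw, by linarith⟩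

end SphereBundle
end FittingFlow

namespace FittingFlow

/-! ### Deck transformations of the universal covering -/

section Covering

variable {M N : Type*} [TopologicalSpace M] [TopologicalSpace N] {π : M → N}

theorem t2Space_of_isCoveringMap [T2Space N] (hπ : IsCoveringMap π) : T2Space M := by
  refine ⟨fun x y hxy => ?_⟩
  by_cases h : π x = π y
  · exact hπ.isSeparatedMap x y h hxy
  · obtain ⟨U, V, hU, hV, hxU, hyV, hd⟩ := t2_separation h
    exact ⟨π ⁻¹' U, π ⁻¹' V, hU.preimage hπ.continuous, hV.preimage hπ.continuous, hxU, hyV,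
      hd.preimage π⟩

/-- The atlas lifted to a covering space. -/
noncomputable abbrev liftedCharts (H : Type*) [TopologicalSpace H] [ChartedSpace H N]
    (hπ : IsCoveringMap π) : ChartedSpace H M where
  atlas := {e | ∃ x, e = (hπ.isLocalHomeomorph x).choose.trans (chartAt H (π x))}
  chartAt x := (hπ.isLocalHomeomorph x).choose.trans (chartAt H (π x))
  mem_chart_source x := by
    have h := (hπ.isLocalHomeomorph x).choose_spec
    rw [OpenPartialHomeomorph.trans_source]
    refine ⟨h.1, ?_⟩
    rw [mem_preimage, ← h.2]
    exact mem_chart_source H (π x)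
  chart_mem_atlas x := ⟨x, rfl⟩

theorem mem_deckGroup {M N : Type*} [TopologicalSpace M] {π : M → N} {φ : M ≃ₜ M} :
    φ ∈ deckGroup π ↔ ∀ x, π (φ x) = π x := Iff.rfl

theorem surjective_of_isCoveringMap [PathConnectedSpace N] [Nonempty M] (hπ : IsCoveringMap π) :
    Surjective π := by
  intro y
  obtain ⟨x⟩ := ‹Nonempty M›
  obtain ⟨Γ, hΓ, -⟩ := hπ.exists_path_lifts (PathConnectedSpace.somePath (π x) y).toContinuousMap x
    (by simp)
  exact ⟨Γ 1, by
    have := congrFun hΓ 1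
    simpa using this⟩

theorem deck_eq_of_apply_eq [PreconnectedSpace M] (hπ : IsCoveringMap π) {γ η : deckGroup π} {x : M}
    (h : γ.1 x = η.1 x) : γ = η := by
  apply Subtype.ext
  ext1 z
  refine congrFun (hπ.eq_of_comp_eq γ.1.continuous η.1.continuous ?_ x h) z
  ext z
  simp only [comp_apply]
  rw [mem_deckGroup.mp γ.2, mem_deckGroup.mp η.2]

/-- `π` lifts through itself with either point as base value, and uniqueness of lifts makes the two
lifts inverse to each other. -/
theorem exists_deck_apply_eq [SimplyConnectedSpace M] [LocallyPathConnectedSpace M]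
    (hπ : IsCoveringMap π) {x y : M} (h : π x = π y) : ∃ γ : deckGroup π, γ.1 x = y := by
  obtain ⟨F, ⟨hF, hF'⟩, -⟩ := hπ.existsUnique_continuousMap_lifts ⟨π, hπ.continuous⟩ x y h.symm
  obtain ⟨G, ⟨hG, hG'⟩, -⟩ := hπ.existsUnique_continuousMap_lifts ⟨π, hπ.continuous⟩ y x h
  have hF'' : ∀ z, π (F z) = π z := fun z => congrFun hF' z
  have hG'' : ∀ z, π (G z) = π z := fun z => congrFun hG' z
  have h1 : ∀ z, G (F z) = z := fun z => congrFun
    (hπ.eq_of_comp_eq (G.continuous.comp F.continuous) continuous_id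
      (by ext z; simp [hF'', hG'']) x (by simp [hF, hG])) z
  have h2 : ∀ z, F (G z) = z := fun z => congrFun
    (hπ.eq_of_comp_eq (F.continuous.comp G.continuous) continuous_id
      (by ext z; simp [hF'', hG'']) y (by simp [hF, hG])) z
  exact ⟨⟨⟨⟨F, G, h1, h2⟩, F.continuous, G.continuous⟩, hF''⟩, hF⟩

/-- Proper discontinuity. Near a pair with equal projections at most one deck transformation
contributes, near any other pair none does, and compactness finishes. -/
theorem finite_deck_inter [T2Space N] [SimplyConnectedSpace M] [LocallyPathConnectedSpace M]
    (hπ : IsCoveringMap π) {S : Set (M × M)} (hS : IsCompact S) :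
    {γ : deckGroup π | ∃ a ∈ S, γ.1 a.1 = a.2}.Finite := by
  refine hS.induction_on (p := fun S => {γ : deckGroup π | ∃ a ∈ S, γ.1 a.1 = a.2}.Finite)
    (by simp) (fun A B hAB hB => hB.subset ?_) (fun A B hA hB => (hA.union hB).subset ?_) ?_
  · rintro γ ⟨a, ha, h⟩
    exact ⟨a, hAB ha, h⟩
  · rintro γ ⟨a, ha | ha, h⟩
    · exact Or.inl ⟨a, ha, h⟩
    · exact Or.inr ⟨a, ha, h⟩
  · rintro ⟨x, y⟩ -
    by_cases hxy : π x = π y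
    · obtain ⟨γ₀, hγ₀⟩ := exists_deck_apply_eq hπ hxy
      obtain ⟨e, he, hπe⟩ := hπ.isLocalHomeomorph y
      refine ⟨{a | a.2 ∈ e.source ∧ γ₀.1 a.1 ∈ e.source}, mem_nhdsWithin_of_mem_nhds
        (Filter.inter_mem ((e.open_source.preimage continuous_snd).mem_nhds he)
          ((e.open_source.preimage (γ₀.1.continuous.comp continuous_fst)).mem_nhds ?_)),
        (finite_singleton γ₀).subset ?_⟩
      · change γ₀.1 x ∈ e.source
        rw [hγ₀]
        exact he
      · rintro γ ⟨a, ⟨h1, h2⟩, h⟩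
        refine deck_eq_of_apply_eq hπ (x := a.1) (h.trans (e.injOn h1 h2 ?_))
        rw [← hπe, ← h, mem_deckGroup.mp γ.2, mem_deckGroup.mp γ₀.2]
    · refine ⟨{a | π a.1 ≠ π a.2}, mem_nhdsWithin_of_mem_nhds
        ((isOpen_ne_fun (hπ.continuous.comp continuous_fst)
          (hπ.continuous.comp continuous_snd)).mem_nhds hxy), finite_empty.subset ?_⟩
      rintro γ ⟨a, ha, h⟩
      exact ha (by rw [← h, mem_deckGroup.mp γ.2])

/-- Coverings are open, so finitely many projected compact neighborhoods cover `N`; deck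
transformations act transitively on fibers. -/
theorem exists_compact_fundamental [CompactSpace N] [PathConnectedSpace N]
    [SimplyConnectedSpace M] [LocallyPathConnectedSpace M] [LocallyCompactSpace M]
    (hπ : IsCoveringMap π) :
    ∃ K : Set M, IsCompact K ∧ ∀ x, ∃ γ : deckGroup π, ∃ y ∈ K, γ.1 y = x := by
  have hsurj := surjective_of_isCoveringMap hπ
  choose C hC hCx using fun x : M => exists_compact_mem_nhds x
  obtain ⟨t, ht⟩ := CompactSpace.elim_nhds_subcover (fun y : N => π '' C (surjInv hsurj y))
    (fun y => by
      have := hπ.isOpenMap.image_mem_nhds (hCx (surjInv hsurj y))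
      rwa [surjInv_eq hsurj] at this)
  refine ⟨⋃ y ∈ t, C (surjInv hsurj y), t.isCompact_biUnion fun y _ => hC _, fun x => ?_⟩
  have hx : π x ∈ ⋃ y ∈ t, π '' C (surjInv hsurj y) := by
    rw [show (⋃ y ∈ t, π '' C (surjInv hsurj y)) = ⊤ from ht]
    trivial
  simp only [mem_iUnion] at hx
  obtain ⟨y, hy, z, hz, hzx⟩ := hx
  obtain ⟨γ, hγ⟩ := exists_deck_apply_eq hπ hzx
  exact ⟨γ, z, by simp only [mem_iUnion]; exact ⟨y, hy, hz⟩, hγ⟩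

end Covering
end FittingFlow

namespace FittingFlow

/-! ### Distortion of Euclidean norms by `SL(V)` -/

section Distortion

variable {m : ℕ}

theorem dotProduct_self_nonneg' (v : Fin m → ℝ) : 0 ≤ v ⬝ᵥ v := by
  rw [← norm_rankOne]
  exact norm_nonneg _

/-- `h` and `h⁻¹` expand squared Euclidean norms by a factor at most `B`. -/
def DistortionLE (B : ℝ) (h : Matrix.SpecialLinearGroup (Fin m) ℝ) : Prop :=
  ∀ w : Fin m → ℝ, (h.1 *ᵥ w) ⬝ᵥ (h.1 *ᵥ w) ≤ B * (w ⬝ᵥ w) ∧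
    ((h⁻¹).1 *ᵥ w) ⬝ᵥ ((h⁻¹).1 *ᵥ w) ≤ B * (w ⬝ᵥ w)

theorem DistortionLE.mul {B C : ℝ} (hB : 0 ≤ B) (hC : 0 ≤ C)
    {g h : Matrix.SpecialLinearGroup (Fin m) ℝ} (hg : DistortionLE B g) (hh : DistortionLE C h) :
    DistortionLE (B * C) (g * h) := by
  intro w
  constructor
  · rw [show (g * h).1 = g.1 * h.1 from rfl, ← Matrix.mulVec_mulVec]
    refine (hg _).1.trans ?_
    rw [mul_assoc]
    exact mul_le_mul_of_nonneg_left (hh w).1 hB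
  · rw [mul_inv_rev, show (h⁻¹ * g⁻¹).1 = (h⁻¹).1 * (g⁻¹).1 from rfl, ← Matrix.mulVec_mulVec]
    refine (hh _).2.trans ?_
    rw [mul_comm B, mul_assoc]
    exact mul_le_mul_of_nonneg_left (hg w).2 hC

theorem DistortionLE.mono {B C : ℝ} (hBC : B ≤ C) {h : Matrix.SpecialLinearGroup (Fin m) ℝ}
    (hh : DistortionLE B h) : DistortionLE C h := fun w =>
  ⟨(hh w).1.trans (mul_le_mul_of_nonneg_right hBC (dotProduct_self_nonneg' w)),
    (hh w).2.trans (mul_le_mul_of_nonneg_right hBC (dotProduct_self_nonneg' w))⟩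

theorem dotProduct_mulVec_self_le (A : Matrix (Fin m) (Fin m) ℝ) :
    ∃ B : ℝ, ∀ w : Fin m → ℝ, (A *ᵥ w) ⬝ᵥ (A *ᵥ w) ≤ B * (w ⬝ᵥ w) := by
  set q : Sym m := ⟨Aᵀ * A, by
    change (Aᵀ * A)ᵀ = _
    rw [Matrix.transpose_mul, Matrix.transpose_transpose]⟩
  refine ⟨‖q‖, fun w => ?_⟩
  have h : quadForm q w = (A *ᵥ w) ⬝ᵥ (A *ᵥ w) := by
    simp only [quadForm, q]
    rw [← Matrix.mulVec_mulVec, Matrix.dotProduct_mulVec, Matrix.vecMul_transpose]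
  rw [← h]
  exact (le_abs_self _).trans (abs_quadForm_le q w)

theorem exists_distortionLE (h : Matrix.SpecialLinearGroup (Fin m) ℝ) :
    ∃ B, 1 ≤ B ∧ DistortionLE B h := by
  obtain ⟨B, hB⟩ := dotProduct_mulVec_self_le h.1
  obtain ⟨C, hC⟩ := dotProduct_mulVec_self_le (h⁻¹).1
  refine ⟨max 1 (max B C), le_max_left _ _, fun w => ⟨(hB w).trans ?_, (hC w).trans ?_⟩⟩
  · exact mul_le_mul_of_nonneg_right ((le_max_left _ _).trans (le_max_right _ _))
      (dotProduct_self_nonneg' w)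
  · exact mul_le_mul_of_nonneg_right ((le_max_right _ _).trans (le_max_right _ _))
      (dotProduct_self_nonneg' w)

theorem exists_distortionLE_of_finite {G : Type*} (f : G → Matrix.SpecialLinearGroup (Fin m) ℝ)
    {S : Set G} (hS : S.Finite) : ∃ B, 1 ≤ B ∧ ∀ γ ∈ S, DistortionLE B (f γ) := by
  induction S, hS using Set.Finite.induction_on with
  | empty => exact ⟨1, le_rfl, by simp⟩
  | insert _ _ ih =>
    obtain ⟨B, hB, h⟩ := ih
    rename_i γ s _ _
    obtain ⟨C, hC, h'⟩ := exists_distortionLE (f γ)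
    refine ⟨max B C, hB.trans (le_max_left _ _), ?_⟩
    rintro η (rfl | hη)
    · exact h'.mono (le_max_right _ _)
    · exact (h η hη).mono (le_max_left _ _)

end Distortion

/-! ### Exponential growth of quadrics along the flow -/

section Growth

variable {M N : Type*} [TopologicalSpace M] {π : M → N} {d m : ℕ}
  {ρ : deckGroup π →* Matrix.SpecialLinearGroup (Fin m) ℝ} {u : M → GrMix d m}

theorem SphereBundle.proj_act (hu : IsEquivariant ρ u) (γ : deckGroup π) (ξ : SphereBundle u) :
    (SphereBundle.act hu γ ξ).proj = γ.1 ξ.proj := by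
  induction ξ using Quotient.inductionOn with
  | h v => rfl

theorem SphereBundle.act_act_inv (hu : IsEquivariant ρ u) (γ : deckGroup π) (ξ : SphereBundle u) :
    SphereBundle.act hu γ (SphereBundle.act hu γ⁻¹ ξ) = ξ := by
  induction ξ using Quotient.inductionOn with
  | h v =>
    change SphereBundle.mk (PunctBundle.act hu γ (PunctBundle.act hu γ⁻¹ v)) = SphereBundle.mk v
    congr 1
    apply Subtype.ext
    apply Prod.ext
    · change γ.1 ((γ.1)⁻¹ v.1.1) = v.1.1
      rw [← Homeomorph.mul_apply, mul_inv_cancel]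
      rfl
    · change actQuadric (ρ γ) (actQuadric (ρ γ⁻¹) v.1.2) = v.1.2
      have := actQuadric_inv (ρ γ⁻¹) v.1.2
      rwa [← map_inv, inv_inv] at this

theorem SphereBundle.exists_dir_act (hu : IsEquivariant ρ u) (γ : deckGroup π)
    (ξ : SphereBundle u) : ∃ c : ℝ, 0 < c ∧
      (SphereBundle.act hu γ ξ).dir = c • actQuadric (ρ γ) ξ.dir := by
  induction ξ using Quotient.inductionOn with
  | h v =>
    have hv := norm_pos_iff.mpr v.2.2
    have hv' := norm_pos_iff.mpr (PunctBundle.act hu γ v).2.2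
    refine ⟨‖(PunctBundle.act hu γ v).1.2‖⁻¹ * ‖v.1.2‖, mul_pos (inv_pos.mpr hv') hv, ?_⟩
    change ‖(PunctBundle.act hu γ v).1.2‖⁻¹ • actQuadric (ρ γ) v.1.2 =
      (‖(PunctBundle.act hu γ v).1.2‖⁻¹ * ‖v.1.2‖) • actQuadric (ρ γ) (‖v.1.2‖⁻¹ • v.1.2)
    rw [map_smul, smul_smul, mul_assoc, mul_inv_cancel₀ hv.ne', mul_one]

variable (hu : IsEquivariant ρ u)

/-- Every quadric direction over `γ K` is the translate of one over `K`. -/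
theorem exists_translate (γ : deckGroup π) (ξ : SphereBundle u) : ∃ c : ℝ, 0 < c ∧
    ∀ v, quadForm ξ.dir v = c * quadForm (SphereBundle.act hu γ⁻¹ ξ).dir (((ρ γ)⁻¹).1 *ᵥ v) := by
  obtain ⟨c, hc, h⟩ := SphereBundle.exists_dir_act hu γ (SphereBundle.act hu γ⁻¹ ξ)
  rw [SphereBundle.act_act_inv] at h
  refine ⟨c, hc, fun v => ?_⟩
  rw [h, quadForm_smul, quadForm_actQuadric]

variable {Φ : Flow ℝ (SphereBundle u)} (hΦ : IsFittingFlow Φ) (hΦρ : IsEquivariantFlow hu Φ)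
  (hcont : Continuous u) {K : Set M} (hK : IsCompact K)
  (hKM : ∀ x, ∃ γ : deckGroup π, ∃ y ∈ K, γ.1 y = x)

theorem inv_mem_of_eq {γ : deckGroup π} {x y : M} (hy : y ∈ K) (h : γ.1 y = x) :
    (γ⁻¹).1 x ∈ K := by
  have : (γ⁻¹).1 x = y := by
    rw [← h]
    change ((γ.1)⁻¹) (γ.1 y) = y
    rw [← Homeomorph.mul_apply, inv_mul_cancel]
    rfl
  rwa [this]

include hΦ hΦρ hcont hK hKM

/-- Over `K` the uniform gap `ε (v ⬝ᵥ v)` dominates `ε |q(v)|` for unit `q`. The weakened inequality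
mentions only values of quadrics, so it survives rescaling and the linear action, and equivariance
carries it from `K` to every point. -/
theorem exists_step : ∃ ε : ℝ, 0 < ε ∧ ε < 1 ∧ ∀ (ξ : SphereBundle u) (c : ℝ), 0 < c →
    ∃ c' : ℝ, 0 < c' ∧ ∀ v, c * quadForm ξ.dir v + ε * |c * quadForm ξ.dir v| ≤
      c' * quadForm (Φ 1 ξ).dir v := by
  obtain ⟨ε, hε, h⟩ := hΦ.exists_uniform (isCompact_proj_preimage hcont hK) one_pos
  refine ⟨min ε (1 / 2), lt_min hε one_half_pos,
    (min_le_right _ _).trans_lt one_half_lt_one, fun ξ c hc => ?_⟩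
  obtain ⟨γ, y, hy, hγ⟩ := hKM ξ.proj
  set η := SphereBundle.act hu γ⁻¹ ξ
  have hηξ : SphereBundle.act hu γ η = ξ := SphereBundle.act_act_inv hu γ ξ
  obtain ⟨s, hs, hsv⟩ := exists_translate hu γ ξ
  obtain ⟨l, hl, hlv⟩ := h η (by
    change η.proj ∈ K
    rw [SphereBundle.proj_act]
    exact inv_mem_of_eq hy hγ)
  obtain ⟨r, hr, hrv⟩ := SphereBundle.exists_dir_act hu γ (Φ 1 η)
  rw [← hΦρ, hηξ] at hrv
  refine ⟨c * s * l * r⁻¹, by positivity, fun v => ?_⟩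
  set w := ((ρ γ)⁻¹).1 *ᵥ v
  have h1 := hlv w
  rw [quadForm_sub, quadForm_smul] at h1
  have h2 : quadForm (Φ 1 ξ).dir v = r * quadForm (Φ 1 η).dir w := by
    rw [hrv, quadForm_smul, quadForm_actQuadric]
  have h3 : |quadForm η.dir w| ≤ w ⬝ᵥ w := by
    have := abs_quadForm_le η.dir w
    rwa [SphereBundle.norm_dir, one_mul] at this
  have h4 : min ε (1 / 2) * |quadForm η.dir w| ≤ ε * (w ⬝ᵥ w) :=
    mul_le_mul (min_le_left _ _) h3 (abs_nonneg _) hε.le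
  rw [hsv v, h2, abs_mul, abs_mul, abs_of_pos hc, abs_of_pos hs]
  have h5 : quadForm η.dir w + min ε (1 / 2) * |quadForm η.dir w| ≤
      l * quadForm (Φ 1 η).dir w := by linarith
  have h6 := mul_le_mul_of_nonneg_left h5 (mul_pos hc hs).le
  calc _ = c * s * (quadForm η.dir w + min ε (1 / 2) * |quadForm η.dir w|) := by ring
    _ ≤ c * s * (l * quadForm (Φ 1 η).dir w) := h6
    _ = _ := by field_simp

/-- Iteration of `exists_step`. Positive values are multiplied by at least `1 + ε`; values that stay
negative have absolute value multiplied by at most `1 - ε ≤ (1 + ε)⁻¹`, so the base `b = 1 + ε`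
serves both. What matters is that the scalar `c` does not depend on `v`. -/
theorem exists_growth : ∃ b : ℝ, 1 < b ∧ ∀ (k : ℕ) (ξ : SphereBundle u), ∃ c : ℝ, 0 < c ∧ ∀ v,
    (0 < quadForm ξ.dir v → b ^ k * quadForm ξ.dir v ≤ c * quadForm (Φ k ξ).dir v) ∧
    (quadForm (Φ k ξ).dir v < 0 →
      b ^ k * (c * -quadForm (Φ k ξ).dir v) ≤ -quadForm ξ.dir v) := by
  obtain ⟨ε, hε, hε1, h⟩ := exists_step hu hΦ hΦρ hcont hK hKM
  refine ⟨1 + ε, by linarith, fun k => ?_⟩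
  induction k with
  | zero =>
    intro ξ
    refine ⟨1, one_pos, fun v => ?_⟩
    have : Φ ((0 : ℕ) : ℝ) ξ = ξ := by rw [Nat.cast_zero, Flow.map_zero_apply]
    rw [this]
    constructor <;> intro _ <;> simp
  | succ k ih =>
    intro ξ
    obtain ⟨c, hc, hv⟩ := ih ξ
    obtain ⟨c', hc', hv'⟩ := h (Φ k ξ) c hc
    have hadd : Φ 1 (Φ k ξ) = Φ ((k + 1 : ℕ) : ℝ) ξ := by
      rw [← Flow.map_add]; push_cast; rw [add_comm]
    rw [hadd] at hv'
    refine ⟨c', hc', fun v => ⟨fun hpos => ?_, fun hneg => ?_⟩⟩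
    · have h1 := (hv v).1 hpos
      have h2 := hv' v
      have h3 : 0 < (1 + ε) ^ k * quadForm ξ.dir v := by positivity
      rw [abs_of_pos (h3.trans_le h1)] at h2
      rw [pow_succ]
      nlinarith
    · have h2 := hv' v
      have h3 : c * quadForm (Φ k ξ).dir v < 0 := by
        by_contra! h0
        have h4 : 0 ≤ c' * quadForm (Φ ((k + 1 : ℕ) : ℝ) ξ).dir v := by
          refine le_trans ?_ h2
          positivity
        exact absurd (mul_neg_of_pos_of_neg hc' hneg) (not_lt.mpr h4)
      have h4 := (hv v).2 (neg_of_mul_neg_right h3 hc.le)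
      rw [abs_of_neg h3] at h2
      set A := -(c * quadForm (Φ k ξ).dir v)
      set B := -(c' * quadForm (Φ ((k + 1 : ℕ) : ℝ) ξ).dir v)
      have hA : 0 < A := by simp only [A]; linarith
      have hBA : B ≤ (1 - ε) * A := by simp only [A, B]; linarith
      have h5 : (1 + ε) * B ≤ A := by
        have h6 : (1 + ε) * B ≤ (1 + ε) * ((1 - ε) * A) :=
          mul_le_mul_of_nonneg_left hBA (by positivity)
        nlinarith [mul_pos (mul_pos hε hε) hA]
      calc (1 + ε) ^ (k + 1) * (c' * -quadForm (Φ ((k + 1 : ℕ) : ℝ) ξ).dir v)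
          = (1 + ε) ^ k * ((1 + ε) * B) := by simp only [B]; ring
        _ ≤ (1 + ε) ^ k * A := by gcongr
        _ ≤ -quadForm ξ.dir v := by
          refine le_trans (le_of_eq ?_) h4
          simp only [A]; ring

/-- Along flow lines the holonomy expands exponentially. -/
theorem exists_expansion : ∃ a b : ℝ, 0 < a ∧ 1 < b ∧ ∀ (k : ℕ) (ξ : SphereBundle u)
    (γ γ' : deckGroup π), (γ⁻¹).1 ξ.proj ∈ K → (γ'⁻¹).1 (Φ k ξ).proj ∈ K →
      ∀ B, 0 ≤ B → DistortionLE B (ρ (γ⁻¹ * γ')) → a * b ^ k ≤ B := by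
  obtain ⟨b, hb, hgrow⟩ := exists_growth hu hΦ hΦρ hcont hK hKM
  obtain ⟨a, ha, hsign⟩ := exists_uniform_quadForm (isCompact_proj_preimage hcont hK)
  refine ⟨a, b, ha, hb, fun k ξ γ γ' hγ hγ' B hB hdist => ?_⟩
  obtain ⟨c, hc, hg⟩ := hgrow k ξ
  obtain ⟨s, hs, hsv⟩ := exists_translate hu γ ξ
  obtain ⟨s', hs', hsv'⟩ := exists_translate hu γ' (Φ k ξ)
  -- A positive vector `v` for the initial quadric and a negative vector `w` for the final one, each
  -- chosen after translation to `K`, where the bounds are uniform.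
  obtain ⟨⟨v, hv, hva⟩, -⟩ := hsign (SphereBundle.act hu γ⁻¹ ξ)
    (by change SphereBundle.proj _ ∈ K; rwa [SphereBundle.proj_act])
  obtain ⟨-, w, hw, hwa⟩ := hsign (SphereBundle.act hu γ'⁻¹ (Φ k ξ))
    (by change SphereBundle.proj _ ∈ K; rwa [SphereBundle.proj_act])
  have hcancel : ∀ (g : Matrix.SpecialLinearGroup (Fin m) ℝ) (x : Fin m → ℝ),
      (g⁻¹).1 *ᵥ (g.1 *ᵥ x) = x := by
    intro g x
    rw [Matrix.mulVec_mulVec, ← Matrix.SpecialLinearGroup.coe_mul, inv_mul_cancel,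
      Matrix.SpecialLinearGroup.coe_one, Matrix.one_mulVec]
  have hv0 := dotProduct_self_pos' hv
  have hw0 := dotProduct_self_pos' hw
  have hbk : 0 < b ^ k := by positivity
  have e1 : ((ρ γ')⁻¹).1 *ᵥ ((ρ γ).1 *ᵥ v) = ((ρ (γ⁻¹ * γ'))⁻¹).1 *ᵥ v := by
    rw [Matrix.mulVec_mulVec, ← Matrix.SpecialLinearGroup.coe_mul, map_mul, mul_inv_rev, map_inv,
      inv_inv]
  have e2 : ((ρ γ)⁻¹).1 *ᵥ ((ρ γ').1 *ᵥ w) = (ρ (γ⁻¹ * γ')).1 *ᵥ w := by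
    rw [Matrix.mulVec_mulVec, ← Matrix.SpecialLinearGroup.coe_mul, map_mul, map_inv]
  have hunit : ∀ (η : SphereBundle u) x, |quadForm η.dir x| ≤ x ⬝ᵥ x := by
    intro η x
    have := abs_quadForm_le η.dir x
    rwa [SphereBundle.norm_dir, one_mul] at this
  have h1 : b ^ k * (s * (a * (v ⬝ᵥ v))) ≤ c * (s' * (B * (v ⬝ᵥ v))) := by
    have h2 : quadForm ξ.dir ((ρ γ).1 *ᵥ v) =
        s * quadForm (SphereBundle.act hu γ⁻¹ ξ).dir v := by rw [hsv, hcancel]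
    have h3 : 0 < quadForm ξ.dir ((ρ γ).1 *ᵥ v) := by
      rw [h2]
      exact mul_pos hs ((mul_pos ha hv0).trans_le hva)
    have h4 := (hg _).1 h3
    rw [h2, hsv', e1] at h4
    refine (mul_le_mul_of_nonneg_left (mul_le_mul_of_nonneg_left hva hs.le) hbk.le).trans
      (h4.trans (mul_le_mul_of_nonneg_left (mul_le_mul_of_nonneg_left ?_ hs'.le) hc.le))
    exact ((le_abs_self _).trans (hunit _ _)).trans (hdist v).2
  have h5 : b ^ k * (c * (s' * (a * (w ⬝ᵥ w)))) ≤ s * (B * (w ⬝ᵥ w)) := by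
    have h2 : quadForm (Φ k ξ).dir ((ρ γ').1 *ᵥ w) =
        s' * quadForm (SphereBundle.act hu γ'⁻¹ (Φ k ξ)).dir w := by rw [hsv', hcancel]
    have h3 : quadForm (Φ k ξ).dir ((ρ γ').1 *ᵥ w) < 0 := by
      rw [h2]
      exact mul_neg_of_pos_of_neg hs' (hwa.trans_lt (neg_neg_of_pos (mul_pos ha hw0)))
    have h4 := (hg _).2 h3
    rw [h2, hsv, e2] at h4
    have h6 : s' * (a * (w ⬝ᵥ w)) ≤ -(s' * quadForm (SphereBundle.act hu γ'⁻¹ (Φ k ξ)).dir w) := by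
      rw [← mul_neg]
      exact mul_le_mul_of_nonneg_left (by linarith) hs'.le
    refine (mul_le_mul_of_nonneg_left (mul_le_mul_of_nonneg_left h6 hc.le) hbk.le).trans
      (h4.trans ?_)
    rw [← mul_neg]
    refine mul_le_mul_of_nonneg_left ?_ hs.le
    exact ((neg_le_abs _).trans (hunit _ _)).trans (hdist w).1
  have h7 : b ^ k * (s * a) ≤ c * s' * B := by
    refine le_of_mul_le_mul_right (le_trans (le_of_eq ?_) (h1.trans (le_of_eq ?_))) hv0 <;> ring
  have h8 : b ^ k * (c * s' * a) ≤ s * B := by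
    refine le_of_mul_le_mul_right (le_trans (le_of_eq ?_) (h5.trans (le_of_eq ?_))) hw0 <;> ring
  have hcs : 0 < c * s' := mul_pos hc hs'
  -- The scalars `c`, `s`, `s'` are uncontrolled, but they cancel in the product of the two
  -- estimates.
  have h9 : (a * b ^ k) * (a * b ^ k) ≤ B * B := by
    have := mul_le_mul h7 h8 (by positivity) (by positivity)
    refine le_of_mul_le_mul_left (a := s * (c * s')) ?_ (mul_pos hs hcs)
    calc _ = b ^ k * (s * a) * (b ^ k * (c * s' * a)) := by ring
      _ ≤ c * s' * B * (s * B) := this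
      _ = _ := by ring
  exact abs_le_of_sq_le_sq' (by rw [sq, sq]; exact h9) hB |>.2

/-- A positive tensor is eventually positive on all quadrics flowing from a compact set. -/
theorem exists_inner_pos {S : Set (SphereBundle u)} (hS : IsCompact S) {p : SymTensor m}
    (hp : (p : Matrix (Fin m) (Fin m) ℝ).PosDef) :
    ∃ k : ℕ, 0 < k ∧ ∀ ξ ∈ S, 0 < inner ℝ (Φ k ξ).dir p := by
  obtain ⟨b, hb, hgrow⟩ := exists_growth hu hΦ hΦρ hcont hK hKM
  obtain ⟨a, ha, hsign⟩ := exists_uniform_quadForm hS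
  obtain ⟨ε, hε, hεp⟩ := exists_le_quadForm hp
  -- `k` is taken so that the gain `ε * a * b ^ (k + 1)` on the rank one part exceeds the possible
  -- loss, at most the pairing of `idQuadric m` with `p`; using `k + 1` keeps the time positive.
  obtain ⟨k, hk⟩ := pow_unbounded_of_one_lt (inner ℝ (idQuadric m) p / (ε * a)) hb
  refine ⟨k + 1, Nat.succ_pos _, fun ξ hξ => ?_⟩
  obtain ⟨c, hc, hg⟩ := hgrow (k + 1) ξ
  obtain ⟨⟨w, hw, hwa⟩, -⟩ := hsign ξ hξ
  have hw0 := dotProduct_self_pos' hw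
  set q := (Φ ((k + 1 : ℕ) : ℝ) ξ).dir
  have hb1 : 1 ≤ b ^ (k + 1) := one_le_pow₀ hb.le
  have hbk : b ^ k < b ^ (k + 1) := pow_lt_pow_right₀ hb (Nat.lt_succ_self k)
  -- A multiple of `w ⊗ w` is removed from `p`, small enough to leave a semi-positive tensor. On the
  -- remainder `c • q` pairs almost nonnegatively, being at least `-b ^ (-(k + 1))` times the
  -- Euclidean form; on the removed part its value `c q(w)` is exponentially large.
  set p' : Sym m := p - (ε / (w ⬝ᵥ w)) • rankOne w
  have hp' : (p' : Matrix (Fin m) (Fin m) ℝ).PosSemidef := by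
    rw [Matrix.posSemidef_iff_dotProduct_mulVec]
    have hs : (p' : Matrix (Fin m) (Fin m) ℝ)ᵀ = p' := p'.2
    refine ⟨by rwa [Matrix.IsHermitian, Matrix.conjTranspose_eq_transpose_of_trivial], fun v => ?_⟩
    change 0 ≤ quadForm p' v
    have h1 : quadForm (rankOne w) v ≤ (w ⬝ᵥ w) * (v ⬝ᵥ v) := by
      have := (le_abs_self _).trans (abs_quadForm_le (rankOne w) v)
      rwa [norm_rankOne] at this
    rw [quadForm_sub, quadForm_smul, sub_nonneg]
    calc ε / (w ⬝ᵥ w) * quadForm (rankOne w) v ≤ ε / (w ⬝ᵥ w) * ((w ⬝ᵥ w) * (v ⬝ᵥ v)) := by gcongr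
      _ = ε * (v ⬝ᵥ v) := by field_simp
      _ ≤ _ := hεp v
  have h1 : 0 ≤ inner ℝ (c • q + (b ^ (k + 1))⁻¹ • idQuadric m) p' := by
    refine inner_nonneg_of_posSemidef (fun v => ?_) hp'
    rw [quadForm_add, quadForm_smul, quadForm_smul, quadForm_idQuadric]
    have hvv := dotProduct_self_nonneg' v
    rcases le_or_gt 0 (quadForm q v) with h | h
    · positivity
    · have h2 := (hg v).2 h
      have h3 : -quadForm ξ.dir v ≤ v ⬝ᵥ v := by
        have := (neg_le_abs _).trans (abs_quadForm_le ξ.dir v)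
        rwa [SphereBundle.norm_dir, one_mul] at this
      have h4 : c * -quadForm q v ≤ (b ^ (k + 1))⁻¹ * (v ⬝ᵥ v) := by
        rw [le_inv_mul_iff₀ (by positivity)]
        exact h2.trans h3
      linarith
  have h2 : b ^ (k + 1) * (a * (w ⬝ᵥ w)) ≤ c * quadForm q w := by
    have h3 := (hg w).1 ((mul_pos ha hw0).trans_le hwa)
    exact (mul_le_mul_of_nonneg_left hwa (by positivity)).trans h3
  have h3 : inner ℝ (idQuadric m) p' ≤ inner ℝ (idQuadric m) p := by
    simp only [p', inner_sub_right, real_inner_smul_right, inner_rankOne, quadForm_idQuadric]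
    have : 0 ≤ ε / (w ⬝ᵥ w) * (w ⬝ᵥ w) := by positivity
    linarith
  have h4 : inner ℝ (c • q) p' = c * inner ℝ q p - ε / (w ⬝ᵥ w) * (c * quadForm q w) := by
    simp only [p', inner_sub_right, real_inner_smul_right, real_inner_smul_left, inner_rankOne]
  rw [inner_add_left, h4, real_inner_smul_left] at h1
  have h5 : ε * a * b ^ (k + 1) ≤ ε / (w ⬝ᵥ w) * (c * quadForm q w) := by
    calc ε * a * b ^ (k + 1) = ε / (w ⬝ᵥ w) * (b ^ (k + 1) * (a * (w ⬝ᵥ w))) := by field_simp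
      _ ≤ _ := by gcongr
  have h6 : inner ℝ (idQuadric m) p < ε * a * b ^ (k + 1) := by
    rw [div_lt_iff₀ (by positivity)] at hk
    have : b ^ k * (ε * a) < b ^ (k + 1) * (ε * a) := by gcongr
    linarith
  have h0 : 0 ≤ inner ℝ (idQuadric m) p := by
    refine inner_nonneg_of_posSemidef (fun v => ?_) hp.posSemidef
    rw [quadForm_idQuadric]
    exact dotProduct_self_nonneg' v
  have h7 : (b ^ (k + 1))⁻¹ * inner ℝ (idQuadric m) p' ≤ inner ℝ (idQuadric m) p := by
    calc (b ^ (k + 1))⁻¹ * inner ℝ (idQuadric m) p' ≤ (b ^ (k + 1))⁻¹ * inner ℝ (idQuadric m) p := by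
          gcongr
      _ ≤ 1 * inner ℝ (idQuadric m) p := by
          gcongr
          exact inv_le_one_of_one_le₀ hb1
      _ = _ := one_mul _
  exact pos_of_mul_pos_right (by linarith : 0 < c * inner ℝ q p) hc.le

end Growth
end FittingFlow

/-! ### Polar coordinates on the ball -/

section Polar

open unitInterval

variable {E : Type*} [NormedAddCommGroup E] [InnerProductSpace ℝ E]

/-- Polar coordinates on the closed unit ball. -/
def polar (t : I) (w : sphere (0 : E) 1) : closedBall (0 : E) 1 :=
  ⟨(t : ℝ) • (w : E), by
    rw [mem_closedBall_zero_iff, norm_smul, norm_eq_of_mem_sphere w, mul_one,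
      Real.norm_of_nonneg t.2.1]
    exact t.2.2⟩

theorem polar_one (w : sphere (0 : E) 1) : polar 1 w = sphereToBall w :=
  Subtype.ext (one_smul ℝ _)

theorem exists_polar [Nontrivial E] (v : closedBall (0 : E) 1) : ∃ t w, polar t w = v := by
  obtain ⟨w₀, hw₀⟩ := (NormedSpace.sphere_nonempty (E := E) (x := 0) (r := 1)).mpr zero_le_one
  by_cases h : (v : E) = 0
  · exact ⟨0, ⟨w₀, hw₀⟩, Subtype.ext ((zero_smul ℝ _).trans h.symm)⟩
  · have hv : ‖(v : E)‖ ≠ 0 := norm_ne_zero_iff.mpr h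
    refine ⟨⟨‖(v : E)‖, norm_nonneg _, mem_closedBall_zero_iff.mp v.2⟩,
      ⟨‖(v : E)‖⁻¹ • (v : E), ?_⟩, Subtype.ext (smul_inv_smul₀ hv _)⟩
    rw [mem_sphere_zero_iff_norm, norm_smul, norm_inv, norm_norm, inv_mul_cancel₀ hv]

/-- A continuous family of maps in polar coordinates descends to the ball if it is constant on
the sphere of radius zero. -/
theorem exists_continuous_polar [FiniteDimensional ℝ E] [Nontrivial E] {Z : Type*}
    [TopologicalSpace Z] {h : I × I × sphere (0 : E) 1 → Z} (hh : Continuous h)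
    (h0 : ∀ s w w', h (s, 0, w) = h (s, 0, w')) :
    ∃ F : I × closedBall (0 : E) 1 → Z, Continuous F ∧ ∀ s t w, F (s, polar t w) = h (s, t, w) := by
  let q : C(I × I × sphere (0 : E) 1, I × closedBall (0 : E) 1) :=
    ⟨fun a => (a.1, polar a.2.1 a.2.2), by
      unfold polar
      refine continuous_fst.prodMk (Continuous.subtype_mk ?_ _)
      fun_prop⟩
  have hq : Topology.IsQuotientMap q := by
    refine q.continuous.isClosedMap.isQuotientMap q.continuous ?_
    rintro ⟨s, v⟩
    obtain ⟨t, w, rfl⟩ := exists_polar v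
    exact ⟨(s, t, w), rfl⟩
  have hfac : FactorsThrough (⟨h, hh⟩ : C(I × I × sphere (0 : E) 1, Z)) q := by
    rintro ⟨s, t, w⟩ ⟨s', t', w'⟩ hab
    obtain ⟨rfl, hv⟩ := Prod.ext_iff.mp hab
    have hv' : (t : ℝ) • (w : E) = (t' : ℝ) • (w' : E) := congrArg Subtype.val hv
    have ht : t = t' := by
      have := congrArg norm hv'
      rw [norm_smul, norm_smul, norm_eq_of_mem_sphere w, norm_eq_of_mem_sphere w', mul_one,
        mul_one, Real.norm_of_nonneg t.2.1, Real.norm_of_nonneg t'.2.1] at this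
      exact Subtype.ext this
    subst ht
    by_cases ht : t = 0
    · subst ht
      exact h0 s w w'
    · have ht' : (t : ℝ) ≠ 0 := fun h => ht (Subtype.ext h)
      have hw : w = w' := Subtype.ext (smul_right_injective E ht' hv')
      subst hw
      rfl
  refine ⟨hq.lift ⟨h, hh⟩ hfac, ContinuousMap.continuous _, fun s t w => ?_⟩
  exact congrArg (fun f : C(I × I × sphere (0 : E) 1, Z) => f (s, t, w)) (hq.lift_comp ⟨h, hh⟩ hfac)

end Polar

namespace FittingFlow

/-! ### Reaching a point by flow lines: the degree argument -/

section Surjectivity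

open unitInterval

variable {M : Type*} [TopologicalSpace M] {d m : ℕ} {u : M → GrMix d m}
  {Φ : Flow ℝ (SphereBundle u)}

/-- A positive definite difference `c q' - q` pairs positively with a nonzero semi-positive tensor,
so vanishing of the pairing with `q` forces positivity with `q'`. Global fitting and the count of
zeros over `x` both rest on this. -/
theorem IsFittingFlow.inner_pos (hΦ : IsFittingFlow Φ) {t : ℝ} (ht : 0 < t) {ξ : SphereBundle u}
    {p : SymTensor m} (hp : (p : Matrix (Fin m) (Fin m) ℝ).PosSemidef) (hp0 : p ≠ 0)
    (h : inner ℝ ξ.dir p = 0) : 0 < inner ℝ (Φ t ξ).dir p := by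
  obtain ⟨c, hc, hpos⟩ := hΦ.exists_dir ht ξ
  have h1 := inner_pos_of_posDef hpos hp hp0
  rw [inner_sub_left, real_inner_smul_left, h, sub_zero] at h1
  exact pos_of_mul_pos_right h1 hc.le

theorem ne_zero_of_posDef {p : SymTensor m} (hm : m ≠ 0)
    (hp : (p : Matrix (Fin m) (Fin m) ℝ).PosDef) : p ≠ 0 := by
  rintro rfl
  have h := hp.diag_pos (i := ⟨0, Nat.pos_of_ne_zero hm⟩)
  exact lt_irrefl _ h

-- By contradiction. For `s ∈ [0, 1]`, the rays over `γ s` flowed for times in `[0, R]` give a map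
-- `F (s, ·)` of the unit ball of `u(x)` to `M`. The projected tensor `p`, perturbed and pulled back
-- through trivializations, gives vector fields `g (s, ·)` on this ball whose boundary values are
-- homotopic to the radial field, thanks to `hRp`. At `s = 0` all zeros of `g` lie over a small
-- neighborhood `V` of `x`; at `s = 1` none does, since `F (1, ·)` misses `V`. No zero lies over the
-- frontier of `V`, so a continuous function `τ` can separate the two kinds of zeros, and
-- `exists_zero_on_graph` then produces an impossible one.
set_option maxHeartbeats 400000 in
theorem exists_flow_proj_eq [T2Space M] (hd : 0 < d) (hm : m ≠ 0) (hcont : Continuous u)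
    (hΦ : IsFittingFlow Φ) {x y : M}
    (e : OpenPartialHomeomorph M (EuclideanSpace ℝ (Fin d))) (hx : x ∈ e.source)
    (γ : Path x y) {p : SymTensor m} (hp : (p : Matrix (Fin m) (Fin m) ℝ).PosDef)
    (hpx : ∀ q ∈ (u x).toSubmodule, inner ℝ q p = 0) {R : ℝ} (hR : 0 < R)
    (hRp : ∀ ξ : SphereBundle u, ξ.proj ∈ range γ → 0 < inner ℝ (Φ R ξ).dir p) :
    ∃ (ξ : SphereBundle u) (t : ℝ), 0 ≤ t ∧ ξ.proj = y ∧ (Φ t ξ).proj = x := by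
  by_contra! hno
  have hp0 := ne_zero_of_posDef hm hp
  set E := (u x).toSubmodule with hE
  have hEd : Module.finrank ℝ E = d := finrank_toSubmodule x
  have : Nontrivial E := Module.nontrivial_of_finrank_pos (R := ℝ) (by rw [hEd]; exact hd)
  have hproj := continuous_proj𝒬 hcont
  obtain ⟨T₁, hT₁c, hT₁0, hT₁u, hT₁⟩ := exists_transport (X := PUnit.{1})
    (W := fun a : I × PUnit.{1} => (u (γ a.1)).toSubmodule)
    (hproj.comp (γ.continuous.comp continuous_fst))
  set S : I → Quadric m →L[ℝ] Quadric m := fun s => T₁ (s, ⟨⟩)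
  have hSc : Continuous S := hT₁c.comp (by fun_prop)
  have hS0 : S 0 = 1 := hT₁0 _
  have hSu : ∀ s, IsUnit (S s) := fun s => hT₁u _
  have hSmul : ∀ s, S s * proj𝒬 u x = proj𝒬 u (γ s) * S s := by
    intro s
    have := hT₁ s ⟨⟩
    simp only [γ.source] at this
    exact this
  have hSinj : ∀ s, Injective (S s) := fun s =>
    (ContinuousLinearMap.isUnit_iff_bijective.mp (hSu s)).1
  have hSmem : ∀ s (w : sphere (0 : E) 1), S s (w : E) ∈ (u (γ s)).toSubmodule := by
    intro s w
    rw [← proj𝒬_eq_self_iff]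
    have := congrArg (fun f : Quadric m →L[ℝ] Quadric m => f (w : E)) (hSmul s)
    simp only [mul_apply_eq_comp] at this
    rw [← this, proj𝒬_eq_self_iff.mpr (w : E).2]
  have hSne : ∀ s (w : sphere (0 : E) 1), S s (w : E) ≠ 0 := by
    intro s w h
    have h1 : ((w : E) : Quadric m) = 0 := hSinj s (h.trans (map_zero _).symm)
    exact ne_zero_of_mem_unit_sphere w (Subtype.ext h1)
  set Ξ : I × sphere (0 : E) 1 → SphereBundle u := fun a =>
    SphereBundle.ofDir (γ a.1) (S a.1 (a.2 : E)) (hSmem a.1 a.2) (hSne a.1 a.2)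
  have hΞ : Continuous Ξ := by
    refine SphereBundle.continuous_ofDir (γ.continuous.comp continuous_fst) ?_ _ _
    exact (hSc.comp continuous_fst).clm_apply (by fun_prop)
  have hΞp : ∀ a, (Ξ a).proj = γ a.1 := fun a => rfl
  have hΞd : ∀ a, ‖S a.1 (a.2 : E)‖ • (Ξ a).dir = S a.1 (a.2 : E) := by
    intro a
    exact smul_inv_smul₀ (norm_ne_zero_iff.mpr (hSne a.1 a.2)) _
  -- The parameters are: the position on the path, the fraction of the time `R`, and the ray. At
  -- fraction `0` the base point does not depend on the ray, so the projection descends to the ball.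
  set Ψ : I × I × sphere (0 : E) 1 → SphereBundle u := fun a => Φ (a.2.1 * R) (Ξ (a.1, a.2.2))
  have hΨ : Continuous Ψ := Φ.continuous (by fun_prop) (hΞ.comp (by fun_prop))
  have hΨ0 : ∀ s w, Ψ (s, 0, w) = Ξ (s, w) := by
    intro s w
    change Φ ((0 : ℝ) * R) _ = _
    rw [zero_mul, Flow.map_zero_apply]
  have hΨp : Continuous fun a => (Ψ a).proj := SphereBundle.continuous_proj.comp hΨ
  obtain ⟨F, hF, hFp⟩ := exists_continuous_polar hΨp (fun s w w' => by
    simp only [hΨ0, hΞp])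
  obtain ⟨T₂, hT₂c, hT₂0, hT₂u, hT₂⟩ := exists_transport
    (W := fun a : I × (I × sphere (0 : E) 1) => (u (Ψ (a.2.1, a.1, a.2.2)).proj).toSubmodule)
    (hproj.comp (hΨp.comp (by fun_prop)))
  set A : I × I × sphere (0 : E) 1 → Quadric m →L[ℝ] Quadric m := fun a =>
    T₂ (a.2.1, (a.1, a.2.2)) * S a.1
  have hAc : Continuous A := (hT₂c.comp (by fun_prop)).mul (hSc.comp continuous_fst)
  have hAu : ∀ a, IsUnit (A a) := fun a => (hT₂u _).mul (hSu _)
  have hA0 : ∀ s w, A (s, 0, w) = S s := by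
    intro s w
    change T₂ (0, (s, w)) * S s = S s
    rw [hT₂0, one_mul]
  have hAmul : ∀ a, A a * proj𝒬 u x = proj𝒬 u (Ψ a).proj * A a := by
    rintro ⟨s, t, w⟩
    have h1 := hT₂ t (s, w)
    simp only [hΨ0, hΞp] at h1
    change T₂ (t, (s, w)) * S s * _ = _ * (T₂ (t, (s, w)) * S s)
    rw [mul_assoc, hSmul, ← mul_assoc, ← mul_assoc]
    exact congrArg (· * S s) h1
  have hinv : ∀ a, proj𝒬 u x * Ring.inverse (A a) = Ring.inverse (A a) * proj𝒬 u (Ψ a).proj := by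
    intro a
    have h1 := Ring.inverse_mul_cancel _ (hAu a)
    have h2 := Ring.mul_inverse_cancel _ (hAu a)
    calc proj𝒬 u x * Ring.inverse (A a)
        = Ring.inverse (A a) * (A a * proj𝒬 u x) * Ring.inverse (A a) := by
          rw [← mul_assoc, h1, one_mul]
      _ = Ring.inverse (A a) * proj𝒬 u (Ψ a).proj * (A a * Ring.inverse (A a)) := by
          rw [hAmul]; simp only [mul_assoc]
      _ = _ := by rw [h2, mul_one]
  have hinvmem : ∀ a, ∀ q ∈ (u (Ψ a).proj).toSubmodule, Ring.inverse (A a) q ∈ E := by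
    intro a q hq
    rw [hE, ← proj𝒬_eq_self_iff]
    have := congrArg (fun f : Quadric m →L[ℝ] Quadric m => f q) (hinv a)
    simp only [mul_apply_eq_comp] at this
    rw [this, proj𝒬_eq_self_iff.mpr hq]
  have hAinv : ∀ a q, A a (Ring.inverse (A a) q) = q := fun a q =>
    congrArg (fun f : Quadric m →L[ℝ] Quadric m => f q) (Ring.mul_inverse_cancel _ (hAu a))
  have hinvA : ∀ a q, Ring.inverse (A a) (A a q) = q := fun a q =>
    congrArg (fun f : Quadric m →L[ℝ] Quadric m => f q) (Ring.inverse_mul_cancel _ (hAu a))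
  -- the perturbed section
  set O : Set M := (range fun v => F (1, v))ᶜ
  have hO : O ∈ nhds x := by
    have hc : IsCompact (range fun v => F (1, v)) := isCompact_range (hF.comp (by fun_prop))
    refine hc.isClosed.isOpen_compl.mem_nhds ?_
    rintro ⟨v, hv⟩
    obtain ⟨t, w, rfl⟩ := exists_polar v
    have hv' : F (1, polar t w) = x := hv
    rw [hFp] at hv'
    exact hno (Ξ (1, w)) (t * R) (mul_nonneg t.2.1 hR.le) ((hΞp _).trans γ.target) hv'
  obtain ⟨V, hV, hxV, hVO, N, hN, hxN, hpert⟩ := exists_perturbation hd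
    (U := fun z => (u z).toSubmodule) hproj hEd e hx hO
  have hKN : IsCompact (range (fun v => F (0, v)) ∩ N) :=
    (isCompact_range (hF.comp (by fun_prop))).inter_right hN
  -- At `s = 0` the unperturbed section vanishes at most over `x`: for positive time the flowed
  -- quadric pairs positively with `p`.
  have hF0 : ∀ v, F (0, v) = x ∨ proj𝒬 u (F (0, v)) p ≠ 0 := by
    intro v
    obtain ⟨t, w, rfl⟩ := exists_polar v
    rw [hFp]
    have hΞx : (Ξ (0, w)).proj = x := (hΞp _).trans γ.source
    rcases eq_or_ne t 0 with rfl | ht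
    · left
      rw [hΨ0, hΞx]
    · right
      have ht' : 0 < (t : ℝ) * R := mul_pos (unitInterval.pos_iff_ne_zero.mpr ht) hR
      have h1 := hΦ.inner_pos (ξ := Ξ (0, w)) ht' hp.posSemidef hp0
        (hpx _ (by have := (Ξ (0, w)).dir_mem; rwa [hΞx] at this))
      intro h2
      rw [← inner_proj𝒬_right (u := u) (SphereBundle.dir_mem _)] at h1
      change 0 < inner ℝ (Ψ (0, t, w)).dir (proj𝒬 u (Ψ (0, t, w)).proj p) at h1
      rw [h2, inner_zero_right] at h1
      exact lt_irrefl _ h1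
  obtain ⟨ε₁, hε₁, hε₁N⟩ : ∃ ε > 0, ∀ z ∈ range (fun v => F (0, v)) ∩ N, ε ≤ ‖proj𝒬 u z p‖ := by
    refine hKN.exists_forall_le' ((hproj.clm_apply continuous_const).norm.continuousOn) ?_
    rintro z ⟨⟨v, rfl⟩, hzN⟩
    exact norm_pos_iff.mpr ((hF0 v).resolve_left fun h => hxN (h ▸ hzN))
  obtain ⟨ε₂, hε₂, hε₂R⟩ : ∃ ε > 0, ∀ a : I × sphere (0 : E) 1,
      a ∈ univ → ε ≤ inner ℝ (Ψ (a.1, 1, a.2)).dir p := by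
    have hc : Continuous fun a : I × sphere (0 : E) 1 => inner ℝ (Ψ (a.1, 1, a.2)).dir p :=
      (SphereBundle.continuous_dir.comp (hΨ.comp (by fun_prop))).inner continuous_const
    refine isCompact_univ.exists_forall_le' hc.continuousOn fun a _ => ?_
    have := hRp (Ξ a) (by rw [hΞp]; exact mem_range_self _)
    change 0 < inner ℝ (Φ ((1 : ℝ) * R) (Ξ a)).dir p
    rwa [one_mul]
  obtain ⟨f, hf, hfp, hfN, hfV⟩ := hpert p (min ε₁ ε₂) (lt_min hε₁ hε₂)
  set sec : M → Quadric m := fun z => proj𝒬 u z (f z)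
  have hs : Continuous sec := hproj.clm_apply hf
  have hsmem : ∀ z, sec z ∈ (u z).toSubmodule := fun z => Submodule.starProjection_apply_mem _ _
  -- The adjoint of `A` pulls the section back to the fixed space `E`, so pairing `g` with `q` is
  -- pairing the section with `A q`. At fraction `0`, `A` does not involve `w`, so `g` is well
  -- defined at the center of the ball.
  obtain ⟨g, hg, hgp⟩ := exists_continuous_polar (E := E)
    (h := fun a => E.orthogonalProjectionOnto
      (ContinuousLinearMap.adjoint (A a) (sec (Ψ a).proj)))
    (E.orthogonalProjectionOnto.continuous.comp
      ((((ContinuousLinearMap.adjoint (𝕜 := ℝ) (E := Quadric m)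
        (F := Quadric m)).continuous.comp hAc)).clm_apply (hs.comp hΨp)))
    (fun s w w' => by simp only [hA0, hΨ0, hΞp])
  have hinnerg : ∀ s t w (q : E), inner ℝ (g (s, polar t w)) q =
      inner ℝ (sec (Ψ (s, t, w)).proj) (A (s, t, w) q) := by
    intro s t w q
    rw [hgp, Submodule.inner_orthogonalProjectionOnto_eq_of_mem_right,
      ContinuousLinearMap.adjoint_inner_left]
  have hgzero : ∀ s v, g (s, v) = 0 → sec (F (s, v)) = 0 := by
    intro s v h
    obtain ⟨t, w, rfl⟩ := exists_polar v
    rw [hFp]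
    have h1 := hinnerg s t w ⟨Ring.inverse (A (s, t, w)) (sec (Ψ (s, t, w)).proj),
      hinvmem _ _ (hsmem _)⟩
    rw [h, inner_zero_left, hAinv] at h1
    exact inner_self_eq_zero.mp h1.symm
  -- The flow direction read in `E`. It never vanishes, is the radial field `w` at fraction `0`, and
  -- at fraction `1` pairs positively with `g`: the required homotopy.
  set c : I × I × sphere (0 : E) 1 → E := fun a =>
    E.orthogonalProjectionOnto (Ring.inverse (A a) (‖S a.1 (a.2.2 : E)‖ • (Ψ a).dir))
  have hcoe : ∀ a, (c a : Quadric m) = Ring.inverse (A a) (‖S a.1 (a.2.2 : E)‖ • (Ψ a).dir) := by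
    intro a
    exact Submodule.starProjection_eq_self_iff.mpr
      (hinvmem a _ (Submodule.smul_mem _ _ (SphereBundle.dir_mem _)))
  have hcc : Continuous c := by
    refine E.orthogonalProjectionOnto.continuous.comp (Continuous.clm_apply ?_ ?_)
    · exact continuous_ringInverse hAc hAu
    · exact (((hSc.comp continuous_fst).clm_apply (by fun_prop)).norm).smul
        (SphereBundle.continuous_dir.comp hΨ)
  have hAcoe : ∀ a, A a (c a) = ‖S a.1 (a.2.2 : E)‖ • (Ψ a).dir := fun a => by
    rw [hcoe, hAinv]
  have hSpos : ∀ s (w : sphere (0 : E) 1), 0 < ‖S s (w : E)‖ := fun s w =>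
    norm_pos_iff.mpr (hSne s w)
  have hc0 : ∀ s w, c (s, 0, w) = w := by
    intro s w
    apply Subtype.ext
    rw [hcoe, hΨ0, hΞd (s, w)]
    conv_lhs => rw [← hA0 s w]
    exact hinvA _ _
  have hcne : ∀ a, c a ≠ 0 := by
    intro a h
    have h1 := hAcoe a
    rw [h, Submodule.coe_zero, map_zero] at h1
    exact smul_ne_zero (hSpos _ _).ne' (SphereBundle.dir_ne_zero _) h1.symm
  have hpos : ∀ s w, 0 < inner ℝ (g (s, sphereToBall w)) (c (s, 1, w)) := by
    intro s w
    rw [← polar_one, hinnerg, hAcoe, real_inner_smul_right, real_inner_comm,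
      inner_proj𝒬_right (SphereBundle.dir_mem _)]
    refine mul_pos (hSpos _ _) ?_
    have h1 := hε₂R (s, w) (mem_univ _)
    have h2 : |inner ℝ (Ψ (s, 1, w)).dir (f (Ψ (s, 1, w)).proj - p)| < ε₂ := by
      refine (abs_real_inner_le_norm _ _).trans_lt ?_
      rw [SphereBundle.norm_dir, one_mul]
      exact (hfp _).trans_le (min_le_right _ _)
    rw [inner_sub_right, abs_lt] at h2
    linarith
  -- the graph function
  obtain ⟨τ, hτ0, hτ1, hτ01⟩ := exists_continuous_zero_one_of_isClosed
    (s := {a : I × closedBall (0 : E) 1 | g a = 0 ∧ F a ∈ Vᶜ})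
    (t := {a | g a = 0 ∧ F a ∈ closure V})
    ((isClosed_eq hg continuous_const).inter (hV.isClosed_compl.preimage hF))
    ((isClosed_eq hg continuous_const).inter (isClosed_closure.preimage hF))
    (by
      rw [Set.disjoint_left]
      rintro ⟨s, v⟩ ⟨h1, h2⟩ ⟨-, h3⟩
      refine hfV (F (s, v)) ?_ (hgzero s v h1)
      rw [hV.frontier_eq]
      exact ⟨h3, h2⟩)
  -- `τ` is `1` at zeros over `V` and `0` at the others, so a zero with `τ = s` is either over `V`
  -- at `s = 1`, where `F` avoids `V`, or off `V` at `s = 0`. In the latter case the unperturbed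
  -- section is nonzero there: within `N` it exceeds the perturbation, and outside `N` it is
  -- unperturbed.
  obtain ⟨⟨s, v⟩, hgz, hτs⟩ := exists_zero_on_graph hg hcc hc0 hcne hpos τ.continuous hτ01
  have hs0 := hgzero s v hgz
  by_cases hFV : F (s, v) ∈ V
  · have h1 : (1 : ℝ) = s := (hτ1 (show (s, v) ∈ _ from ⟨hgz, subset_closure hFV⟩)).symm.trans hτs
    have h2 : s = 1 := Subtype.ext h1.symm
    subst h2
    exact hVO hFV ⟨v, rfl⟩
  · have h1 : (0 : ℝ) = s := (hτ0 (show (s, v) ∈ _ from ⟨hgz, hFV⟩)).symm.trans hτs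
    have h2 : s = 0 := Subtype.ext h1.symm
    subst h2
    have h3 := (hF0 v).resolve_left fun h => hFV (h ▸ hxV)
    by_cases hzN : F (0, v) ∈ N
    · have h4 := hε₁N _ ⟨⟨v, rfl⟩, hzN⟩
      have h5 : proj𝒬 u (F (0, v)) (f (F (0, v)) - p) = -proj𝒬 u (F (0, v)) p := by
        rw [map_sub]
        change sec _ - _ = _
        rw [hs0, zero_sub]
      have h6 : ‖proj𝒬 u (F (0, v)) (f (F (0, v)) - p)‖ ≤ ‖f (F (0, v)) - p‖ :=
        Submodule.norm_starProjection_apply_le _ _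
      rw [h5, norm_neg] at h6
      exact absurd ((h4.trans h6).trans_lt (hfp _)) (not_lt.mpr (min_le_left _ _))
    · refine h3 ?_
      have h4 : sec (F (0, v)) = proj𝒬 u (F (0, v)) p := by simp only [sec, hfN _ hzN]
      rw [← h4, hs0]

end Surjectivity
end FittingFlow

namespace FittingFlow

/-! ### Global fitting and the embedding property -/

section Embedding

variable {M : Type*} [TopologicalSpace M] {d m : ℕ} {u : M → GrMix d m}
  {Φ : Flow ℝ (SphereBundle u)}

theorem dim_ne_zero (hd : 0 < d) (P : GrMix d m) : m ≠ 0 := by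
  rintro rfl
  have h : Module.finrank ℝ P.toSubmodule = d := P.1.2
  have : Subsingleton (Quadric 0) := ⟨fun q r => Subtype.ext (Subsingleton.elim _ _)⟩
  have h0 : Module.finrank ℝ P.toSubmodule = 0 := Module.finrank_zero_of_subsingleton
  omega

/-- A semi-positive tensor annihilated by `u(x)` and by `u(y)` would pair to zero with both ends of
a flow line from `x` to `y`, whereas fitting makes the second pairing positive. -/
theorem isGloballyFitting_of_flow (hcont : Continuous u) (hΦ : IsFittingFlow Φ)
    (hline : ∀ x y : M, ∃ (ξ : SphereBundle u) (t : ℝ), 0 ≤ t ∧ ξ.proj = x ∧ (Φ t ξ).proj = y) :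
    IsGloballyFitting u := by
  refine ⟨hcont, fun x y hxy => ?_⟩
  rw [Set.disjoint_left]
  rintro ℓ ⟨p, hp, hpx, hpos, rfl⟩ ⟨r, hr, hry, -, hpr⟩
  obtain ⟨ξ, t, ht, rfl, rfl⟩ := hline x y
  have ht' : 0 < t := by
    refine lt_of_le_of_ne ht fun h => hxy ?_
    rw [← h, Flow.map_zero_apply]
  obtain ⟨a, ha⟩ := (Projectivization.mk_eq_mk_iff' ℝ p r hp hr).mp hpr
  have h1 : inner ℝ ξ.dir p = 0 := hpx _ ξ.dir_mem
  have h2 : inner ℝ (Φ t ξ).dir r = 0 := hry _ (Φ t ξ).dir_mem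
  have h3 := hΦ.inner_pos ht' hpos hp h1
  rw [← ha, inner_smul_right, h2, mul_zero] at h3
  exact lt_irrefl _ h3

theorem injective_of_isGloballyFitting (hm : m ≠ 0) (h : IsGloballyFitting u) : Injective u := by
  intro x y hxy
  by_contra hne
  have h1 := h.2 x y hne
  rw [← hxy] at h1
  obtain ⟨p, hp, hpx⟩ := exists_posDef_annihilated u x
  have h2 : Projectivization.mk ℝ p (ne_zero_of_posDef hm hp) ∈ projSlice (u x) :=
    ⟨p, ne_zero_of_posDef hm hp, hpx, hp.posSemidef, rfl⟩
  exact Set.disjoint_left.mp h1 h2 h2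

/-- Points outside a neighborhood `O` of `x` are reached from `x` only after some time `t₀ > 0`,
hence by a quadric exceeding the initial one by `ε` times the Euclidean form, after scaling. Pair
this gap with `p - r'`, where `u(x)` annihilates the positive tensor `p` and `r'` is the projection
of `p` to `u(z)`. Both quadrics contribute almost nothing, so `r'` cannot be small; smallness of
`r'` thus defines a neighborhood of `u(x)` whose preimage lies in `O`. -/
theorem isInducing_of_flow (hm : m ≠ 0) (hcont : Continuous u) (hΦ : IsFittingFlow Φ)
    (hline : ∀ x y : M, ∃ (ξ : SphereBundle u) (t : ℝ), 0 ≤ t ∧ ξ.proj = x ∧ (Φ t ξ).proj = y) :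
    Topology.IsInducing u := by
  rw [Topology.isInducing_iff_nhds]
  intro x
  refine le_antisymm (Filter.map_le_iff_le_comap.mp hcont.continuousAt) fun O hO => ?_
  have hS : IsCompact {ξ : SphereBundle u | ξ.proj ∈ ({x} : Set M)} :=
    isCompact_proj_preimage hcont isCompact_singleton
  have hnear : ∀ᶠ t in nhds (0 : ℝ), ∀ ξ ∈ {ξ : SphereBundle u | ξ.proj ∈ ({x} : Set M)},
      (Φ t ξ).proj ∈ O := by
    refine hS.eventually_forall_of_forall_eventually fun ξ hξ => ?_
    have hc : Continuous fun z : ℝ × SphereBundle u => (Φ z.1 z.2).proj :=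
      SphereBundle.continuous_proj.comp (Φ.continuous continuous_fst continuous_snd)
    refine hc.continuousAt (x := (0, ξ)) ?_
    simp only [Flow.map_zero_apply]
    rwa [show ξ.proj = x from hξ]
  obtain ⟨r, hr, hball⟩ := Metric.eventually_nhds_iff.mp hnear
  set t₀ := r / 2
  have ht₀ : 0 < t₀ := half_pos hr
  obtain ⟨ε, hε, hunif⟩ := hΦ.exists_uniform hS ht₀
  obtain ⟨p, hp, hpx⟩ := exists_posDef_annihilated u x
  obtain ⟨κ, hκ, hκp⟩ := exists_le_quadForm hp
  set a : ℝ := inner ℝ (idQuadric m) p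
  have ha : 0 < a := by
    refine inner_pos_of_posDef (posDef_iff.mpr fun v hv => ?_) hp.posSemidef (ne_zero_of_posDef hm hp)
    rw [quadForm_idQuadric]
    exact dotProduct_self_pos' hv
  set b : ℝ := ‖idQuadric m‖
  have hb : 0 ≤ b := norm_nonneg _
  -- `η ≤ κ` keeps `p - r'` semi-positive; the other bound makes the errors, at most `‖r'‖ (1 + ε
  -- b)`, smaller than the main term `ε a`.
  set η : ℝ := min κ (ε * a / (1 + ε * b))
  have hη : 0 < η := lt_min hκ (by positivity)
  have hηa : η * (1 + ε * b) ≤ ε * a := by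
    rw [← le_div_iff₀ (by positivity)]
    exact min_le_right _ _
  refine ⟨{P : GrMix d m | ‖P.toSubmodule.starProjection p‖ < η}, ?_, ?_⟩
  · have hc : Continuous fun P : GrMix d m => ‖P.toSubmodule.starProjection p‖ :=
      ((continuous_starProjection_gr.comp continuous_subtype_val).clm_apply continuous_const).norm
    refine hc.continuousAt.eventually (gt_mem_nhds ?_)
    beta_reduce
    rw [(mem_annihilator_iff.mp hpx), norm_zero]
    exact hη
  · intro z hz
    by_contra hzO
    obtain ⟨ξ, t, ht, hξ, rfl⟩ := hline x z
    have htt : t₀ < t := by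
      by_contra! h
      refine hzO (hball ?_ ξ hξ)
      rw [Real.dist_eq, sub_zero, abs_of_nonneg ht]
      exact h.trans_lt (half_lt_self hr)
    set ζ := Φ t ξ
    have hζ : Φ (t - t₀) (Φ t₀ ξ) = ζ := by
      rw [← Flow.map_add, sub_add_cancel]
    obtain ⟨c, hc, hcv⟩ := hunif ξ hξ
    obtain ⟨c', hc', hpos⟩ := hΦ.exists_dir (sub_pos.mpr htt) (Φ t₀ ξ)
    rw [hζ] at hpos
    set r' := (u ζ.proj).toSubmodule.starProjection p
    have hr' : ‖r'‖ < η := hz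
    have hp' : ((p - r' : Sym m) : Matrix (Fin m) (Fin m) ℝ).PosSemidef := by
      have h1 : ∀ v, 0 ≤ quadForm (p - r') v := fun v => by
        have h2 := le_quadForm_of_norm_sub_le hκp (r := p - r') (η := κ)
          (by rw [sub_sub_cancel_left, norm_neg]; exact hr'.le.trans (min_le_left _ _)) v
        simpa using h2
      rw [Matrix.posSemidef_iff_dotProduct_mulVec]
      have hs : ((p - r' : Sym m) : Matrix (Fin m) (Fin m) ℝ)ᵀ = (p - r' : Sym m) := (p - r').2
      exact ⟨by rwa [Matrix.IsHermitian, Matrix.conjTranspose_eq_transpose_of_trivial], h1⟩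
    have h1 : 0 ≤ inner ℝ ((c * c') • ζ.dir - ξ.dir - ε • idQuadric m) (p - r') := by
      refine inner_nonneg_of_posSemidef (fun v => ?_) hp'
      have h2 := hcv v
      have h3 : 0 ≤ quadForm (c' • ζ.dir - (Φ t₀ ξ).dir) v := by
        rw [← inner_rankOne]
        have := hpos.posSemidef
        rw [Matrix.posSemidef_iff_dotProduct_mulVec] at this
        rw [inner_rankOne]
        exact this.2 v
      simp only [quadForm_sub, quadForm_smul, quadForm_idQuadric] at h2 h3 ⊢
      nlinarith [mul_nonneg hc.le h3]
    have h2 : inner ℝ ζ.dir (p - r') = 0 := by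
      rw [inner_sub_right]
      have := inner_proj𝒬_right (u := u) (p := p) ζ.dir_mem
      rw [sub_eq_zero, ← this]
      rfl
    have h3 : inner ℝ ξ.dir p = 0 := hpx _ (by have := ξ.dir_mem; rwa [show ξ.proj = x from hξ] at this)
    rw [inner_sub_left, inner_sub_left, real_inner_smul_left, h2, real_inner_smul_left,
      inner_sub_right, h3, inner_sub_right] at h1
    have h4 : inner ℝ ξ.dir r' ≤ ‖r'‖ := by
      have := real_inner_le_norm ξ.dir r'
      rwa [SphereBundle.norm_dir, one_mul] at this
    have h5 : inner ℝ (idQuadric m) r' ≤ b * ‖r'‖ := real_inner_le_norm _ _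
    change 0 ≤ c * c' * 0 - (0 - inner ℝ ξ.dir r') - ε * (a - inner ℝ (idQuadric m) r') at h1
    nlinarith [mul_le_mul_of_nonneg_left h5 hε.le, mul_lt_mul_of_pos_right hr'
      (show (0 : ℝ) < 1 + ε * b by positivity)]

end Embedding

/-! ### Flow lines between arbitrary points -/

section FlowLines

variable {M N : Type*} [TopologicalSpace M] [TopologicalSpace N] {π : M → N} {d m : ℕ}
  {ρ : deckGroup π →* Matrix.SpecialLinearGroup (Fin m) ℝ} {u : M → GrMix d m}
  {Φ : Flow ℝ (SphereBundle u)}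

/-- Any two points are joined by a flow line of an equivariant fitting flow. -/
theorem exists_flow_line [T2Space N] [PathConnectedSpace M]
    [ChartedSpace (EuclideanSpace ℝ (Fin d)) N] (hπ : IsCoveringMap π) (hd : 0 < d)
    (hu : IsEquivariant ρ u) (hcont : Continuous u) (hΦ : IsFittingFlow Φ)
    (hΦρ : IsEquivariantFlow hu Φ) {K : Set M} (hK : IsCompact K)
    (hKM : ∀ x, ∃ γ : deckGroup π, ∃ y ∈ K, γ.1 y = x) (x y : M) :
    ∃ (ξ : SphereBundle u) (t : ℝ), 0 ≤ t ∧ ξ.proj = x ∧ (Φ t ξ).proj = y := by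
  have := t2Space_of_isCoveringMap hπ
  let _ := liftedCharts (EuclideanSpace ℝ (Fin d)) hπ
  obtain ⟨p, hp, hpy⟩ := exists_posDef_annihilated u y
  let γ := PathConnectedSpace.somePath y x
  obtain ⟨k, hk, hkp⟩ := exists_inner_pos hu hΦ hΦρ hcont hK hKM
    (isCompact_proj_preimage hcont (isCompact_range γ.continuous)) hp
  exact exists_flow_proj_eq hd (dim_ne_zero hd (u x)) hcont hΦ (chartAt _ y) (mem_chart_source _ y)
    γ hp hpy (Nat.cast_pos.mpr hk) hkp

end FlowLines
end FittingFlow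

theorem exists_linear_bound_of_mul_pow_le {a b : ℝ} (ha : 0 < a) (hb : 1 < b) :
    ∃ C D : ℝ, 0 < C ∧ 0 < D ∧ ∀ (k : ℕ) (L : ℝ), a * b ^ k ≤ Real.exp L → (k : ℝ) ≤ C * L + D := by
  have hlog := Real.log_pos hb
  refine ⟨(Real.log b)⁻¹, (Real.log b)⁻¹ * (|Real.log a| + 1), by positivity, by positivity,
    fun k L h => ?_⟩
  have h1 := Real.log_le_log (by positivity) h
  rw [Real.log_exp, Real.log_mul ha.ne' (by positivity), Real.log_pow] at h1
  have h2 : k * Real.log b ≤ L + (|Real.log a| + 1) := by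
    have := neg_abs_le (Real.log a)
    linarith
  rw [← mul_add, ← div_eq_inv_mul, le_div_iff₀ hlog]
  exact h2

namespace FittingFlow

/-! ### Distortion of the holonomy in terms of a length distance -/

section LengthDist

variable {M N : Type*} [TopologicalSpace M] {π : M → N} {δ : M → M → ℝ}

theorem IsInvariantLengthDist.nonneg (hδ : IsInvariantLengthDist π δ) (x y : M) : 0 ≤ δ x y := by
  have h1 := hδ.triangle x y x
  rw [(hδ.eq_zero_iff x x).mpr rfl, hδ.symm y x] at h1
  linarith

/-- The pseudometric of an invariant length distance. -/
@[reducible] def IsInvariantLengthDist.pseudoMetricSpace (hδ : IsInvariantLengthDist π δ) :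
    PseudoMetricSpace M :=
  PseudoMetricSpace.ofDistTopology δ (fun x => (hδ.eq_zero_iff x x).mpr rfl) hδ.symm hδ.triangle
    hδ.isOpen_iff

theorem IsInvariantLengthDist.continuous (hδ : IsInvariantLengthDist π δ) :
    Continuous fun a : M × M => δ a.1 a.2 := by
  let _ := hδ.pseudoMetricSpace
  exact continuous_dist

/-- On a path of length at most `δ x y + r / 4`, the intermediate value theorem gives a point at
distance `3 r / 4` from `x`; what remains is at most `δ x y - r / 2`. -/
theorem IsInvariantLengthDist.exists_step (hδ : IsInvariantLengthDist π δ) {r : ℝ} (hr : 0 < r)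
    {x y : M} (h : r < δ x y) : ∃ z, δ x z ≤ r ∧ δ z y ≤ δ x y - r / 2 := by
  obtain ⟨c, hc⟩ := hδ.length x y (r / 4) (by positivity)
  have hcont : Continuous fun t => δ x (c t) :=
    hδ.continuous.comp (continuous_const.prodMk c.continuous)
  have hxx : δ x x = 0 := (hδ.eq_zero_iff x x).mpr rfl
  have hmem : 3 / 4 * r ∈ Icc (δ x (c 0)) (δ x (c 1)) := by
    rw [c.source, c.target, hxx]
    constructor <;> linarith
  obtain ⟨s, -, hs⟩ := intermediate_value_Icc (zero_le_one : (0 : unitInterval) ≤ 1)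
    hcont.continuousOn hmem
  have hs' : δ x (c s) = 3 / 4 * r := hs
  refine ⟨c s, by rw [hs']; linarith, ?_⟩
  have h2 := hc 2 ![0, s, 1] (by
    rw [Fin.monotone_iff_le_succ]
    intro i
    fin_cases i
    · exact s.2.1
    · exact s.2.2)
  rw [Fin.sum_univ_two] at h2
  change δ (c 0) (c s) + δ (c s) (c 1) ≤ _ at h2
  rw [c.source, c.target, hs'] at h2
  linarith

/-- For points at distance at most `r`, the element `γ⁻¹ * γ'` stays in a finite set, by proper
discontinuity and a compact thickening of `K`. Longer distances are cut into hops, each gaining at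
least `r / 2`, and distortion is submultiplicative. -/
theorem IsInvariantLengthDist.exists_distortionLE [TopologicalSpace N] [T2Space N]
    [SimplyConnectedSpace M] [LocallyPathConnectedSpace M] [LocallyCompactSpace M] {m : ℕ}
    (hδ : IsInvariantLengthDist π δ) (hπ : IsCoveringMap π)
    (ρ : deckGroup π →* Matrix.SpecialLinearGroup (Fin m) ℝ) {K : Set M} (hK : IsCompact K)
    (hKM : ∀ x, ∃ γ : deckGroup π, ∃ y ∈ K, γ.1 y = x) :
    ∃ C D : ℝ, 0 < C ∧ 0 < D ∧ ∀ (x y : M) (γ γ' : deckGroup π), (γ⁻¹).1 x ∈ K → (γ'⁻¹).1 y ∈ K →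
      DistortionLE (Real.exp (C * δ x y + D)) (ρ (γ⁻¹ * γ')) := by
  obtain ⟨r, hr, hrK⟩ : ∃ r > 0, ∃ K' : Set M, IsCompact K' ∧ ∀ x ∈ K, ∀ y, δ x y ≤ r → y ∈ K' := by
    let _ := hδ.pseudoMetricSpace
    obtain ⟨r, hr, hcpt⟩ := hK.exists_isCompact_cthickening
    refine ⟨r, hr, _, hcpt, fun x hx y hxy => mem_cthickening_of_dist_le y x r K hx ?_⟩
    rw [dist_comm]
    exact hxy
  obtain ⟨K', hK', hKK'⟩ := hrK
  obtain ⟨B, hB, hBfin⟩ := exists_distortionLE_of_finite ρ (finite_deck_inter hπ (hK.prod hK'))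
  have hshort : ∀ (x y : M) (γ γ' : deckGroup π), (γ⁻¹).1 x ∈ K → (γ'⁻¹).1 y ∈ K → δ x y ≤ r →
      DistortionLE B (ρ (γ⁻¹ * γ')) := by
    intro x y γ γ' hx hy hxy
    refine hBfin _ ⟨((γ'⁻¹).1 y, (γ⁻¹).1 y), ⟨hy, hKK' _ hx _ ?_⟩, ?_⟩
    · exact (hδ.invariant _ (γ⁻¹).2 x y).trans_le hxy
    · change ((γ⁻¹ * γ').1 * (γ'⁻¹).1) y = (γ⁻¹).1 y
      rw [← Subgroup.coe_mul, mul_assoc, mul_inv_cancel, mul_one]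
  have hB0 : 0 ≤ B := zero_le_one.trans hB
  have hchain : ∀ (n : ℕ) (x y : M) (γ γ' : deckGroup π), (γ⁻¹).1 x ∈ K → (γ'⁻¹).1 y ∈ K →
      δ x y ≤ n * (r / 2) → DistortionLE (B ^ (n + 1)) (ρ (γ⁻¹ * γ')) := by
    intro n
    induction n with
    | zero =>
      intro x y γ γ' hx hy hxy
      rw [zero_add, pow_one]
      refine hshort x y γ γ' hx hy (hxy.trans ?_)
      rw [Nat.cast_zero, zero_mul]
      exact hr.le
    | succ n ih =>
      intro x y γ γ' hx hy hxy
      rcases le_or_gt (δ x y) r with h | h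
      · exact (hshort x y γ γ' hx hy h).mono (le_self_pow₀ hB (Nat.succ_ne_zero _))
      · obtain ⟨z, hxz, hzy⟩ := hδ.exists_step hr h
        obtain ⟨η, w, hw, hηw⟩ := hKM z
        have hz := inv_mem_of_eq hw hηw
        have h1 := hshort x z γ η hx hz hxz
        have h2 := ih z y η γ' hz hy (by push_cast at hxy; linarith)
        have h3 := h1.mul hB0 (pow_nonneg hB0 _) h2
        rw [← map_mul, ← pow_succ'] at h3
        rwa [show γ⁻¹ * η * (η⁻¹ * γ') = γ⁻¹ * γ' by group] at h3
  refine ⟨(Real.log B + 1) * (2 / r), (Real.log B + 1) * 2, ?_, ?_, fun x y γ γ' hx hy => ?_⟩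
  · have := Real.log_nonneg hB
    positivity
  · have := Real.log_nonneg hB
    positivity
  · set n := ⌈δ x y / (r / 2)⌉₊
    have hnn := hδ.nonneg x y
    have hn : δ x y ≤ n * (r / 2) := by
      rw [← div_le_iff₀ (by positivity)]
      exact Nat.le_ceil _
    have hn' : (n : ℝ) ≤ δ x y / (r / 2) + 1 := (Nat.ceil_lt_add_one (by positivity)).le
    refine (hchain n x y γ γ' hx hy hn).mono ?_
    rw [← Real.exp_log (show 0 < B by linarith), ← Real.exp_nat_mul, Real.exp_le_exp, Real.log_exp]
    have h0 := Real.log_nonneg hB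
    calc ((n + 1 : ℕ) : ℝ) * Real.log B ≤ (δ x y / (r / 2) + 2) * Real.log B := by
          push_cast
          exact mul_le_mul_of_nonneg_right (by linarith) h0
      _ ≤ (δ x y / (r / 2) + 2) * (Real.log B + 1) := by
          gcongr
          linarith
      _ = _ := by field_simp

end LengthDist

/-! ### Flow lines are quasi-geodesics -/

section QuasiGeodesic

variable {M N : Type*} [TopologicalSpace M] {π : M → N} {δ : M → M → ℝ} {d m : ℕ}
  {ρ : deckGroup π →* Matrix.SpecialLinearGroup (Fin m) ℝ} {u : M → GrMix d m}
  {Φ : Flow ℝ (SphereBundle u)}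

theorem exists_dist_flow_le (hδ : IsInvariantLengthDist π δ) (hu : IsEquivariant ρ u)
    (hcont : Continuous u) (hΦρ : IsEquivariantFlow hu Φ) {K : Set M} (hK : IsCompact K)
    (hKM : ∀ x, ∃ γ : deckGroup π, ∃ y ∈ K, γ.1 y = x) :
    ∃ A : ℝ, 0 < A ∧ ∀ (t : ℝ), 0 ≤ t → ∀ (ξ : SphereBundle u),
      δ ξ.proj (Φ t ξ).proj ≤ A * t + A := by
  have hS := isCompact_proj_preimage hcont hK
  have hc : Continuous fun a : ℝ × SphereBundle u => δ a.2.proj (Φ a.1 a.2).proj :=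
    hδ.continuous.comp ((SphereBundle.continuous_proj.comp continuous_snd).prodMk
      (SphereBundle.continuous_proj.comp (Φ.continuous continuous_fst continuous_snd)))
  obtain ⟨A, hA⟩ := ((isCompact_Icc (a := (0 : ℝ)) (b := 1)).prod hS).bddAbove_image hc.continuousOn
  have hunit : ∀ t ∈ Icc (0 : ℝ) 1, ∀ ξ : SphereBundle u, δ ξ.proj (Φ t ξ).proj ≤ max A 1 := by
    intro t ht ξ
    obtain ⟨γ, y, hy, hγ⟩ := hKM ξ.proj
    set ζ := SphereBundle.act hu γ⁻¹ ξ
    have hζ : SphereBundle.act hu γ ζ = ξ := SphereBundle.act_act_inv hu γ ξ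
    have hζK : ζ.proj ∈ K := by
      rw [SphereBundle.proj_act]
      exact inv_mem_of_eq hy hγ
    rw [← hζ, hΦρ, SphereBundle.proj_act hu γ ζ, SphereBundle.proj_act hu γ (Φ t ζ),
      hδ.invariant _ γ.2]
    exact (hA ⟨(t, ζ), ⟨ht, hζK⟩, rfl⟩).trans (le_max_left _ _)
  have hnat : ∀ (n : ℕ) (ξ : SphereBundle u), δ ξ.proj (Φ n ξ).proj ≤ max A 1 * n := by
    intro n
    induction n with
    | zero =>
      intro ξ
      rw [Nat.cast_zero, Flow.map_zero_apply, (hδ.eq_zero_iff _ _).mpr rfl, mul_zero]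
    | succ n ih =>
      intro ξ
      have h1 := hunit 1 ⟨zero_le_one, le_rfl⟩ (Φ n ξ)
      rw [← Flow.map_add, add_comm] at h1
      have h2 := hδ.triangle ξ.proj (Φ n ξ).proj (Φ ((n : ℝ) + 1) ξ).proj
      push_cast
      linarith [ih ξ]
  refine ⟨max A 1, lt_max_of_lt_right one_pos, fun t ht ξ => ?_⟩
  have h1 := hunit (t - ⌊t⌋₊) ⟨by linarith [Nat.floor_le ht], by linarith [Nat.lt_floor_add_one t]⟩
    (Φ ⌊t⌋₊ ξ)
  rw [← Flow.map_add, sub_add_cancel] at h1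
  have h2 := hδ.triangle ξ.proj (Φ ⌊t⌋₊ ξ).proj (Φ t ξ).proj
  have h3 : max A 1 * ⌊t⌋₊ ≤ max A 1 * t :=
    mul_le_mul_of_nonneg_left (Nat.floor_le ht) (zero_le_one.trans (le_max_right _ _))
  linarith [hnat ⌊t⌋₊ ξ]

/-- The upper bound is compactness and equivariance. For the lower bound, flowing for time `k`
forces distortion at least `a * b ^ k`, while a displacement `δ` allows at most `exp (C δ + D)`;
logarithms compare `k` with `δ`. -/
theorem isQuasiGeodesic_flow [TopologicalSpace N] [T2Space N]
    [SimplyConnectedSpace M] [LocallyPathConnectedSpace M] [LocallyCompactSpace M]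
    (hδ : IsInvariantLengthDist π δ) (hπ : IsCoveringMap π) (hu : IsEquivariant ρ u)
    (hcont : Continuous u) (hΦ : IsFittingFlow Φ) (hΦρ : IsEquivariantFlow hu Φ)
    {K : Set M} (hK : IsCompact K) (hKM : ∀ x, ∃ γ : deckGroup π, ∃ y ∈ K, γ.1 y = x) :
    ∃ C D : ℝ, 0 < C ∧ 0 < D ∧ ∀ ξ : SphereBundle u,
      IsQuasiGeodesic δ C D (fun t => (Φ t ξ).proj) := by
  obtain ⟨A, hA, hup⟩ := exists_dist_flow_le hδ hu hcont hΦρ hK hKM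
  obtain ⟨a, b, ha, hb, hexp⟩ := exists_expansion hu hΦ hΦρ hcont hK hKM
  obtain ⟨C₁, D₁, hC₁, hD₁, hlog⟩ := exists_linear_bound_of_mul_pow_le ha hb
  obtain ⟨C₂, D₂, hC₂, hD₂, hdist⟩ := hδ.exists_distortionLE hπ ρ hK hKM
  have hnat : ∀ (k : ℕ) (ξ : SphereBundle u),
      (k : ℝ) ≤ C₁ * (C₂ * δ ξ.proj (Φ k ξ).proj + D₂) + D₁ := by
    intro k ξ
    obtain ⟨γ, y, hy, hγ⟩ := hKM ξ.proj
    obtain ⟨γ', y', hy', hγ'⟩ := hKM (Φ k ξ).proj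
    have h1 := inv_mem_of_eq hy hγ
    have h2 := inv_mem_of_eq hy' hγ'
    exact hlog _ _ (hexp k ξ γ γ' h1 h2 _ (Real.exp_nonneg _) (hdist _ _ _ _ h1 h2))
  set C := max A (C₁ * C₂)
  have hC : 0 < C := lt_max_of_lt_left hA
  set D := A + A + (C₁ * C₂)⁻¹ * (1 + C₁ * D₂ + D₁)
  have hC12 : 0 < C₁ * C₂ := mul_pos hC₁ hC₂
  have hDA : A + A ≤ D := le_add_of_nonneg_right (by positivity)
  have hmain : ∀ (t : ℝ), 0 ≤ t → ∀ ξ : SphereBundle u,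
      C⁻¹ * t - D ≤ δ ξ.proj (Φ t ξ).proj ∧ δ ξ.proj (Φ t ξ).proj ≤ C * t + D := by
    intro t ht ξ
    constructor
    · have h1 := hnat ⌊t⌋₊ ξ
      have h2 := hup (t - ⌊t⌋₊) (by linarith [Nat.floor_le ht]) (Φ ⌊t⌋₊ ξ)
      rw [← Flow.map_add, sub_add_cancel] at h2
      have h3 : A * (t - ⌊t⌋₊) ≤ A * 1 :=
        mul_le_mul_of_nonneg_left (by linarith [Nat.lt_floor_add_one t]) hA.le
      have h4 := hδ.triangle ξ.proj (Φ t ξ).proj (Φ ⌊t⌋₊ ξ).proj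
      rw [hδ.symm (Φ t ξ).proj] at h4
      have h5 : t ≤ (C₁ * C₂) * δ ξ.proj (Φ ⌊t⌋₊ ξ).proj + (1 + C₁ * D₂ + D₁) := by
        have := Nat.lt_floor_add_one t
        linarith
      have h6 : (C₁ * C₂)⁻¹ * t ≤
          δ ξ.proj (Φ ⌊t⌋₊ ξ).proj + (C₁ * C₂)⁻¹ * (1 + C₁ * D₂ + D₁) := by
        rw [inv_mul_le_iff₀ hC12, mul_add, mul_inv_cancel_left₀ hC12.ne']
        exact h5
      have h7 : C⁻¹ * t ≤ (C₁ * C₂)⁻¹ * t :=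
        mul_le_mul_of_nonneg_right (inv_anti₀ hC12 (le_max_right _ _)) ht
      simp only [D]
      linarith
    · have h1 : A * t ≤ C * t := mul_le_mul_of_nonneg_right (le_max_left _ _) ht
      linarith [hup t ht ξ]
  refine ⟨C, D, hC, by positivity, fun ξ => ?_⟩
  have hle : ∀ s t : ℝ, s ≤ t → C⁻¹ * |s - t| - D ≤ δ (Φ s ξ).proj (Φ t ξ).proj ∧
      δ (Φ s ξ).proj (Φ t ξ).proj ≤ C * |s - t| + D := by
    intro s t hst
    have h := hmain (t - s) (sub_nonneg.mpr hst) (Φ s ξ)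
    rwa [← Flow.map_add, sub_add_cancel, ← abs_of_nonneg (sub_nonneg.mpr hst), abs_sub_comm] at h
  intro s t
  rcases le_total s t with h | h
  · exact hle s t h
  · have := hle t s h
    rwa [abs_sub_comm, hδ.symm] at this

end QuasiGeodesic
end FittingFlow

namespace FittingFlow

/-! ### Curve length in `SL(V)` controls distortion -/

section Curves

variable {m : ℕ} {g h k : Matrix.SpecialLinearGroup (Fin m) ℝ} {c : ℝ → Matrix (Fin m) (Fin m) ℝ}

/-- The entrywise derivative of a curve of matrices. -/
noncomputable def matDeriv (c : ℝ → Matrix (Fin m) (Fin m) ℝ) (t : ℝ) :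
    Matrix (Fin m) (Fin m) ℝ := Matrix.of fun k l => deriv (fun s => c s k l) t

/-- The Frobenius norm. -/
noncomputable def frob (X : Matrix (Fin m) (Fin m) ℝ) : ℝ := √(∑ i, ∑ j, X i j ^ 2)

theorem continuous_frob : Continuous (frob (m := m)) := by
  unfold frob
  fun_prop

theorem frob_nonneg (X : Matrix (Fin m) (Fin m) ℝ) : 0 ≤ frob X := Real.sqrt_nonneg _

theorem frob_smul {a : ℝ} (ha : 0 ≤ a) (X : Matrix (Fin m) (Fin m) ℝ) :
    frob (a • X) = a * frob X := by
  simp only [frob, Matrix.smul_apply, smul_eq_mul, mul_pow, ← Finset.mul_sum]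
  rw [Real.sqrt_mul (sq_nonneg a), Real.sqrt_sq ha]

theorem abs_dotProduct_vecMul_le (X : Matrix (Fin m) (Fin m) ℝ) (y : Fin m → ℝ) :
    |y ⬝ᵥ (y ᵥ* X)| ≤ frob X * (y ⬝ᵥ y) := by
  have h1 : y ⬝ᵥ (y ᵥ* X) = ∑ a : Fin m × Fin m, X a.1 a.2 * (y a.1 * y a.2) := by
    rw [Fintype.sum_prod_type_right]
    simp only [dotProduct, Matrix.vecMul, Finset.mul_sum]
    exact Finset.sum_congr rfl fun i _ => Finset.sum_congr rfl fun j _ => by ring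
  have h2 : ∑ a : Fin m × Fin m, (y a.1 * y a.2) ^ 2 = (y ⬝ᵥ y) ^ 2 := by
    rw [Fintype.sum_prod_type, sq, dotProduct, Finset.sum_mul_sum]
    exact Finset.sum_congr rfl fun i _ => Finset.sum_congr rfl fun j _ => by ring
  have h3 := Finset.sum_mul_sq_le_sq_mul_sq Finset.univ
    (fun a : Fin m × Fin m => X a.1 a.2) fun a => y a.1 * y a.2
  rw [← h1, h2, Fintype.sum_prod_type] at h3
  have h0 : 0 ≤ ∑ i, ∑ j, X i j ^ 2 :=
    Finset.sum_nonneg fun i _ => Finset.sum_nonneg fun j _ => sq_nonneg _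
  refine abs_le_of_sq_le_sq ?_ (mul_nonneg (frob_nonneg _) (dotProduct_self_nonneg' y))
  rw [mul_pow, frob, Real.sq_sqrt h0]
  exact h3

/-- A matrix and its transpose have the same operator norm. This is needed because left-invariant
length controls row vectors, while `DistortionLE` speaks of columns. -/
theorem dotProduct_mulVec_le_of_vecMul {A : Matrix (Fin m) (Fin m) ℝ} {B : ℝ} (hB : 0 ≤ B)
    (h : ∀ w : Fin m → ℝ, (w ᵥ* A) ⬝ᵥ (w ᵥ* A) ≤ B * (w ⬝ᵥ w)) (v : Fin m → ℝ) :
    (A *ᵥ v) ⬝ᵥ (A *ᵥ v) ≤ B * (v ⬝ᵥ v) := by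
  set s := (A *ᵥ v) ⬝ᵥ (A *ᵥ v)
  have hv := dotProduct_self_nonneg' v
  have hs : 0 ≤ s := dotProduct_self_nonneg' _
  have h1 : s = ((A *ᵥ v) ᵥ* A) ⬝ᵥ v := Matrix.dotProduct_mulVec _ _ _
  have h2 : s ^ 2 ≤ (((A *ᵥ v) ᵥ* A) ⬝ᵥ ((A *ᵥ v) ᵥ* A)) * (v ⬝ᵥ v) := by
    have := Finset.sum_mul_sq_le_sq_mul_sq Finset.univ ((A *ᵥ v) ᵥ* A) v
    rw [h1]
    simpa only [dotProduct, ← sq] using this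
  have h3 : s * s ≤ s * (B * (v ⬝ᵥ v)) := by
    calc s * s = s ^ 2 := (sq s).symm
      _ ≤ (B * s) * (v ⬝ᵥ v) := h2.trans (mul_le_mul_of_nonneg_right (h _) hv)
      _ = _ := by ring
  rcases hs.eq_or_lt with h0 | h0
  · rw [← h0]
    positivity
  · exact le_of_mul_le_mul_left h3 h0

theorem IsCurveInSL.continuous (hc : IsCurveInSL g h c) : Continuous c :=
  continuous_pi fun i => continuous_pi fun j => (hc.1 i j).continuous

theorem IsCurveInSL.continuous_matDeriv (hc : IsCurveInSL g h c) : Continuous (matDeriv c) :=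
  continuous_pi fun i => continuous_pi fun j => (hc.1 i j).continuous_deriv_one

theorem IsCurveInSL.hasDerivAt (hc : IsCurveInSL g h c) (i j : Fin m) (t : ℝ) :
    HasDerivAt (fun s => c s i j) (matDeriv c t i j) t :=
  ((hc.1 i j).differentiable one_ne_zero t).hasDerivAt

theorem IsCurveInSL.continuous_speed (hc : IsCurveInSL g h c) :
    Continuous fun t => frob ((c t)⁻¹ * matDeriv c t) := by
  have h1 : ∀ t, (c t)⁻¹ = (c t).adjugate := fun t => by
    rw [Matrix.inv_def, hc.2.1 t, Ring.inverse_one, one_smul]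
  simp only [h1]
  exact continuous_frob.comp (hc.continuous.matrix_adjugate.matrix_mul hc.continuous_matDeriv)

theorem curveLength_eq (c : ℝ → Matrix (Fin m) (Fin m) ℝ) :
    curveLength c = ∫ t in (0 : ℝ)..1, frob ((c t)⁻¹ * matDeriv c t) := rfl

theorem curveLength_nonneg (c : ℝ → Matrix (Fin m) (Fin m) ℝ) : 0 ≤ curveLength c := by
  rw [curveLength_eq]
  exact intervalIntegral.integral_nonneg zero_le_one fun t _ => frob_nonneg _

/-- A Grönwall estimate: with `y = w c(t)` one has `y' = y (c⁻¹ c')`, so the logarithmic derivative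
of `y ⬝ᵥ y` is at most twice the speed in absolute value. The factors `exp (∓ 2 G)` turn this into
monotonicity, without division by `y ⬝ᵥ y`. -/
theorem IsCurveInSL.dotProduct_vecMul_le (hc : IsCurveInSL g h c) (w : Fin m → ℝ) :
    (w ᵥ* h.1) ⬝ᵥ (w ᵥ* h.1) ≤ Real.exp (2 * curveLength c) * ((w ᵥ* g.1) ⬝ᵥ (w ᵥ* g.1)) ∧
    (w ᵥ* g.1) ⬝ᵥ (w ᵥ* g.1) ≤ Real.exp (2 * curveLength c) * ((w ᵥ* h.1) ⬝ᵥ (w ᵥ* h.1)) := by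
  set s : ℝ → ℝ := fun t => frob ((c t)⁻¹ * matDeriv c t)
  have hs : Continuous s := hc.continuous_speed
  set y : ℝ → Fin m → ℝ := fun t => w ᵥ* c t
  set f : ℝ → ℝ := fun t => y t ⬝ᵥ y t
  set f' : ℝ → ℝ := fun t => 2 * (y t ⬝ᵥ (y t ᵥ* ((c t)⁻¹ * matDeriv c t)))
  have hy : ∀ t j, HasDerivAt (fun t => y t j) ((w ᵥ* matDeriv c t) j) t := fun t j =>
    HasDerivAt.fun_sum (u := Finset.univ) fun i _ => (hc.hasDerivAt i j t).const_mul (w i)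
  have hf : ∀ t, HasDerivAt f (f' t) t := by
    intro t
    have h1 : y t ᵥ* ((c t)⁻¹ * matDeriv c t) = w ᵥ* matDeriv c t := by
      rw [Matrix.vecMul_vecMul, Matrix.mul_nonsing_inv_cancel_left]
      rw [hc.2.1 t]
      exact isUnit_one
    have h2 : HasDerivAt f (∑ j, ((w ᵥ* matDeriv c t) j * y t j + y t j * (w ᵥ* matDeriv c t) j)) t :=
      HasDerivAt.fun_sum fun j _ => (hy t j).fun_mul (hy t j)
    convert h2 using 1
    simp only [f', h1, dotProduct, Finset.mul_sum]
    exact Finset.sum_congr rfl fun j _ => by ring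
  have hbound : ∀ t, |f' t| ≤ 2 * s t * f t := by
    intro t
    simp only [f', abs_mul, abs_two, mul_assoc]
    exact mul_le_mul_of_nonneg_left (abs_dotProduct_vecMul_le _ _) zero_le_two
  set G : ℝ → ℝ := fun t => ∫ x in (0 : ℝ)..t, s x
  have hG : ∀ t, HasDerivAt G (s t) t := fun t => (hs.integral_hasStrictDerivAt 0 t).hasDerivAt
  have hG0 : G 0 = 0 := intervalIntegral.integral_same
  have hG1 : G 1 = curveLength c := rfl
  have hf0 : f 0 = (w ᵥ* g.1) ⬝ᵥ (w ᵥ* g.1) := by simp only [f, y, hc.2.2.1]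
  have hf1 : f 1 = (w ᵥ* h.1) ⬝ᵥ (w ᵥ* h.1) := by simp only [f, y, hc.2.2.2]
  rw [← hf0, ← hf1, ← hG1]
  have hanti : Antitone fun t => f t * Real.exp (-(2 * G t)) := by
    refine antitone_of_hasDerivAt_nonpos
      (fun t => (hf t).fun_mul (((hG t).const_mul 2).fun_neg.exp)) fun t => ?_
    have := (abs_le.mp (hbound t)).2
    have h2 := Real.exp_pos (-(2 * G t))
    have h3 : f' t * Real.exp (-(2 * G t)) ≤ 2 * s t * f t * Real.exp (-(2 * G t)) :=
      mul_le_mul_of_nonneg_right this h2.le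
    simp only [Pi.zero_apply]
    linarith
  have hmono : Monotone fun t => f t * Real.exp (2 * G t) := by
    refine monotone_of_hasDerivAt_nonneg
      (fun t => (hf t).fun_mul (((hG t).const_mul 2).exp)) fun t => ?_
    have := (abs_le.mp (hbound t)).1
    have h2 := Real.exp_pos (2 * G t)
    have h3 : -(2 * s t * f t) * Real.exp (2 * G t) ≤ f' t * Real.exp (2 * G t) :=
      mul_le_mul_of_nonneg_right this h2.le
    simp only [Pi.zero_apply]
    linarith
  constructor
  · have h1 := hanti zero_le_one
    simp only [hG0, mul_zero, neg_zero, Real.exp_zero, mul_one, Real.exp_neg] at h1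
    rwa [← div_eq_mul_inv, div_le_iff₀ (Real.exp_pos _), mul_comm] at h1
  · have h1 := hmono zero_le_one
    simp only [hG0, mul_zero, Real.exp_zero, mul_one] at h1
    rwa [mul_comm] at h1

theorem IsCurveInSL.distortionLE (hc : IsCurveInSL g h c) :
    DistortionLE (Real.exp (2 * curveLength c)) (g⁻¹ * h) := by
  have hE := (Real.exp_pos (2 * curveLength c)).le
  have hmul : ∀ a b : Matrix.SpecialLinearGroup (Fin m) ℝ, (a * b).1 = a.1 * b.1 := fun _ _ => rfl
  have h1 : ∀ w : Fin m → ℝ, (w ᵥ* (g⁻¹ * h).1) ⬝ᵥ (w ᵥ* (g⁻¹ * h).1) ≤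
      Real.exp (2 * curveLength c) * (w ⬝ᵥ w) := by
    intro w
    have := (hc.dotProduct_vecMul_le (w ᵥ* (g⁻¹).1)).1
    rwa [Matrix.vecMul_vecMul, Matrix.vecMul_vecMul, ← hmul, ← hmul, inv_mul_cancel,
      Matrix.SpecialLinearGroup.coe_one, Matrix.vecMul_one] at this
  have h2 : ∀ w : Fin m → ℝ, (w ᵥ* ((g⁻¹ * h)⁻¹).1) ⬝ᵥ (w ᵥ* ((g⁻¹ * h)⁻¹).1) ≤
      Real.exp (2 * curveLength c) * (w ⬝ᵥ w) := by
    intro w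
    have := (hc.dotProduct_vecMul_le (w ᵥ* (h⁻¹).1)).2
    rwa [Matrix.vecMul_vecMul, Matrix.vecMul_vecMul, ← hmul, ← hmul, inv_mul_cancel,
      Matrix.SpecialLinearGroup.coe_one, Matrix.vecMul_one,
      show h⁻¹ * g = (g⁻¹ * h)⁻¹ by group] at this
  exact fun v => ⟨dotProduct_mulVec_le_of_vecMul hE h1 v, dotProduct_mulVec_le_of_vecMul hE h2 v⟩

theorem matDeriv_const_mul {A : Matrix (Fin m) (Fin m) ℝ}
    (hc : ∀ i j, Differentiable ℝ fun t => c t i j) (t : ℝ) :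
    matDeriv (fun t => A * c t) t = A * matDeriv c t := by
  ext i j
  have : HasDerivAt (fun s => (A * c s) i j) (∑ l, A i l * deriv (fun s => c s l j) t) t :=
    HasDerivAt.fun_sum (u := Finset.univ) fun l _ => ((hc l j t).hasDerivAt).const_mul (A i l)
  exact this.deriv

theorem IsCurveInSL.mul_left (hc : IsCurveInSL g h c) (k : Matrix.SpecialLinearGroup (Fin m) ℝ) :
    IsCurveInSL (k * g) (k * h) (fun t => k.1 * c t) ∧
      curveLength (fun t => k.1 * c t) = curveLength c := by
  refine ⟨⟨fun i j => ?_, fun t => ?_, ?_, ?_⟩, ?_⟩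
  · simp only [Matrix.mul_apply]
    exact ContDiff.sum fun l _ => contDiff_const.mul (hc.1 l j)
  · rw [Matrix.det_mul, hc.2.1, k.2, mul_one]
  · beta_reduce; rw [hc.2.2.1]; rfl
  · beta_reduce; rw [hc.2.2.2]; rfl
  · rw [curveLength_eq, curveLength_eq]
    congr 1
    ext t
    rw [matDeriv_const_mul fun i j => (hc.1 i j).differentiable one_ne_zero, Matrix.mul_inv_rev,
      Matrix.mul_assoc, Matrix.nonsing_inv_mul_cancel_left]
    rw [k.2]
    exact isUnit_one

end Curves
end FittingFlow

namespace FittingFlow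

/-! ### The left-invariant distance: concatenation and existence of curves -/

section SlDist

variable {m : ℕ} {g h k : Matrix.SpecialLinearGroup (Fin m) ℝ}
  {c c₁ c₂ : ℝ → Matrix (Fin m) (Fin m) ℝ}

theorem deriv_smoothTransition_of_nonpos {x : ℝ} (hx : x ≤ 0) :
    deriv Real.smoothTransition x = 0 := by
  refine IsLocalMin.deriv_eq_zero (Filter.Eventually.of_forall fun y => ?_)
  rw [Real.smoothTransition.zero_of_nonpos hx]
  exact Real.smoothTransition.nonneg y

theorem deriv_smoothTransition_of_one_le {x : ℝ} (hx : 1 ≤ x) :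
    deriv Real.smoothTransition x = 0 := by
  refine IsLocalMax.deriv_eq_zero (Filter.Eventually.of_forall fun y => ?_)
  rw [Real.smoothTransition.one_of_one_le hx]
  exact Real.smoothTransition.le_one y

/-- The product `c₁(α) c₂(β)` follows `c₁` and then `h c₂`. The reparametrizations have zero
derivative at the junction `t = 1 / 2`, so the curve is `C¹`; only one factor moves at a time, so
left invariance makes the lengths add. -/
theorem IsCurveInSL.concat (h₁ : IsCurveInSL g h c₁) (h₂ : IsCurveInSL 1 k c₂) :
    ∃ c, IsCurveInSL g (h * k) c ∧ curveLength c = curveLength c₁ + curveLength c₂ := by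
  set φ := Real.smoothTransition
  have hφ : ContDiff ℝ 1 φ := Real.smoothTransition.contDiff (n := 1)
  set α : ℝ → ℝ := fun t => φ (2 * t)
  set β : ℝ → ℝ := fun t => φ (2 * t - 1)
  have hα : ContDiff ℝ 1 α := hφ.comp (by fun_prop)
  have hβ : ContDiff ℝ 1 β := hφ.comp (by fun_prop)
  have hα' : ∀ t, HasDerivAt α (deriv φ (2 * t) * 2) t := fun t => by
    have h : HasDerivAt (fun t : ℝ => 2 * t) 2 t := by simpa using (hasDerivAt_id t).const_mul 2
    exact (hφ.differentiable one_ne_zero (2 * t)).hasDerivAt.comp t h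
  have hβ' : ∀ t, HasDerivAt β (deriv φ (2 * t - 1) * 2) t := fun t => by
    have h : HasDerivAt (fun t : ℝ => 2 * t - 1) 2 t := by
      simpa using ((hasDerivAt_id t).const_mul 2).sub_const 1
    exact (hφ.differentiable one_ne_zero (2 * t - 1)).hasDerivAt.comp t h
  have hφ' := hφ.continuous_deriv_one
  have hnn : ∀ x, 0 ≤ deriv φ x := fun x => Real.smoothTransition.monotone.deriv_nonneg
  set c : ℝ → Matrix (Fin m) (Fin m) ℝ := fun t => c₁ (α t) * c₂ (β t)
  have hc : IsCurveInSL g (h * k) c := by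
    refine ⟨fun i j => ?_, fun t => ?_, ?_, ?_⟩
    · simp only [c, Matrix.mul_apply]
      exact ContDiff.sum fun l _ => ((h₁.1 i l).comp hα).mul ((h₂.1 l j).comp hβ)
    · rw [Matrix.det_mul, h₁.2.1, h₂.2.1, mul_one]
    · simp only [c, α, β, φ]
      rw [mul_zero, Real.smoothTransition.zero, Real.smoothTransition.zero_of_nonpos (by norm_num),
        h₁.2.2.1, h₂.2.2.1, Matrix.SpecialLinearGroup.coe_one, mul_one]
    · simp only [c, α, β, φ]
      rw [Real.smoothTransition.one_of_one_le (by norm_num),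
        Real.smoothTransition.one_of_one_le (by norm_num), h₁.2.2.2, h₂.2.2.2]
      rfl
  have hderiv : ∀ t, matDeriv c t = (deriv φ (2 * t) * 2) • (matDeriv c₁ (α t) * c₂ (β t)) +
      (deriv φ (2 * t - 1) * 2) • (c₁ (α t) * matDeriv c₂ (β t)) := by
    intro t
    ext i j
    have : HasDerivAt (fun s => c s i j)
        (∑ l, ((matDeriv c₁ (α t) i l * (deriv φ (2 * t) * 2)) * c₂ (β t) l j +
          c₁ (α t) i l * (matDeriv c₂ (β t) l j * (deriv φ (2 * t - 1) * 2)))) t :=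
      HasDerivAt.fun_sum (u := Finset.univ) fun l _ =>
        ((h₁.hasDerivAt i l (α t)).comp t (hα' t)).fun_mul
          ((h₂.hasDerivAt l j (β t)).comp t (hβ' t))
    refine this.deriv.trans ?_
    simp only [Matrix.add_apply, Matrix.smul_apply, Matrix.mul_apply, smul_eq_mul, Finset.mul_sum,
      ← Finset.sum_add_distrib]
    exact Finset.sum_congr rfl fun l _ => by ring
  have hspeed : ∀ t, frob ((c t)⁻¹ * matDeriv c t) =
      frob ((c₁ (α t))⁻¹ * matDeriv c₁ (α t)) * (deriv φ (2 * t) * 2) +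
      frob ((c₂ (β t))⁻¹ * matDeriv c₂ (β t)) * (deriv φ (2 * t - 1) * 2) := by
    intro t
    rw [hderiv]
    rcases le_total (2 * t) 1 with ht | ht
    · have h3 : c₂ (β t) = 1 := by
        simp only [β, φ]
        rw [Real.smoothTransition.zero_of_nonpos (by linarith), h₂.2.2.1,
          Matrix.SpecialLinearGroup.coe_one]
      have h4 : deriv φ (2 * t - 1) = 0 := deriv_smoothTransition_of_nonpos (by linarith)
      simp only [c, h3, h4, zero_mul, zero_smul, add_zero, mul_zero, mul_one]
      rw [Matrix.mul_smul, frob_smul (mul_nonneg (hnn _) zero_le_two), mul_comm]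
    · have h4 : deriv φ (2 * t) = 0 := deriv_smoothTransition_of_one_le ht
      have h5 : IsUnit (c₁ (α t)).det := by
        rw [h₁.2.1]
        exact isUnit_one
      simp only [c, h4, zero_mul, zero_smul, zero_add, mul_zero]
      rw [Matrix.mul_smul, frob_smul (mul_nonneg (hnn _) zero_le_two), mul_comm, Matrix.mul_inv_rev,
        Matrix.mul_assoc, Matrix.nonsing_inv_mul_cancel_left _ _ h5]
  refine ⟨c, hc, ?_⟩
  have hαc : Continuous fun t => deriv φ (2 * t) * 2 := (hφ'.comp (by fun_prop)).mul_const 2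
  have hβc : Continuous fun t => deriv φ (2 * t - 1) * 2 := (hφ'.comp (by fun_prop)).mul_const 2
  have hi₁ := intervalIntegral.integral_comp_mul_deriv (a := 0) (b := 1) (fun t _ => hα' t)
    hαc.continuousOn h₁.continuous_speed
  have hi₂ := intervalIntegral.integral_comp_mul_deriv (a := 0) (b := 1) (fun t _ => hβ' t)
    hβc.continuousOn h₂.continuous_speed
  have e0 : α 0 = 0 := Real.smoothTransition.zero_of_nonpos (by norm_num)
  have e1 : α 1 = 1 := Real.smoothTransition.one_of_one_le (by norm_num)
  have e2 : β 0 = 0 := Real.smoothTransition.zero_of_nonpos (by norm_num)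
  have e3 : β 1 = 1 := Real.smoothTransition.one_of_one_le (by norm_num)
  rw [e0, e1, ← curveLength_eq] at hi₁
  rw [e2, e3, ← curveLength_eq] at hi₂
  rw [← hi₁, ← hi₂, curveLength_eq, ← intervalIntegral.integral_add]
  · exact intervalIntegral.integral_congr fun t _ => hspeed t
  · exact ((h₁.continuous_speed.comp hα.continuous).mul hαc).intervalIntegrable _ _
  · exact ((h₂.continuous_speed.comp hβ.continuous).mul hβc).intervalIntegrable _ _

-- Whitehead's identity. It reduces the existence of curves to transvections, which are joined to
-- `1` by scaling their entry, and spares a discussion of negative diagonal entries.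
open Matrix Matrix.SpecialLinearGroup in
theorem diag2n_eq_prod_transvection {i j : Fin m} (hij : i ≠ j) {a : ℝ} (ha : a ≠ 0) :
    diag2n hij a ha =
      transvection hij a * (transvection hij.symm (-a⁻¹) * (transvection hij a *
        (transvection hij (-1) * (transvection hij.symm 1 * transvection hij (-1))))) := by
  apply Subtype.ext
  change Matrix.diagonal _ = Matrix.transvection i j a * (Matrix.transvection j i (-a⁻¹) *
    (Matrix.transvection i j a * (Matrix.transvection i j (-1) *
      (Matrix.transvection j i 1 * Matrix.transvection i j (-1)))))
  simp only [Matrix.transvection, mul_add, add_mul, one_mul, mul_one,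
    Matrix.single_mul_single_same, Matrix.single_mul_single_of_ne _ _ _ _ hij,
    Matrix.single_mul_single_of_ne _ _ _ _ hij.symm, add_zero]
  ext r s
  simp only [Matrix.add_apply, Matrix.single_apply, Matrix.diagonal_apply, Matrix.one_apply]
  have hr : (i = r ↔ r = i) ∧ (j = r ↔ r = j) := ⟨eq_comm, eq_comm⟩
  have hs : (i = s ↔ s = i) ∧ (j = s ↔ s = j) := ⟨eq_comm, eq_comm⟩
  by_cases hri : r = i <;> by_cases hrj : r = j <;> by_cases hsi : s = i <;>
    by_cases hsj : s = j <;> by_cases hrs : r = s <;>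
    first
      | (exfalso; grind)
      | (simp only [hr, hs, hri, hrj, hsi, hsj, hrs, hij, hij.symm, if_true, if_false, and_true,
          and_false]
         field_simp
         ring)

theorem exists_isCurveInSL_mul (h₁ : ∃ c, IsCurveInSL 1 h c) (h₂ : ∃ c, IsCurveInSL 1 k c) :
    ∃ c, IsCurveInSL 1 (h * k) c := by
  obtain ⟨c₁, h₁⟩ := h₁
  obtain ⟨c₂, h₂⟩ := h₂
  obtain ⟨c, hc, -⟩ := h₁.concat h₂
  exact ⟨c, hc⟩

theorem exists_isCurveInSL_transvection {i j : Fin m} (hij : i ≠ j) (a : ℝ) :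
    ∃ c, IsCurveInSL 1 (Matrix.SpecialLinearGroup.transvection hij a) c := by
  refine ⟨fun t => Matrix.transvection i j (t * a), fun k l => ?_, fun t => ?_, ?_, ?_⟩
  · simp only [Matrix.transvection, Matrix.add_apply, Matrix.single_apply]
    split_ifs <;> fun_prop
  · exact Matrix.det_transvection_of_ne i j hij _
  · simp
  · beta_reduce
    rw [one_mul]
    rfl

theorem exists_isCurveInSL_one [Nontrivial (Fin m)] (g : Matrix.SpecialLinearGroup (Fin m) ℝ) :
    ∃ c, IsCurveInSL 1 g c := by
  refine Matrix.SpecialLinearGroup.diagonal_transvection_induction' (fun g => ∃ c, IsCurveInSL 1 g c)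
    g (fun i j hij a ha => ?_) (fun i j hij a => exists_isCurveInSL_transvection hij a)
    fun _ _ => exists_isCurveInSL_mul
  rw [diag2n_eq_prod_transvection hij ha]
  repeat' apply exists_isCurveInSL_mul
  all_goals exact exists_isCurveInSL_transvection _ _

theorem exists_isCurveInSL [Nontrivial (Fin m)] (g h : Matrix.SpecialLinearGroup (Fin m) ℝ) :
    ∃ c, IsCurveInSL g h c := by
  obtain ⟨c, hc⟩ := exists_isCurveInSL_one (g⁻¹ * h)
  have := (hc.mul_left g).1
  rw [mul_one, mul_inv_cancel_left] at this
  exact ⟨_, this⟩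

/-- Existence of a joining curve is essential: the infimum of the empty set is `0` by convention,
and the bound could fail for positive `L`. -/
theorem le_slDist [Nontrivial (Fin m)] {L : ℝ}
    (hL : ∀ c, IsCurveInSL g h c → L ≤ curveLength c) : L ≤ slDist g h := by
  obtain ⟨c, hc⟩ := exists_isCurveInSL g h
  refine le_csInf ⟨_, c, hc, rfl⟩ ?_
  rintro _ ⟨c, hc, rfl⟩
  exact hL c hc

theorem slDist_le_curveLength (hc : IsCurveInSL g h c) : slDist g h ≤ curveLength c := by
  refine csInf_le ⟨0, ?_⟩ ⟨c, hc, rfl⟩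
  rintro _ ⟨c, -, rfl⟩
  exact curveLength_nonneg c

theorem slDist_nonneg (g h : Matrix.SpecialLinearGroup (Fin m) ℝ) : 0 ≤ slDist g h := by
  refine Real.sInf_nonneg ?_
  rintro _ ⟨c, -, rfl⟩
  exact curveLength_nonneg c

theorem slDist_le_slDist_one [Nontrivial (Fin m)] (g h : Matrix.SpecialLinearGroup (Fin m) ℝ) :
    slDist g h ≤ slDist 1 (g⁻¹ * h) := by
  refine le_slDist fun c hc => ?_
  obtain ⟨h1, h2⟩ := hc.mul_left g
  rw [mul_one, mul_inv_cancel_left] at h1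
  exact h2 ▸ slDist_le_curveLength h1

theorem slDist_mul_le [Nontrivial (Fin m)] (h k : Matrix.SpecialLinearGroup (Fin m) ℝ) :
    slDist 1 (h * k) ≤ slDist 1 h + slDist 1 k := by
  rw [← sub_le_iff_le_add]
  refine le_slDist fun c₁ h₁ => ?_
  rw [sub_le_comm]
  refine le_slDist fun c₂ h₂ => ?_
  obtain ⟨c, hc, hl⟩ := h₁.concat h₂
  have := slDist_le_curveLength hc
  linarith

end SlDist
end FittingFlow

namespace FittingFlow

/-! ### Word length -/

section Words

variable {G : Type*} [Group G]

theorem exists_list_of_closure_eq_top {S : Finset G} (hS : Subgroup.closure (S : Set G) = ⊤)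
    (g : G) : ∃ l : List G, (∀ s ∈ l, s ∈ S ∨ s⁻¹ ∈ S) ∧ l.prod = g :=
  Submonoid.exists_list_of_mem_closure (s := (S : Set G) ∪ (S : Set G)⁻¹) <| by
    rw [← Subgroup.closure_toSubmonoid, hS]
    trivial

theorem exists_wordLength_le {S : Finset G} (hS : Subgroup.closure (S : Set G) = ⊤) {T : Set G}
    (hT : T.Finite) : ∃ W : ℕ, ∀ l : List G, (∀ s ∈ l, s ∈ T) →
    wordLength S l.prod ≤ W * l.length := by
  have hword : ∀ g : G, ∃ w : List G, (∀ s ∈ w, s ∈ S ∨ s⁻¹ ∈ S) ∧ w.prod = g := fun g =>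
    exists_list_of_closure_eq_top hS g
  choose w hw hwp using hword
  obtain ⟨W, hW⟩ := (hT.image fun g => (w g).length).bddAbove
  refine ⟨W, fun l hl => ?_⟩
  suffices h : ∃ w' : List G, w'.length ≤ W * l.length ∧ (∀ s ∈ w', s ∈ S ∨ s⁻¹ ∈ S) ∧
      w'.prod = l.prod by
    obtain ⟨w', h1, h2, h3⟩ := h
    refine le_trans (Nat.sInf_le ?_) h1
    exact ⟨w', rfl, h2, h3⟩
  induction l with
  | nil => exact ⟨[], by simp⟩
  | cons g l ih =>
    obtain ⟨w', h1, h2, h3⟩ := ih fun s hs => hl s (List.mem_cons_of_mem _ hs)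
    refine ⟨w g ++ w', ?_, fun s hs => ?_, ?_⟩
    · rw [List.length_append, List.length_cons, mul_add, mul_one, add_comm]
      exact add_le_add h1 (hW (mem_image_of_mem _ (hl g List.mem_cons_self)))
    · exact (List.mem_append.mp hs).elim (hw g s) (h2 s)
    · rw [List.prod_append, hwp, h3, List.prod_cons]

theorem exists_word {S : Finset G} (hS : Subgroup.closure (S : Set G) = ⊤) (g : G) :
    ∃ l : List G, l.length = wordLength S g ∧ (∀ s ∈ l, s ∈ S ∨ s⁻¹ ∈ S) ∧ l.prod = g := by
  obtain ⟨w, hw, hwp⟩ := exists_list_of_closure_eq_top hS g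
  exact Nat.sInf_mem (s := {k | ∃ l : List G, l.length = k ∧ (∀ s ∈ l, s ∈ S ∨ s⁻¹ ∈ S) ∧
    l.prod = g}) ⟨_, w, rfl, hw, hwp⟩

theorem exists_slDist_le_wordLength {m : ℕ} [Nontrivial (Fin m)] {S : Finset G}
    (hS : Subgroup.closure (S : Set G) = ⊤) (ρ : G →* Matrix.SpecialLinearGroup (Fin m) ℝ) :
    ∃ A D : ℝ, 0 ≤ A ∧ 0 ≤ D ∧ ∀ g, slDist 1 (ρ g) ≤ A * wordLength S g + D := by
  set A := ∑ s ∈ S, (slDist 1 (ρ s) + slDist 1 (ρ s⁻¹))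
  have hnn : ∀ s ∈ S, 0 ≤ slDist 1 (ρ s) + slDist 1 (ρ s⁻¹) := fun s _ =>
    add_nonneg (slDist_nonneg _ _) (slDist_nonneg _ _)
  have hA : ∀ s, s ∈ S ∨ s⁻¹ ∈ S → slDist 1 (ρ s) ≤ A := by
    rintro s (hs | hs)
    · exact (le_add_of_nonneg_right (slDist_nonneg _ _)).trans (Finset.single_le_sum hnn hs)
    · have := Finset.single_le_sum hnn hs
      rw [inv_inv] at this
      exact (le_add_of_nonneg_left (slDist_nonneg _ _)).trans this
  -- The additive constant `slDist 1 1` is what the empty word costs; its vanishing is not needed.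
  refine ⟨A, slDist (1 : Matrix.SpecialLinearGroup (Fin m) ℝ) 1, Finset.sum_nonneg hnn,
    slDist_nonneg _ _, fun g => ?_⟩
  obtain ⟨l, hl, hlS, rfl⟩ := exists_word hS g
  rw [← hl]
  clear hl
  induction l with
  | nil => simp
  | cons s l ih =>
    have h1 := ih fun t ht => hlS t (List.mem_cons_of_mem _ ht)
    have h2 := hA s (hlS s List.mem_cons_self)
    rw [List.prod_cons, map_mul, List.length_cons]
    push_cast
    linarith [slDist_mul_le (ρ s) (ρ l.prod)]

end Words

/-! ### The quasi-isometric embedding -/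

section QuasiIsometry

variable {M N : Type*} [TopologicalSpace M] {π : M → N} {d m : ℕ}
  {ρ : deckGroup π →* Matrix.SpecialLinearGroup (Fin m) ℝ} {u : M → GrMix d m}
  {Φ : Flow ℝ (SphereBundle u)} {K : Set M}

/-- After translation of the starting point to `K`, the endpoint lies in the compact set swept out
in unit time, and proper discontinuity leaves finitely many elements. -/
theorem exists_finite_flow_step [TopologicalSpace N] [T2Space N] [SimplyConnectedSpace M]
    [LocallyPathConnectedSpace M] (hπ : IsCoveringMap π) (hu : IsEquivariant ρ u)
    (hcont : Continuous u) (hΦρ : IsEquivariantFlow hu Φ) (hK : IsCompact K) :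
    ∃ S : Set (deckGroup π), S.Finite ∧ ∀ (t : ℝ), t ∈ Icc (0 : ℝ) 1 → ∀ (ξ : SphereBundle u)
      (γ γ' : deckGroup π), (γ⁻¹).1 ξ.proj ∈ K → (γ'⁻¹).1 (Φ t ξ).proj ∈ K → γ⁻¹ * γ' ∈ S := by
  have hK' : IsCompact ((fun a : ℝ × SphereBundle u => (Φ a.1 a.2).proj) ''
      (Icc 0 1 ×ˢ {ξ : SphereBundle u | ξ.proj ∈ K})) :=
    (isCompact_Icc.prod (isCompact_proj_preimage hcont hK)).image
      (SphereBundle.continuous_proj.comp (Φ.continuous continuous_fst continuous_snd))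
  refine ⟨_, finite_deck_inter hπ (hK.prod hK'), fun t ht ξ γ γ' h1 h2 => ?_⟩
  refine ⟨((γ'⁻¹).1 (Φ t ξ).proj, (γ⁻¹).1 (Φ t ξ).proj), ⟨h2, (t, SphereBundle.act hu γ⁻¹ ξ),
    ⟨ht, ?_⟩, ?_⟩, ?_⟩
  · change SphereBundle.proj _ ∈ K
    rwa [SphereBundle.proj_act]
  · beta_reduce
    rw [hΦρ, SphereBundle.proj_act]
  · change ((γ⁻¹ * γ').1 * (γ'⁻¹).1) (Φ t ξ).proj = (γ⁻¹).1 (Φ t ξ).proj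
    rw [← Subgroup.coe_mul, mul_assoc, mul_inv_cancel, mul_one]

theorem exists_flow_word {S : Set (deckGroup π)} (hKM : ∀ x, ∃ γ : deckGroup π, ∃ y ∈ K, γ.1 y = x)
    (hS : ∀ (t : ℝ), t ∈ Icc (0 : ℝ) 1 → ∀ (ξ : SphereBundle u)
      (γ γ' : deckGroup π), (γ⁻¹).1 ξ.proj ∈ K → (γ'⁻¹).1 (Φ t ξ).proj ∈ K → γ⁻¹ * γ' ∈ S)
    (k : ℕ) : ∀ (t : ℝ), t ∈ Icc (0 : ℝ) (k + 1) → ∀ (ξ : SphereBundle u)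
      (γ γ' : deckGroup π), (γ⁻¹).1 ξ.proj ∈ K → (γ'⁻¹).1 (Φ t ξ).proj ∈ K →
      ∃ l : List (deckGroup π), l.length ≤ k + 1 ∧ (∀ s ∈ l, s ∈ S) ∧ l.prod = γ⁻¹ * γ' := by
  have hone : ∀ k : ℕ, ∀ g ∈ S, ∃ l : List (deckGroup π), l.length ≤ k + 1 ∧ (∀ s ∈ l, s ∈ S) ∧
      l.prod = g := fun k g hg => ⟨[g], by simp, by simpa using hg, by simp⟩
  induction k with
  | zero =>
    intro t ht ξ γ γ' h1 h2
    exact hone 0 _ (hS t (by simpa using ht) ξ γ γ' h1 h2)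
  | succ k ih =>
    intro t ht ξ γ γ' h1 h2
    rcases le_or_gt t 1 with h | h
    · exact hone _ _ (hS t ⟨ht.1, h⟩ ξ γ γ' h1 h2)
    · obtain ⟨η, y, hy, hη⟩ := hKM (Φ 1 ξ).proj
      have h3 := inv_mem_of_eq hy hη
      obtain ⟨l, hl, hlS, hlp⟩ := ih (t - 1)
        ⟨by linarith, by have := ht.2; push_cast at this; linarith⟩ (Φ 1 ξ) η γ' h3
        (by rwa [← Flow.map_add, sub_add_cancel])
      refine ⟨(γ⁻¹ * η) :: l, ?_, ?_, ?_⟩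
      · rw [List.length_cons]
        omega
      · rintro s hs
        rcases List.mem_cons.mp hs with rfl | hs
        · exact hS 1 ⟨zero_le_one, le_rfl⟩ ξ γ η h1 h3
        · exact hlS s hs
      · rw [List.prod_cons, hlp]
        group

/-- A flow line from `x₀` to `γ x₀`, cut at unit times, writes `γ` as a word in a finite set `T` of
length at most one more than the integer part of the flow time; this gives finite generation and
bounds word length by time. Expansion bounds time by the logarithm of the distortion of `ρ γ`, which
is at most twice the length of any curve. The upper bound is the triangle inequality over a word. -/
theorem isQuasiIsometricEmbedding_of_flow [TopologicalSpace N] [T2Space N] [SimplyConnectedSpace M]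
    [LocallyPathConnectedSpace M] [Nontrivial (Fin m)] (hπ : IsCoveringMap π)
    (hu : IsEquivariant ρ u) (hcont : Continuous u) (hΦ : IsFittingFlow Φ)
    (hΦρ : IsEquivariantFlow hu Φ) (hK : IsCompact K)
    (hKM : ∀ x, ∃ γ : deckGroup π, ∃ y ∈ K, γ.1 y = x)
    (hline : ∀ x y : M, ∃ (ξ : SphereBundle u) (t : ℝ), 0 ≤ t ∧ ξ.proj = x ∧ (Φ t ξ).proj = y) :
    IsQuasiIsometricEmbedding ρ := by
  obtain ⟨x₁⟩ : Nonempty M := inferInstance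
  obtain ⟨-, x₀, hx₀, -⟩ := hKM x₁
  obtain ⟨T, hT, hstep⟩ := exists_finite_flow_step hπ hu hcont hΦρ hK
  have hpath : ∀ γ : deckGroup π, ∃ (ξ : SphereBundle u) (t : ℝ), 0 ≤ t ∧
      ((1 : deckGroup π)⁻¹).1 ξ.proj ∈ K ∧ (γ⁻¹).1 (Φ t ξ).proj ∈ K := by
    intro γ
    obtain ⟨ξ, t, ht, h1, h2⟩ := hline x₀ (γ.1 x₀)
    exact ⟨ξ, t, ht, inv_mem_of_eq hx₀ h1.symm, inv_mem_of_eq hx₀ h2.symm⟩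
  have hword := exists_flow_word hKM hstep
  have hmem : ∀ t : ℝ, 0 ≤ t → t ∈ Icc (0 : ℝ) (⌊t⌋₊ + 1) := fun t ht =>
    ⟨ht, (Nat.lt_floor_add_one t).le⟩
  constructor
  · rw [Group.fg_iff]
    refine ⟨T, eq_top_iff.mpr fun γ _ => ?_, hT⟩
    obtain ⟨ξ, t, ht, h1, h2⟩ := hpath γ
    obtain ⟨l, -, hlT, hl⟩ := hword ⌊t⌋₊ t (hmem t ht) ξ 1 γ h1 h2
    rw [inv_one, one_mul] at hl
    rw [← hl]
    exact Subgroup.list_prod_mem _ fun s hs => Subgroup.subset_closure (hlT s hs)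
  · intro S hS
    obtain ⟨W, hW⟩ := exists_wordLength_le hS hT
    obtain ⟨A, D, hA, hD, hup⟩ := exists_slDist_le_wordLength hS ρ
    obtain ⟨a, b, ha, hb, hexp⟩ := exists_expansion hu hΦ hΦρ hcont hK hKM
    obtain ⟨C₁, D₁, hC₁, hD₁, hlog⟩ := exists_linear_bound_of_mul_pow_le ha hb
    obtain ⟨B, hB, hBT⟩ := exists_distortionLE_of_finite (fun γ => ρ γ⁻¹) hT
    have hB0 : 0 < B := one_pos.trans_le hB
    have hlogB := Real.log_nonneg hB
    have hlow : ∀ γ η : deckGroup π, (wordLength S (γ⁻¹ * η) : ℝ) ≤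
        (W * C₁ * 2) * slDist (ρ γ) (ρ η) + W * (C₁ * Real.log B + D₁ + 1) := by
      intro γ η
      obtain ⟨ξ, t, ht, h1, h2⟩ := hpath (γ⁻¹ * η)
      obtain ⟨l, hlen, hlT, hl⟩ := hword ⌊t⌋₊ t (hmem t ht) ξ 1 (γ⁻¹ * η) h1 h2
      rw [inv_one, one_mul] at hl
      have h3 : (wordLength S (γ⁻¹ * η) : ℝ) ≤ W * (⌊t⌋₊ + 1) := by
        have := (hW l hlT).trans (Nat.mul_le_mul_left W hlen)
        rw [hl] at this
        exact_mod_cast this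
      -- Expansion is available at integer times only. The flow line is stopped at `⌊t⌋₊`, in the
      -- translate of `K` by `ζ`, and the remaining fraction of a step costs an element of `T`, of
      -- distortion at most `B`.
      obtain ⟨ζ, y, hy, hζ⟩ := hKM (Φ ⌊t⌋₊ ξ).proj
      have h4 := inv_mem_of_eq hy hζ
      have h5 : ζ⁻¹ * (γ⁻¹ * η) ∈ T := hstep (t - ⌊t⌋₊)
        ⟨by linarith [Nat.floor_le ht], by linarith [Nat.lt_floor_add_one t]⟩ (Φ ⌊t⌋₊ ξ) ζ _ h4
        (by rwa [← Flow.map_add, sub_add_cancel])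
      have h6 : ((⌊t⌋₊ : ℝ) - C₁ * Real.log B - D₁) / (C₁ * 2) ≤ slDist (ρ γ) (ρ η) := by
        refine le_slDist fun c hc => ?_
        have h7 := hc.distortionLE
        rw [← map_inv, ← map_mul] at h7
        have h8 := h7.mul (Real.exp_nonneg _) hB0.le (hBT _ h5)
        rw [← map_mul, show γ⁻¹ * η * (ζ⁻¹ * (γ⁻¹ * η))⁻¹ = 1⁻¹ * ζ by group] at h8
        have h9 := hexp ⌊t⌋₊ ξ 1 ζ h1 h4 _ (by positivity) h8
        conv_rhs at h9 => rw [← Real.exp_log hB0, ← Real.exp_add]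
        have h10 := hlog _ _ h9
        rw [div_le_iff₀ (by positivity)]
        linarith
      rw [div_le_iff₀ (by positivity)] at h6
      calc (wordLength S (γ⁻¹ * η) : ℝ) ≤ W * (⌊t⌋₊ + 1) := h3
        _ ≤ W * (slDist (ρ γ) (ρ η) * (C₁ * 2) + C₁ * Real.log B + D₁ + 1) := by
            gcongr
            linarith
        _ = _ := by ring
    set C := max (W * C₁ * 2 + 1) (A + 1)
    have hC : 0 < C := lt_max_of_lt_right (by linarith)
    set E := max (W * (C₁ * Real.log B + D₁ + 1)) D + 1
    have hE : 0 < E := by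
      have : D ≤ max (W * (C₁ * Real.log B + D₁ + 1)) D := le_max_right _ _
      linarith
    refine ⟨C, E, hC, hE, fun γ η => ⟨?_, ?_⟩⟩
    · rw [sub_le_iff_le_add, inv_mul_le_iff₀ hC]
      have h1 : (W * C₁ * 2) * slDist (ρ γ) (ρ η) ≤ C * slDist (ρ γ) (ρ η) :=
        mul_le_mul_of_nonneg_right
          ((le_add_of_nonneg_right zero_le_one).trans (le_max_left _ _)) (slDist_nonneg _ _)
      have h2 : W * (C₁ * Real.log B + D₁ + 1) ≤ E :=
        (le_max_left _ _).trans (le_add_of_nonneg_right zero_le_one)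
      have h3 : E ≤ C * E :=
        le_mul_of_one_le_left hE.le ((le_add_of_nonneg_left hA).trans (le_max_right _ _))
      rw [mul_add]
      linarith [hlow γ η]
    · have h1 := slDist_le_slDist_one (ρ γ) (ρ η)
      rw [← map_inv, ← map_mul] at h1
      have h2 := hup (γ⁻¹ * η)
      have h3 : A * (wordLength S (γ⁻¹ * η) : ℝ) ≤ C * wordLength S (γ⁻¹ * η) := by
        gcongr
        exact (by linarith : A ≤ A + 1).trans (le_max_right _ _)
      have h4 : D ≤ E := (le_max_right _ _).trans (le_add_of_nonneg_right zero_le_one)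
      linarith

end QuasiIsometry
end FittingFlow

end

theorem corollary4p7 {n d : ℕ} (hd : 0 < d)
    {N M : Type*} [TopologicalSpace N] [T2Space N] [CompactSpace N] [ConnectedSpace N]
    [ChartedSpace (EuclideanSpace ℝ (Fin d)) N]
    [TopologicalSpace M] [SimplyConnectedSpace M]
    (π : M → N) (hπ : IsCoveringMap π)
    (ρ : deckGroup π →* Matrix.SpecialLinearGroup (Fin (2 * n)) ℝ)
    (u : M → GrMix d (2 * n)) (hcont : Continuous u) (hu : IsEquivariant ρ u)
    (Φ : Flow ℝ (SphereBundle u)) (hΦ : IsFittingFlow Φ) (hΦρ : IsEquivariantFlow hu Φ) :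
    Topology.IsEmbedding u ∧
    IsGloballyFitting u ∧
    (∀ δ : M → M → ℝ, IsInvariantLengthDist π δ →
      ∃ C D : ℝ, 0 < C ∧ 0 < D ∧ ∀ ξ : SphereBundle u,
        IsQuasiGeodesic δ C D (fun t => (Φ t ξ).proj)) ∧
    (∀ x y : M, ∃ (ξ : SphereBundle u) (t : ℝ), 0 ≤ t ∧ ξ.proj = x ∧ (Φ t ξ).proj = y) ∧
    IsQuasiIsometricEmbedding ρ := by
  have : LocallyPathConnectedSpace N :=
    ChartedSpace.locallyPathConnectedSpace (EuclideanSpace ℝ (Fin d)) N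
  have : PathConnectedSpace N := PathConnectedSpace.of_locallyPathConnectedSpace
  let _ := liftedCharts (EuclideanSpace ℝ (Fin d)) hπ
  have : LocallyPathConnectedSpace M :=
    ChartedSpace.locallyPathConnectedSpace (EuclideanSpace ℝ (Fin d)) M
  have : LocallyCompactSpace M := ChartedSpace.locallyCompactSpace (EuclideanSpace ℝ (Fin d)) M
  obtain ⟨K, hK, hKM⟩ := exists_compact_fundamental hπ
  obtain ⟨x⟩ : Nonempty M := inferInstance
  have hm := dim_ne_zero hd (u x)
  -- The dimension is nonzero because `u(x)` has positive dimension, and evenness then makes it at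
  -- least two, as generation by transvections requires.
  have : Nontrivial (Fin (2 * n)) := Fin.nontrivial_iff_two_le.mpr (by omega)
  have hline := exists_flow_line hπ hd hu hcont hΦ hΦρ hK hKM
  have hglob := isGloballyFitting_of_flow hcont hΦ hline
  exact ⟨⟨isInducing_of_flow hm hcont hΦ hline, injective_of_isGloballyFitting hm hglob⟩, hglob,
    fun δ hδ => isQuasiGeodesic_flow hδ hπ hu hcont hΦ hΦρ hK hKM, hline,
    isQuasiIsometricEmbedding_of_flow hπ hu hcont hΦ hΦρ hK hKM hline⟩
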